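/- Let $K$ be a field with an embedding $K\to\mathbb C$ and let $(A,\eta)$ be a finite-dimensional commutative Frobenius algebra over $K$, with counit $\epsilon(u)=\eta(1,u)$, coproduct $\delta$ and Euler element $\mathbf e=(m\circ\delta)(1)$, where $m$ is the product. Put $\Omega_{g,n}(v_1,\dots,v_n)=\epsilon(v_1\cdots v_n\,\mathbf e^{g})$, and for $f_1,f_2\in A^*$ put $\delta^*(f_1,f_2)=(f_1\otimes f_2)\circ\delta\in A^*$. Values in $K$ are regarded as complex numbers. For $\mu\in\mathbb Z_{+}^n$ let $D_{g,n}(\mu)=\sum_\gamma 1/|\mathrm{Aut}(\gamma)|$, where $\gamma$ runs over the isomorphism classes of dessins (connected cell graphs on a closed oriented surface) of genus $g$ with $n$ labelled vertices of degrees $\mu_1,\dots,\mu_n$, and isomorphisms and automorphisms fix the vertex labels. Let $\mathcal D_{g,n}(\mu;v)=D_{g,n}(\mu)\,\Omega_{g,n}(v)$ be the decorated count. Consider the spectral curve $$x=z+\tfrac1z,\qquad y=-z,\qquad z=\frac{t+1}{t-1},$$ and the Laplace transforms $$F_{g,n}(t)=\sum_{\mu\in\mathbb Z_+^n}D_{g,n}(\mu)\prod_i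 x(t_i)^{-\mu_i},\qquad \mathcal F_{g,n}(t;v)=\sum_{\mu\in\mathbb Z_+^n}\mathcal D_{g,n}(\mu;v)\prod_i x(t_i)^{-\mu_i}=F_{g,n}(t)\,\Omega_{g,n}(v),$$ which converge absolutely if $\mathrm{Re}\,t_i<0$ (that is, $|z_i|<1$) and all $|x(t_i)|$ are sufficiently large. Let $n\ge1$. For $2g-2+n>0$ the form $d_1\cdots d_nF_{g,n}$ extends from this region to a differential $W^D_{g,n}=w_{g,n}(t)\,dt_1\cdots dt_n$, where $w_{g,n}$ is a Laurent polynomial in $t_1^2,\dots,t_n^2$. Moreover $d_1d_2F_{0,2}$ extends to $W^D_{0,2}=dt_1dt_2/(t_1+t_2)^2$, and $W^D_{0,1}:=y\,dx$ satisfies $W^D_{0,1}=dF_{0,1}-dx/x$. The differentials $\mathcal W_{g,n}(t;v)=W^D_{g,n}(t)\,\Omega_{g,n}(v)$ thus extend $d_1\cdots d_n\mathcal F_{g,n}(t;v)$ for $(g,n)\ne(0,1)$. For all $g\ge0$, $n\ge1$ with $2g-2+n>0$ they satisfy the twisted Eynard–Orantin recursion $$\mathcal W_{g,n}(t_1,\dots,t_n;v_1,\dots,v_n)=\frac1{2\pi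 i}\int_\phi K^D(t,t_1)\Big[\mathcal W_{g-1,n+1}(t,-t,t_2,\dots,t_n;\delta(v_1),v_2,\dots,v_n)+\sum^{\text{no }(0,1)}_{\substack{g_1+g_2=g\\ I\sqcup J=\{2,\dots,n\}}}\delta^*\big(\mathcal W_{g_1,|I|+1}(t,t_I;-,v_I),\,\mathcal W_{g_2,|J|+1}(-t,t_J;-,v_J)\big)(v_1)\Big].$$ Here the first term is absent if $g=0$. In the sum the terms with $(g_1,|I|+1)=(0,1)$ or $(g_2,|J|+1)=(0,1)$ are omitted. For $(g,n)=(1,1)$, where $W^D_{0,2}$ is singular at $(t,-t)$, the differential $W^D_{0,2}(t,-t)$ in the first term is replaced by its regularization $W^D_{0,2}+\frac{dx_1dx_2}{(x_1-x_2)^2}=\frac{dt_1dt_2}{(t_1-t_2)^2}$ evaluated at $(t,-t)$. The kernel is $$K^D(t,t_1)=\frac12\,\frac{\int_t^{-t}W^D_{0,2}(\cdot,t_1)}{W^D_{0,1}(-t)-W^D_{0,1}(t)}=-\frac12\Big(\frac1{t+t_1}+\frac1{t-t_1}\Big)\frac1{32}\,\frac{(t^2-1)^3}{t^2}\,\frac1{dt}\,dt_1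 ,$$ where the integral in the numerator is along any path in $\mathbb C\setminus\{-t_1\}$. The contour $\phi$ consists of the positively oriented circle $|t|=\varepsilon$ and the negatively oriented circle $|t|=1/\varepsilon$, for any $\varepsilon>0$ with $\varepsilon<|t_i|<1/\varepsilon$ for $i=1,\dots,n$. -/

import Mathlib

open scoped TensorProduct BigOperators

/-! ### Dessins and their weighted count -/

/-- A dessin (connected cell graph on a closed oriented surface) of genus `g` with `n` labelled
vertices of prescribed degrees `μ`, presented as a rotation system on the set of its half-edges
`Fin (∑ i, μ i)`: `σ` turns around the vertices, `α` exchanges the two halves of each edge, and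
the cycles of `σ * α` are the faces. -/
structure Dessin (g n : ℕ) (μ : Fin n → ℕ) where
  /-- rotation around the vertices -/
  σ : Equiv.Perm (Fin (∑ i, μ i))
  /-- the edge involution -/
  α : Equiv.Perm (Fin (∑ i, μ i))
  /-- the labelled vertex to which a half-edge is attached -/
  vertex : Fin (∑ i, μ i) → Fin n
  α_mul_self : α * α = 1
  α_ne : ∀ h, α h ≠ h
  vertex_eq_iff : ∀ h h', vertex h = vertex h' ↔ σ.SameCycle h h'
  degree : ∀ i, Nat.card {h // vertex h = i} = μ i
  connected : MulAction.IsPretransitive (Subgroup.closure {σ, α}) (Fin (∑ i, μ i))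
  /-- Euler's formula `n - N / 2 + #faces = 2 - 2 g`, where `N` is the number of half-edges. -/
  euler : 2 * (n + Nat.card (Quotient (Equiv.Perm.SameCycle.setoid (σ * α))) + 2 * g)
    = (∑ i, μ i) + 4

namespace Dessin

variable {g n : ℕ} {μ : Fin n → ℕ}

/-- `τ` is an (orientation preserving) isomorphism of dessins which preserves every labelled
vertex. -/
def IsIso (γ γ' : Dessin g n μ) (τ : Equiv.Perm (Fin (∑ i, μ i))) : Prop :=
  τ * γ.σ = γ'.σ * τ ∧ τ * γ.α = γ'.α * τ ∧ ∀ h, γ'.vertex (τ h) = γ.vertex h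

/-- Isomorphism of dessins. -/
instance isoSetoid (g n : ℕ) (μ : Fin n → ℕ) : Setoid (Dessin g n μ) where
  r γ γ' := ∃ τ, IsIso γ γ' τ
  iseqv :=
    { refl := fun _ => ⟨1, by simp [IsIso]⟩
      symm := by
        rintro γ γ' ⟨τ, h1, h2, h3⟩
        refine ⟨τ⁻¹, ?_, ?_, fun h => ?_⟩
        · rw [inv_mul_eq_iff_eq_mul, ← mul_assoc, h1, mul_assoc, mul_inv_cancel, mul_one]
        · rw [inv_mul_eq_iff_eq_mul, ← mul_assoc, h2, mul_assoc, mul_inv_cancel, mul_one]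
        · simpa using (h3 (τ⁻¹ h)).symm
      trans := by
        rintro γ γ' γ'' ⟨τ, h1, h2, h3⟩ ⟨τ', k1, k2, k3⟩
        refine ⟨τ' * τ, ?_, ?_, fun h => ?_⟩
        · rw [mul_assoc, h1, ← mul_assoc, k1, mul_assoc]
        · rw [mul_assoc, h2, ← mul_assoc, k2, mul_assoc]
        · rw [Equiv.Perm.mul_apply, k3, h3] }

/-- The number of automorphisms of a dessin which preserve every vertex. -/
noncomputable def autCard (γ : Dessin g n μ) : ℕ := Nat.card {τ // IsIso γ γ τ}

end Dessin

/-- `D_{g,n}(μ)`: the number of isomorphism classes of dessins `γ` of type `(g,n)` with vertex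
degrees `μ`, each counted with weight `1 / |Aut γ|`. -/
noncomputable def dessinCount (g n : ℕ) (μ : Fin n → ℕ) : ℚ :=
  ∑ᶠ c : Quotient (Dessin.isoSetoid g n μ), (1 : ℚ) / (Dessin.autCard c.out : ℚ)

/-! ### Frobenius algebras -/

/-- A Frobenius structure on a commutative algebra: a nondegenerate symmetric invariant
bilinear form. -/
structure FrobeniusForm (K A : Type*) [Field K] [CommRing A] [Algebra K A] where
  /-- the pairing -/
  η : LinearMap.BilinForm K A
  symm : ∀ u v, η u v = η v u
  nondegenerate : η.Nondegenerate
  invariant : ∀ u v w, η (u * v) w = η u (v * w)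

namespace FrobeniusForm

variable {K A ι : Type*} [Field K] [CommRing A] [Algebra K A] [Fintype ι] [DecidableEq ι]

/-- The Frobenius form (counit) `ε u = η (1, u)`. -/
noncomputable def counit (Fr : FrobeniusForm K A) : A →ₗ[K] K := Fr.η 1

/-- The inverse matrix `(η^{ij})` of `η_{ij} = η (e_i, e_j)`. -/
noncomputable def etaInv (Fr : FrobeniusForm K A) (e : Module.Basis ι K A) : Matrix ι ι K :=
  (Matrix.of fun i j => Fr.η (e i) (e j))⁻¹

/-- The coproduct `δ v = ∑ φ(v, e_i, e_j) η^{ia} η^{jb} e_a ⊗ e_b`, where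
`φ(u, v, w) = η (u v, w)`. -/
noncomputable def coproduct (Fr : FrobeniusForm K A) (e : Module.Basis ι K A) :
    A →ₗ[K] A ⊗[K] A :=
  ∑ i, ∑ j, ∑ a, ∑ b,
    (((Fr.η.flip (e j)) ∘ₗ LinearMap.mulRight K (e i)).smulRight
      ((Fr.etaInv e i a * Fr.etaInv e j b) • (e a ⊗ₜ[K] e b)))

/-- The Euler element `(m ∘ δ) 1`. -/
noncomputable def euler (Fr : FrobeniusForm K A) (e : Module.Basis ι K A) : A :=
  LinearMap.mul' K A (Fr.coproduct e 1)

variable [Algebra K ℂ]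

/-- The 2D TQFT `Ω_{g,n}(v_1, …, v_n) = ε(v_1 ⋯ v_n · 𝐞^g)` of the Frobenius algebra, with values
regarded as complex numbers. -/
noncomputable def Omega (Fr : FrobeniusForm K A) (e : Module.Basis ι K A) (g n : ℕ) :
    MultilinearMap K (fun _ : Fin n => A) ℂ :=
  (Algebra.linearMap K ℂ ∘ₗ Fr.counit ∘ₗ LinearMap.mulRight K (Fr.euler e ^ g)).compMultilinearMap
    (MultilinearMap.mkPiAlgebra K (Fin n) A)

/-- The map dual to the coproduct: it sends a bilinear form `B` to `v ↦ B (δ v)`. -/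
noncomputable def coproductDual (Fr : FrobeniusForm K A) (e : Module.Basis ι K A)
    (B : A →ₗ[K] A →ₗ[K] ℂ) : A →ₗ[K] ℂ :=
  TensorProduct.lift B ∘ₗ Fr.coproduct e

/-- The kernel operator `δ* : A* ⊗ A* → A*`, `δ* (f₁, f₂) = (f₁ ⊗ f₂) ∘ δ`. -/
noncomputable def deltaStar (Fr : FrobeniusForm K A) (e : Module.Basis ι K A)
    (f₁ f₂ : A →ₗ[K] ℂ) : A →ₗ[K] ℂ :=
  Fr.coproductDual e ((LinearMap.mul K ℂ).compl₁₂ f₁ f₂)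

end FrobeniusForm

section Slots

variable {K A : Type*} [Field K] [CommRing A] [Algebra K A] [Algebra K ℂ]

/-- `a ↦ f (a, v_1, …, v_n)`. -/
def firstSlot {n : ℕ} (f : MultilinearMap K (fun _ : Fin (n + 1) => A) ℂ) (v : Fin n → A) :
    A →ₗ[K] ℂ where
  toFun a := f (Fin.cons a v)
  map_add' a b := f.cons_add v a b
  map_smul' c a := f.cons_smul v c a

/-- `(a, b) ↦ f (a, b, v_1, …, v_n)`. -/
def firstTwoSlots {n : ℕ} (f : MultilinearMap K (fun _ : Fin (n + 2) => A) ℂ) (v : Fin n → A) :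
    A →ₗ[K] A →ₗ[K] ℂ where
  toFun a := firstSlot (f.curryLeft a) v
  map_add' a b := by ext; simp [firstSlot]
  map_smul' c a := by ext; simp [firstSlot]

end Slots

/-! ### The spectral curve and the Laplace transforms -/

/-- The coordinate `z` on the spectral curve as a function of `t`. -/
noncomputable def zOf (t : ℂ) : ℂ := (t + 1) / (t - 1)

/-- `x = z + 1 / z`; this is also `e ^ w`. -/
noncomputable def xOf (t : ℂ) : ℂ := zOf t + 1 / zOf t

/-- `y = - z`. -/
noncomputable def yOf (t : ℂ) : ℂ := -zOf t

/-- The points with `0 < |z_i| < 1` (that is, `Re t_i < 0`) and `|x_i| > R` for all `i`: a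
neighbourhood of `x = ∞` in the `n`-th power of the sheet `z ∼ 1 / x` of the spectral curve. -/
def nearInfinity (n : ℕ) (R : ℝ) : Set (Fin n → ℂ) :=
  {t | ∀ i, (t i).re < 0 ∧ R < ‖xOf (t i)‖}

/-- `e ^ (-(w_1 μ_1 + ⋯ + w_n μ_n))`, where `e ^ (w_i) = x_i`. -/
noncomputable def laplaceWeight {n : ℕ} (μ : Fin n → ℕ+) (t : Fin n → ℂ) : ℂ :=
  ∏ i, ((xOf (t i))⁻¹) ^ (μ i : ℕ)

/-- The Laplace transform `F_{g,n}` of the dessin count, in the coordinates `t_i`. -/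
noncomputable def dessinLaplace (g n : ℕ) (t : Fin n → ℂ) : ℂ :=
  ∑' μ : Fin n → ℕ+, (dessinCount g n (fun i => (μ i : ℕ)) : ℂ) * laplaceWeight μ t

/-- The partial derivative of `f` in the `i`-th variable. -/
noncomputable def partialDeriv {n : ℕ} (i : Fin n) (f : (Fin n → ℂ) → ℂ) : (Fin n → ℂ) → ℂ :=
  fun t => deriv (fun s => f (Function.update t i s)) (t i)

/-- `∂^n f / ∂t_1 ⋯ ∂t_n`, the coefficient of `d_1 ⋯ d_n f` with respect to `dt_1 ⋯ dt_n`. -/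
noncomputable def mixedDeriv {n : ℕ} (f : (Fin n → ℂ) → ℂ) : (Fin n → ℂ) → ℂ :=
  (List.finRange n).foldr partialDeriv f

/-- `w` is a Laurent polynomial in `t_1 ^ 2, …, t_n ^ 2`. -/
def IsEvenLaurent {n : ℕ} (w : (Fin n → ℂ) → ℂ) : Prop :=
  ∃ (P : MvPolynomial (Fin n) ℂ) (N : ℕ), ∀ t : Fin n → ℂ, (∀ i, t i ≠ 0) →
    w t = MvPolynomial.eval (fun i => t i ^ 2) P / ∏ i, (t i ^ 2) ^ N

/-- The coefficient of `W_{0,1} = y dx` with respect to `dt`. -/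
noncomputable def w01 (t : ℂ) : ℂ := yOf t * deriv xOf t

/-- The coefficient of `W_{0,2} = dt_1 dt_2 / (t_1 + t_2) ^ 2`. -/
noncomputable def w02 (t₁ t₂ : ℂ) : ℂ := 1 / (t₁ + t₂) ^ 2

/-- A family `w` of coefficient functions with the one of type `(0,2)` replaced by the coefficient
of `W_{0,2} + dx_1 dx_2 / (x_1 - x_2) ^ 2 = dt_1 dt_2 / (t_1 - t_2) ^ 2`. -/
noncomputable def regularized (w : (g n : ℕ) → (Fin n → ℂ) → ℂ) :
    (g n : ℕ) → (Fin n → ℂ) → ℂ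
  | 0, 2, t => 1 / (t 0 - t 1) ^ 2
  | g, n, t => w g n t

/-- The recursion kernel `K^D(t, t₁)`, as the coefficient of `dt₁ / dt`. -/
noncomputable def kernelD (t t₁ : ℂ) : ℂ :=
  -(1 / 2) * (1 / (t + t₁) + 1 / (t - t₁)) * (1 / 32) * ((t ^ 2 - 1) ^ 3 / t ^ 2)

/-! ### Twisted counts, twisted differentials and the recursion -/

section Twisted

variable {K A ι : Type*} [Field K] [CommRing A] [Algebra K A] [Fintype ι] [DecidableEq ι]
  [Algebra K ℂ]

/-- The number `𝒟_{g,n}(μ; v_1, …, v_n) = D_{g,n}(μ) Ω_{g,n}(v_1, …, v_n)` of decorated dessins. -/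
noncomputable def decoratedCount (Fr : FrobeniusForm K A) (e : Module.Basis ι K A) (g n : ℕ)
    (μ : Fin n → ℕ) : MultilinearMap K (fun _ : Fin n => A) ℂ :=
  (dessinCount g n μ : ℂ) • Fr.Omega e g n

/-- The Laplace transform `ℱ_{g,n}(t; v)` of the decorated count. -/
noncomputable def twistedLaplace (Fr : FrobeniusForm K A) (e : Module.Basis ι K A) (g n : ℕ)
    (t : Fin n → ℂ) (v : Fin n → A) : ℂ :=
  ∑' μ : Fin n → ℕ+, decoratedCount Fr e g n (fun i => (μ i : ℕ)) v * laplaceWeight μ t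

/-- The coefficient of `𝒲_{g,n}(t; v) = W_{g,n}(t) Ω_{g,n}(v)` with respect to `dt_1 ⋯ dt_n`, where
`w g n` is the coefficient of `W_{g,n}`. -/
noncomputable def twisted (Fr : FrobeniusForm K A) (e : Module.Basis ι K A)
    (w : (g n : ℕ) → (Fin n → ℂ) → ℂ) (g n : ℕ) (t : Fin n → ℂ) :
    MultilinearMap K (fun _ : Fin n => A) ℂ :=
  w g n t • Fr.Omega e g n

/-- The term `𝒲_{g-1,n+1}(t, -t, t_2, …, t_n; δ(v_1), v_2, …, v_n)`, which is absent for `g = 0`;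
`t'` and `v'` stand for `(t_2, …, t_n)` and `(v_2, …, v_n)`. The sign is that of `d(-t) = -dt`. -/
noncomputable def connectedTerm (Fr : FrobeniusForm K A) (e : Module.Basis ι K A)
    (w : (g n : ℕ) → (Fin n → ℂ) → ℂ) {m : ℕ} (t : ℂ) (t' : Fin m → ℂ) (v₁ : A)
    (v' : Fin m → A) : ℕ → ℂ
  | 0 => 0
  | g + 1 => -Fr.coproductDual e
      (firstTwoSlots (twisted Fr e (regularized w) g (m + 2) (Fin.cons t (Fin.cons (-t) t'))) v') v₁

/-- The functional `a ↦ 𝒲_{g,|I|+1}(t, t_I; a, v_I)`. -/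
noncomputable def partialForm (Fr : FrobeniusForm K A) (e : Module.Basis ι K A)
    (w : (g n : ℕ) → (Fin n → ℂ) → ℂ) (g : ℕ) {m : ℕ} (I : Finset (Fin m)) (t : ℂ)
    (t' : Fin m → ℂ) (v' : Fin m → A) : A →ₗ[K] ℂ :=
  firstSlot (twisted Fr e w g (I.card + 1) (Fin.cons t fun k => t' (I.orderEmbOfFin rfl k)))
    (fun k => v' (I.orderEmbOfFin rfl k))

/-- The sum over `g₁ + g₂ = g` and `I ⊔ J = {2, …, n}` without `(0,1)` terms of
`δ*(𝒲_{g₁,|I|+1}(t, t_I; -, v_I), 𝒲_{g₂,|J|+1}(-t, t_J; -, v_J))(v_1)`.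
The sign is that of `d(-t) = -dt`. -/
noncomputable def splitTerm (Fr : FrobeniusForm K A) (e : Module.Basis ι K A)
    (w : (g n : ℕ) → (Fin n → ℂ) → ℂ) (g : ℕ) {m : ℕ} (t : ℂ) (t' : Fin m → ℂ) (v₁ : A)
    (v' : Fin m → A) : ℂ :=
  ∑ p ∈ Finset.HasAntidiagonal.antidiagonal g, ∑ I : Finset (Fin m),
    if (p.1 = 0 ∧ I = ∅) ∨ (p.2 = 0 ∧ Iᶜ = ∅) then 0
    else -Fr.deltaStar e (partialForm Fr e w p.1 I t t' v') (partialForm Fr e w p.2 Iᶜ (-t) t' v') v₁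

/-- The integrand of the twisted recursion for `𝒲_{g,m+1}(t_1, …, t_{m+1}; v_1, …, v_{m+1})`, as
the coefficient of `dt` times `dt_1 ⋯ dt_{m+1}`. -/
noncomputable def recursionIntegrand (Fr : FrobeniusForm K A) (e : Module.Basis ι K A)
    (w : (g n : ℕ) → (Fin n → ℂ) → ℂ) (g : ℕ) {m : ℕ} (t : Fin (m + 1) → ℂ) (v : Fin (m + 1) → A)
    (s : ℂ) : ℂ :=
  kernelD s (t 0) *
    (connectedTerm Fr e w s (Fin.tail t) (v 0) (Fin.tail v) g
      + splitTerm Fr e w g s (Fin.tail t) (v 0) (Fin.tail v))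

end Twisted

/-!
The weighted count of dessins is reduced to a count of gluings: `gluingCount g n μ` counts the
connected perfect matchings of the half-edges `Σ i, Fin (μ i)` of genus `g`, and by orbit counting
`D_{g,n}(μ) μ_1 ⋯ μ_n = gluingCount g n μ` (`dessinCount_mul_prod`). The factor `μ_1 ⋯ μ_n` is what
`d_1 ⋯ d_n` produces from `∏ x(t_i)^{-μ_i}`, so that `d_1 ⋯ d_n F_{g,n}` is the generating function
of the gluings (`sheetForm`).

The recursion for the number of gluings under removal of an edge is obtained from the Gaussian
matrix model. Integration by parts gives the loop equation for the expectation of a product of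
traces (`loop_equation`), Wick's theorem identifies this expectation with the sum of
`N ^ (number of faces)` over all gluings (`expect_prod_trPow`), the passage from all gluings to
connected ones is an inversion with respect to the convolution of set functions
(`connSumOn_recursion`), and comparison of the coefficients of the powers of `N` isolates the genus
(`gluingCount_cons_succ`). The recursion also yields an exponential bound for the number of gluings
of bounded complexity, hence the convergence of all generating functions (`exists_gluingCount_le`).

On the sheet `z ∼ 1 / x` the recursion becomes a quadratic loop equation (`genFun_loop`). Solving it
for types `(0,1)` and `(0,2)` gives `y dx` and `dt_1 dt_2 / (t_1 + t_2)^2`. In general it expresses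
`W_{g,n}(t_1, …, t_n)` through differentials of smaller complexity, evaluated at `t_1`, and through
their values and first derivatives at the points `t_j` (`GrowthBound.sheetForm_recursion`).

On the other hand the integrand of the topological recursion is, apart from the type `(0,3)`, a sum
of even Laurent polynomials in `t` multiplied by `t / (t^2 - t_1^2)` and possibly by
`2 (t^2 + t_j^2) / (t^2 - t_j^2)^2`. For these products the contour integral is again an even
Laurent polynomial, which for generic points is minus the sum of the residues at `± t_1` and
`± t_j` (`EvenLaurent.hasContour_simple`, `EvenLaurent.exists_hasContour_double`); the type `(0,3)`
is computed from the poles at `0` and `∞` (`hasContour_three`). The differentials `dessinForm`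
defined by the recursion are therefore even Laurent polynomials and satisfy the same evaluated
recursion as `d_1 ⋯ d_n F_{g,n}` on the sheet `z ∼ 1 / x`, and so agree with it there by induction on
`2 g + n`, by continuity also at the points with `t_1 = t_j`
(`GrowthBound.dessinForm_eq_sheetForm`).

Finally the Frobenius algebra factors out: multiplying the two legs of `δ v` gives `v 𝐞`, and
contracting `ε(· p) ⊗ ε(· q)` with `δ v` gives `ε(v p q)`, so that every term of the twisted
integrand is `Ω_{g,n}(v)` times the untwisted one (`recursionIntegrand_eq`).
-/

set_option linter.unusedSectionVars false

namespace DessinRecursion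

/-! ### The Gaussian functional -/

section Gaussian

open MvPolynomial

variable {κ : Type*} [Fintype κ] [DecidableEq κ]

/-- The operator `½ ∑ₐ ∂ₐ ∂_{ι a}`, the generator of the Gaussian functional whose covariance
pairs the variable `a` with the variable `ι a`. -/
noncomputable def gaussLaplacian (ι : κ → κ) : MvPolynomial κ ℚ →ₗ[ℚ] MvPolynomial κ ℚ :=
  (1 / 2 : ℚ) • ∑ a, (pderiv a : Derivation ℚ _ _).toLinearMap ∘ₗ
    (pderiv (ι a) : Derivation ℚ _ _).toLinearMap

lemma gaussLaplacian_apply (ι : κ → κ) (p : MvPolynomial κ ℚ) :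
    gaussLaplacian ι p = (1 / 2 : ℚ) • ∑ a, pderiv a (pderiv (ι a) p) := by
  simp [gaussLaplacian, LinearMap.sum_apply]

lemma pderiv_comm (a b : κ) (p : MvPolynomial κ ℚ) :
    pderiv a (pderiv b p) = pderiv b (pderiv a p) := by
  induction p using MvPolynomial.induction_on with
  | C r => simp
  | add p q hp hq => simp [hp, hq]
  | mul_X p c hp =>
    simp only [pderiv_mul, map_add, pderiv_X, hp]
    by_cases h1 : c = a <;> by_cases h2 : c = b <;>
      simp [h1, h2, Pi.single_apply] <;> split_ifs <;> simp <;> ring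

lemma gaussLaplacian_pderiv (ι : κ → κ) (b : κ) (p : MvPolynomial κ ℚ) :
    gaussLaplacian ι (pderiv b p) = pderiv b (gaussLaplacian ι p) := by
  rw [gaussLaplacian_apply, gaussLaplacian_apply, Derivation.map_smul, map_sum]
  congr 1
  refine Finset.sum_congr rfl fun a _ => ?_
  rw [pderiv_comm (ι a) b, pderiv_comm a b]

lemma gaussLaplacian_X_mul {ι : κ → κ} (hι : Function.Involutive ι) (b : κ)
    (p : MvPolynomial κ ℚ) :
    gaussLaplacian ι (X b * p) = X b * gaussLaplacian ι p + pderiv (ι b) p := by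
  have key : ∀ a, pderiv a (pderiv (ι a) (X b * p)) =
      X b * pderiv a (pderiv (ι a) p) + (if a = b then pderiv (ι b) p else 0)
        + (if a = ι b then pderiv (ι b) p else 0) := by
    intro a
    have h : (b = ι a) ↔ (a = ι b) := ⟨fun h => by rw [h, hι], fun h => by rw [h, hι]⟩
    simp only [pderiv_mul, map_add, pderiv_X, Pi.single_apply]
    simp only [h]
    by_cases h1 : a = b
    · subst h1
      by_cases h2 : a = ι a
      · simp [← h2]
        ring
      · simp [h2]
        ring
    · by_cases h2 : a = ι b
      · subst h2
        simp [h1, Ne.symm h1, hι b]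
        ring
      · simp [h1, h2, Ne.symm h1]
  rw [gaussLaplacian_apply, gaussLaplacian_apply, Finset.sum_congr rfl fun a _ => key a,
    Finset.sum_add_distrib, Finset.sum_add_distrib, ← Finset.mul_sum]
  simp only [Finset.sum_ite_eq', Finset.mem_univ, if_true]
  rw [smul_add, smul_add, add_assoc, ← add_smul, mul_smul_comm]
  norm_num

lemma gaussLaplacian_pow_X_mul {ι : κ → κ} (hι : Function.Involutive ι) (b : κ)
    (p : MvPolynomial κ ℚ) (k : ℕ) :
    (gaussLaplacian ι ^ (k + 1)) (X b * p) = X b * (gaussLaplacian ι ^ (k + 1)) p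
      + (k + 1 : ℚ) • (gaussLaplacian ι ^ k) (pderiv (ι b) p) := by
  induction k with
  | zero => simp [gaussLaplacian_X_mul hι]
  | succ k ih =>
    rw [pow_succ', Module.End.mul_apply, ih, map_add, map_smul, gaussLaplacian_X_mul hι]
    have h : pderiv (ι b) ((gaussLaplacian ι ^ (k + 1)) p)
        = (gaussLaplacian ι ^ (k + 1)) (pderiv (ι b) p) := by
      generalize k + 1 = j
      induction j with
      | zero => simp
      | succ j ihj =>
        rw [pow_succ', Module.End.mul_apply, ← gaussLaplacian_pderiv, ihj, ← Module.End.mul_apply]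
    rw [h, ← Module.End.mul_apply, ← pow_succ', ← Module.End.mul_apply, ← pow_succ']
    push_cast
    rw [add_assoc, add_smul ((k : ℚ) + 1), one_smul, add_comm (_ • _)]

lemma exists_gaussLaplacian_pow_eq_zero {ι : κ → κ} (hι : Function.Involutive ι)
    (p : MvPolynomial κ ℚ) : ∃ K : ℕ, ∀ k ≥ K, (gaussLaplacian ι ^ k) p = 0 := by
  suffices h : ∃ K : ℕ, (gaussLaplacian ι ^ K) p = 0 by
    obtain ⟨K, hK⟩ := h
    refine ⟨K, fun k hk => ?_⟩
    obtain ⟨j, rfl⟩ := Nat.exists_eq_add_of_le hk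
    rw [add_comm, pow_add, Module.End.mul_apply, hK, map_zero]
  have mono : ∀ (q : MvPolynomial κ ℚ) (K j : ℕ), (gaussLaplacian ι ^ K) q = 0 →
      (gaussLaplacian ι ^ (j + K)) q = 0 := fun q K j h => by
    rw [pow_add, Module.End.mul_apply, h, map_zero]
  induction p using MvPolynomial.induction_on with
  | C r => exact ⟨1, by simp [gaussLaplacian_apply]⟩
  | add p q hp hq =>
    obtain ⟨K, hK⟩ := hp
    obtain ⟨K', hK'⟩ := hq
    refine ⟨K + K', ?_⟩
    rw [map_add, mono q K' K hK', add_comm K K', mono p K K' hK, add_zero]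
  | mul_X p c hp =>
    obtain ⟨K, hK⟩ := hp
    refine ⟨K + 1, ?_⟩
    have h : pderiv (ι c) ((gaussLaplacian ι ^ K) p)
        = (gaussLaplacian ι ^ K) (pderiv (ι c) p) := by
      clear hK
      induction K with
      | zero => simp
      | succ j ihj =>
        rw [pow_succ', Module.End.mul_apply, ← gaussLaplacian_pderiv, ihj, ← Module.End.mul_apply]
    rw [mul_comm, gaussLaplacian_pow_X_mul hι, add_comm K 1, mono p K 1 hK, ← h, hK]
    simp

/-- The Gaussian functional with covariance `⟨X_a X_b⟩ = 1` if `b = ι a` and `0` otherwise, that is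
`p ↦ (exp (½ ∑ₐ ∂ₐ ∂_{ι a}) p)(0)`. -/
noncomputable def gauss {ι : κ → κ} (hι : Function.Involutive ι) : MvPolynomial κ ℚ →ₗ[ℚ] ℚ where
  toFun p := ∑ᶠ k : ℕ, (k.factorial : ℚ)⁻¹ * constantCoeff ((gaussLaplacian ι ^ k) p)
  map_add' p q := by
    obtain ⟨K, hK⟩ := exists_gaussLaplacian_pow_eq_zero hι p
    obtain ⟨K', hK'⟩ := exists_gaussLaplacian_pow_eq_zero hι q
    rw [← finsum_add_distrib]
    · exact finsum_congr fun k => by rw [map_add, map_add, mul_add]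
    · refine (Set.finite_lt_nat K).subset fun k hk => ?_
      by_contra h
      exact hk (by simp [hK k (not_lt.1 h)])
    · refine (Set.finite_lt_nat K').subset fun k hk => ?_
      by_contra h
      exact hk (by simp [hK' k (not_lt.1 h)])
  map_smul' r p := by
    rw [RingHom.id_apply, smul_eq_mul, mul_finsum]
    exact finsum_congr fun k => by
      rw [map_smul, constantCoeff_smul, smul_eq_mul, mul_left_comm]

lemma gauss_one {ι : κ → κ} (hι : Function.Involutive ι) : gauss hι 1 = 1 := by
  change ∑ᶠ k : ℕ, (k.factorial : ℚ)⁻¹ * constantCoeff ((gaussLaplacian ι ^ k) 1) = 1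
  rw [finsum_eq_single _ 0]
  · simp
  · intro k hk
    obtain ⟨j, rfl⟩ := Nat.exists_eq_succ_of_ne_zero hk
    rw [Nat.succ_eq_add_one, pow_succ, Module.End.mul_apply]
    simp [gaussLaplacian_apply]

/-- Gaussian integration by parts. -/
lemma gauss_X_mul {ι : κ → κ} (hι : Function.Involutive ι) (b : κ) (p : MvPolynomial κ ℚ) :
    gauss hι (X b * p) = gauss hι (pderiv (ι b) p) := by
  obtain ⟨K, hK⟩ := exists_gaussLaplacian_pow_eq_zero hι (X b * p)
  obtain ⟨K', hK'⟩ := exists_gaussLaplacian_pow_eq_zero hι (pderiv (ι b) p)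
  change ∑ᶠ k : ℕ, (k.factorial : ℚ)⁻¹ * constantCoeff ((gaussLaplacian ι ^ k) (X b * p))
    = ∑ᶠ k : ℕ, (k.factorial : ℚ)⁻¹ * constantCoeff ((gaussLaplacian ι ^ k) (pderiv (ι b) p))
  rw [finsum_eq_sum_of_support_subset (s := Finset.range (K + K' + 1)),
    finsum_eq_sum_of_support_subset (s := Finset.range (K + K')), Finset.sum_range_succ']
  · simp only [pow_zero, Module.End.one_apply, map_mul, constantCoeff_X, zero_mul, mul_zero,
      add_zero]
    refine Finset.sum_congr rfl fun k _ => ?_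
    rw [gaussLaplacian_pow_X_mul hι, map_add, map_mul, constantCoeff_X, zero_mul, zero_add,
      constantCoeff_smul, smul_eq_mul, Nat.factorial_succ]
    push_cast
    field_simp
  · intro k hk
    simp only [Finset.coe_range, Set.mem_Iio]
    by_contra h
    exact hk (by simp [hK' k (by omega)])
  · intro k hk
    simp only [Finset.coe_range, Set.mem_Iio]
    by_contra h
    exact hk (by simp [hK k (by omega)])

end Gaussian

/-! ### Loop equations of the Gaussian matrix model -/

section Loop

open MvPolynomial

variable (N : ℕ)

/-- The polynomial ring in the entries of an `N × N` matrix. -/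
abbrev MatPoly : Type := MvPolynomial (Fin N × Fin N) ℚ

/-- The generic `N × N` matrix. -/
noncomputable def genMat : Matrix (Fin N) (Fin N) (MatPoly N) := Matrix.of fun i j => X (i, j)

/-- The trace of the `k`-th power of the generic matrix. -/
noncomputable def trPow (k : ℕ) : MatPoly N := (genMat N ^ k).trace

lemma swap_involutive : Function.Involutive (Prod.swap : Fin N × Fin N → Fin N × Fin N) :=
  fun p => Prod.swap_swap p

/-- The expectation in the Gaussian Hermitian matrix model: `⟨M_ij M_kl⟩ = 1` if `(k, l) = (j, i)`
and `0` otherwise. -/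
noncomputable def expect : MatPoly N →ₗ[ℚ] ℚ := gauss (swap_involutive N)

variable {N}

lemma pderiv_genMat_pow (k l i j : Fin N) (a : ℕ) :
    pderiv (k, l) ((genMat N ^ a) i j)
      = ∑ p ∈ Finset.range a, (genMat N ^ p) i k * (genMat N ^ (a - 1 - p)) l j := by
  induction a generalizing i j with
  | zero =>
    by_cases h : i = j <;> simp [h]
  | succ a ih =>
    rw [pow_succ', Matrix.mul_apply, map_sum, Finset.sum_range_succ']
    simp only [pderiv_mul, ih]
    rw [Finset.sum_add_distrib, add_comm]
    congr 1
    · simp only [Finset.mul_sum]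
      rw [Finset.sum_comm]
      refine Finset.sum_congr rfl fun p _ => ?_
      rw [pow_succ', Matrix.mul_apply, Finset.sum_mul]
      refine Finset.sum_congr rfl fun x _ => ?_
      rw [show a + 1 - 1 - (p + 1) = a - 1 - p by omega, mul_assoc]
    · rw [Finset.sum_eq_single l]
      · by_cases h : i = k
        · simp [genMat, h]
        · have : (i, l) ≠ (k, l) := fun h' => h (Prod.ext_iff.1 h').1
          simp [genMat, h, pderiv_X_of_ne this]
      · intro x _ hx
        have : (i, x) ≠ (k, l) := fun h' => hx (Prod.ext_iff.1 h').2
        simp [genMat, pderiv_X_of_ne this]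
      · simp

lemma pderiv_trPow (i j : Fin N) (a : ℕ) :
    pderiv (j, i) (trPow N a) = (a : MatPoly N) * (genMat N ^ (a - 1)) i j := by
  rw [trPow, Matrix.trace, map_sum]
  simp only [Matrix.diag, pderiv_genMat_pow]
  rw [Finset.sum_comm]
  have : ∀ p ∈ Finset.range a, ∑ l, (genMat N ^ p) l j * (genMat N ^ (a - 1 - p)) i l
      = (genMat N ^ (a - 1)) i j := by
    intro p hp
    rw [Finset.mem_range] at hp
    rw [show a - 1 = (a - 1 - p) + p by omega, pow_add, Matrix.mul_apply,
      show a - 1 - p + p - p = a - 1 - p by omega]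
    exact Finset.sum_congr rfl fun l _ => mul_comm _ _
  rw [Finset.sum_congr rfl this]
  simp

lemma pderiv_prod {κ U : Type*} [DecidableEq U] (b : κ) (S : Finset U)
    (f : U → MvPolynomial κ ℚ) :
    pderiv b (∏ v ∈ S, f v) = ∑ v ∈ S, pderiv b (f v) * ∏ w ∈ S.erase v, f w := by
  induction S using Finset.induction_on with
  | empty => simp
  | insert v S hv ih =>
    rw [Finset.prod_insert hv, pderiv_mul, ih, Finset.sum_insert hv, Finset.erase_insert hv,
      Finset.mul_sum]
    congr 1
    refine Finset.sum_congr rfl fun w hw => ?_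
    have hvw : v ≠ w := fun h => hv (h ▸ hw)
    rw [Finset.erase_insert_of_ne hvw, Finset.prod_insert (fun h => hv (Finset.mem_of_mem_erase h))]
    ring

/-- The loop equation (Schwinger–Dyson equation) of the Gaussian matrix model. -/
theorem loop_equation {U : Type*} [DecidableEq U] (deg : U → ℕ) (S : Finset U) (a : ℕ) :
    expect N (trPow N (a + 1) * ∏ v ∈ S, trPow N (deg v))
      = ∑ p ∈ Finset.range a,
          expect N (trPow N p * trPow N (a - 1 - p) * ∏ v ∈ S, trPow N (deg v))
        + ∑ v ∈ S, (deg v : ℚ) *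
            expect N (trPow N (a + deg v - 1) * ∏ w ∈ S.erase v, trPow N (deg w)) := by
  set q := ∏ v ∈ S, trPow N (deg v) with hq
  have h1 : trPow N (a + 1) * q = ∑ i, ∑ j, X (i, j) * ((genMat N ^ a) j i * q) := by
    rw [trPow, pow_succ', Matrix.trace, Finset.sum_mul]
    refine Finset.sum_congr rfl fun i _ => ?_
    rw [Matrix.diag, Matrix.mul_apply, Finset.sum_mul]
    exact Finset.sum_congr rfl fun j _ => by rw [mul_assoc]; rfl
  have h2 : ∀ i j : Fin N, pderiv (j, i) ((genMat N ^ a) j i * q)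
      = ∑ p ∈ Finset.range a, (genMat N ^ p) j j * (genMat N ^ (a - 1 - p)) i i * q
        + ∑ v ∈ S, (deg v : MatPoly N) * ((genMat N ^ a) j i * (genMat N ^ (deg v - 1)) i j)
            * ∏ w ∈ S.erase v, trPow N (deg w) := by
    intro i j
    rw [pderiv_mul, pderiv_genMat_pow, Finset.sum_mul, hq, pderiv_prod, Finset.mul_sum]
    congr 1
    refine Finset.sum_congr rfl fun v _ => ?_
    rw [pderiv_trPow]
    ring
  rw [h1, map_sum]
  simp only [map_sum]
  have h3 : ∀ i j : Fin N, expect N (X (i, j) * ((genMat N ^ a) j i * q))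
      = expect N (pderiv (j, i) ((genMat N ^ a) j i * q)) := fun i j => gauss_X_mul _ _ _
  simp only [h3, h2]
  simp only [← map_sum]
  have h4 : ∑ i : Fin N, ∑ j : Fin N,
      (∑ p ∈ Finset.range a, (genMat N ^ p) j j * (genMat N ^ (a - 1 - p)) i i * q
        + ∑ v ∈ S, (deg v : MatPoly N) * ((genMat N ^ a) j i * (genMat N ^ (deg v - 1)) i j)
            * ∏ w ∈ S.erase v, trPow N (deg w))
      = ∑ p ∈ Finset.range a, trPow N p * trPow N (a - 1 - p) * q
        + ∑ v ∈ S, (deg v : ℚ) •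
            (trPow N (a + deg v - 1) * ∏ w ∈ S.erase v, trPow N (deg w)) := by
    simp only [Finset.sum_add_distrib]
    congr 1
    · rw [Finset.sum_comm, Finset.sum_congr rfl fun j _ => Finset.sum_comm, Finset.sum_comm]
      refine Finset.sum_congr rfl fun p _ => ?_
      simp only [trPow, Matrix.trace, Matrix.diag, Finset.sum_mul, Finset.mul_sum]
      rw [Finset.sum_comm]
    · rw [Finset.sum_congr rfl fun j _ => Finset.sum_comm, Finset.sum_comm]
      refine Finset.sum_congr rfl fun v _ => ?_
      rcases Nat.eq_zero_or_pos (deg v) with h0 | h0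
      · simp [h0]
      simp only [← Finset.sum_mul, ← Finset.mul_sum]
      rw [Finset.sum_comm, trPow, Matrix.trace, show a + deg v - 1 = a + (deg v - 1) by omega,
        pow_add, ← smul_mul_assoc]
      simp only [Matrix.diag, Matrix.mul_apply, MvPolynomial.smul_eq_C_mul]
      congr 2
  rw [h4, map_add, map_sum, map_sum]
  simp only [map_smul, smul_eq_mul]

end Loop

/-! ### Wick's theorem -/

section Matchings

open MvPolynomial

variable {H : Type*} [Fintype H] [DecidableEq H]

/-- The perfect matchings of a set `s` of half-edges: the involutions whose non-fixed points are
exactly the elements of `s`. -/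
def matchings (s : Finset H) : Finset (Equiv.Perm H) :=
  Finset.univ.filter fun α => α * α = 1 ∧ ∀ h, α h ≠ h ↔ h ∈ s

lemma mem_matchings {s : Finset H} {α : Equiv.Perm H} :
    α ∈ matchings s ↔ α * α = 1 ∧ ∀ h, α h ≠ h ↔ h ∈ s := by
  simp [matchings]

lemma apply_apply_of_mul_self {α : Equiv.Perm H} (h : α * α = 1) (x : H) : α (α x) = x := by
  rw [← Equiv.Perm.mul_apply, h, Equiv.Perm.one_apply]

/-- Removing the pair `{h₀, h₁}` identifies the matchings of `s` that contain it with the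
matchings of `s \ {h₀, h₁}`. -/
lemma card_matchings_pair (s : Finset H) (h₀ h₁ : H) (h0 : h₀ ∈ s) (h1 : h₁ ∈ s)
    (hne : h₁ ≠ h₀) (Q : H → H → Prop) [DecidableRel Q] (hQ : Q h₀ h₁) (hQ' : Q h₁ h₀) :
    ((matchings s).filter fun α => α h₀ = h₁ ∧ ∀ h ∈ s, Q h (α h)).card
      = ((matchings ((s.erase h₀).erase h₁)).filter
          fun α => ∀ h ∈ (s.erase h₀).erase h₁, Q h (α h)).card := by
  refine Finset.card_bij' (fun α _ => Equiv.swap h₀ h₁ * α) (fun α _ => Equiv.swap h₀ h₁ * α)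
    ?_ ?_ (fun α _ => by simp [← mul_assoc]) (fun α _ => by simp [← mul_assoc])
  · intro α hα
    rw [Finset.mem_filter, mem_matchings] at hα
    obtain ⟨⟨hα2, hαs⟩, h01, hαQ⟩ := hα
    have inv := apply_apply_of_mul_self hα2
    have h10 : α h₁ = h₀ := by rw [← h01, inv]
    have key : ∀ h, h ≠ h₀ → h ≠ h₁ → (Equiv.swap h₀ h₁ * α) h = α h := by
      intro h hh0 hh1
      rw [Equiv.Perm.mul_apply]
      refine Equiv.swap_apply_of_ne_of_ne ?_ ?_
      · intro h'; apply hh1; rw [← inv h, h', h01]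
      · intro h'; apply hh0; rw [← inv h, h', h10]
    have k0 : (Equiv.swap h₀ h₁ * α) h₀ = h₀ := by simp [h01]
    have k1 : (Equiv.swap h₀ h₁ * α) h₁ = h₁ := by simp [h10]
    rw [Finset.mem_filter, mem_matchings]
    refine ⟨⟨?_, fun h => ?_⟩, fun h hh => ?_⟩
    · ext h
      rcases eq_or_ne h h₀ with rfl | hh0
      · rw [Equiv.Perm.mul_apply, k0, k0]; rfl
      rcases eq_or_ne h h₁ with rfl | hh1
      · rw [Equiv.Perm.mul_apply, k1, k1]; rfl
      rw [Equiv.Perm.mul_apply, key h hh0 hh1, key, inv]; · rfl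
      · intro h'; apply hh1; rw [← inv h, h', h01]
      · intro h'; apply hh0; rw [← inv h, h', h10]
    · rcases eq_or_ne h h₀ with rfl | hh0
      · simp [k0]
      rcases eq_or_ne h h₁ with rfl | hh1
      · simp [k1]
      rw [key h hh0 hh1, hαs]
      simp [hh0, hh1]
    · simp only [Finset.mem_erase] at hh
      rw [key h hh.2.1 hh.1]
      exact hαQ h hh.2.2
  · intro α hα
    rw [Finset.mem_filter, mem_matchings] at hα
    obtain ⟨⟨hα2, hαs⟩, hαQ⟩ := hα
    have inv := apply_apply_of_mul_self hα2
    have k0 : α h₀ = h₀ := by by_contra h; simpa using (hαs h₀).1 h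
    have k1 : α h₁ = h₁ := by by_contra h; simpa using (hαs h₁).1 h
    have key : ∀ h, h ≠ h₀ → h ≠ h₁ → (Equiv.swap h₀ h₁ * α) h = α h := by
      intro h hh0 hh1
      rw [Equiv.Perm.mul_apply]
      refine Equiv.swap_apply_of_ne_of_ne ?_ ?_
      · intro h'; apply hh0; rw [← inv h, h', k0]
      · intro h'; apply hh1; rw [← inv h, h', k1]
    have j0 : (Equiv.swap h₀ h₁ * α) h₀ = h₁ := by simp [k0]
    have j1 : (Equiv.swap h₀ h₁ * α) h₁ = h₀ := by simp [k1]
    rw [Finset.mem_filter, mem_matchings]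
    refine ⟨⟨?_, fun h => ?_⟩, j0, fun h hh => ?_⟩
    · ext h
      rcases eq_or_ne h h₀ with rfl | hh0
      · rw [Equiv.Perm.mul_apply, j0, j1]; rfl
      rcases eq_or_ne h h₁ with rfl | hh1
      · rw [Equiv.Perm.mul_apply, j1, j0]; rfl
      rw [Equiv.Perm.mul_apply, key h hh0 hh1, key, inv]; · rfl
      · intro h'; apply hh0; rw [← inv h, h', k0]
      · intro h'; apply hh1; rw [← inv h, h', k1]
    · rcases eq_or_ne h h₀ with rfl | hh0
      · simp [j0, h0, hne]
      rcases eq_or_ne h h₁ with rfl | hh1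
      · simp [j1, h1, hne.symm]
      rw [key h hh0 hh1, hαs]
      simp [hh0, hh1]
    · rcases eq_or_ne h h₀ with rfl | hh0
      · rwa [j0]
      rcases eq_or_ne h h₁ with rfl | hh1
      · rwa [j1]
      rw [key h hh0 hh1]
      exact hαQ h (by simp [hh0, hh1, hh])

/-- Wick's theorem: the Gaussian expectation of a monomial counts the matchings of its factors
which pair every variable with its conjugate. -/
theorem gauss_prod_X {κ : Type*} [Fintype κ] [DecidableEq κ] {ι : κ → κ}
    (hι : Function.Involutive ι) (e : H → κ) (s : Finset H) :
    gauss hι (∏ h ∈ s, X (e h))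
      = ((matchings s).filter fun α => ∀ h ∈ s, e (α h) = ι (e h)).card := by
  induction hn : s.card using Nat.strong_induction_on generalizing s with
  | _ n ih =>
    rcases s.eq_empty_or_nonempty with rfl | ⟨h₀, h0⟩
    · rw [Finset.prod_empty, gauss_one]
      have : (matchings (∅ : Finset H)) = {1} := by
        ext α
        rw [mem_matchings, Finset.mem_singleton]
        constructor
        · rintro ⟨-, h⟩
          ext x
          simpa using h x
        · rintro rfl
          simp
      simp [this]
    · rw [← Finset.mul_prod_erase _ _ h0, gauss_X_mul]
      rw [pderiv_prod, map_sum]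
      have hfib : ((matchings s).filter fun α => ∀ h ∈ s, e (α h) = ι (e h)).card
          = ∑ h₁ ∈ s.erase h₀,
            ((matchings s).filter fun α => α h₀ = h₁ ∧ ∀ h ∈ s, e (α h) = ι (e h)).card := by
        rw [Finset.card_eq_sum_card_fiberwise (f := fun α => α h₀) (t := s.erase h₀)]
        · refine Finset.sum_congr rfl fun h₁ _ => ?_
          rw [Finset.filter_filter]
          congr 1
          ext α
          simp [and_comm]
        · intro α hα
          simp only [Finset.coe_filter, Set.mem_ofPred_eq, mem_matchings] at hα
          obtain ⟨⟨hα2, hαs⟩, -⟩ := hα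
          simp only [Finset.coe_erase, Set.mem_sdiff, Finset.mem_coe, Set.mem_singleton_iff]
          refine ⟨(hαs _).1 ?_, (hαs h₀).2 h0⟩
          rw [apply_apply_of_mul_self hα2]
          exact ((hαs h₀).2 h0).symm
      rw [hfib]
      push_cast
      refine Finset.sum_congr rfl fun h₁ h1 => ?_
      rw [Finset.mem_erase] at h1
      by_cases hp : e h₁ = ι (e h₀)
      · rw [hp, pderiv_X_self, one_mul]
        rw [ih _ (by rw [Finset.card_erase_of_mem (by simp [h1]), Finset.card_erase_of_mem h0]
                     have := Finset.card_pos.2 ⟨h₀, h0⟩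
                     omega) _ rfl]
        congr 1
        exact (card_matchings_pair s h₀ h₁ h0 h1.2 h1.1 (fun h h' => e h' = ι (e h)) hp
          (by rw [hp, hι])).symm
      · rw [pderiv_X_of_ne hp, zero_mul, map_zero, eq_comm, Nat.cast_eq_zero, Finset.card_eq_zero,
          Finset.filter_eq_empty_iff]
        rintro α - ⟨h01, hα⟩
        exact hp (h01 ▸ hα h₀ h0)

end Matchings

/-! ### Matrix traces as sums over closed walks -/

section Traces

open MvPolynomial

lemma pow_apply_eq_sum_walks {R : Type*} [CommRing R] {N : ℕ} (M : Matrix (Fin N) (Fin N) R)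
    (n : ℕ) (i j : Fin N) :
    (M ^ n) i j = ∑ f : Fin (n + 1) → Fin N,
      if f 0 = i ∧ f (Fin.last n) = j then ∏ k : Fin n, M (f k.castSucc) (f k.succ) else 0 := by
  induction n generalizing i with
  | zero =>
    rw [pow_zero, Matrix.one_apply, ← (Equiv.funUnique (Fin 1) (Fin N)).symm.sum_comp]
    by_cases h : i = j
    · subst h
      simp
    · have : ∀ x : Fin N, ¬(x = i ∧ x = j) := fun x hx => h (hx.1.symm.trans hx.2)
      simp [h, this]
  | succ n ih =>
    rw [pow_succ', Matrix.mul_apply, ← (Fin.consEquiv fun _ => Fin N).sum_comp,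
      Fintype.sum_prod_type]
    refine Eq.trans ?_ (Finset.sum_eq_single i ?_ ?_).symm
    · simp only [ih, Finset.mul_sum]
      rw [Finset.sum_comm]
      refine Finset.sum_congr rfl fun f _ => ?_
      rw [Finset.sum_eq_single (f 0)]
      · simp [Fin.consEquiv, Fin.prod_univ_succ, ← Fin.succ_last, -Fin.castSucc_succ,
          ← Fin.succ_castSucc]
      · intro b _ hb
        simp [hb.symm]
      · simp
    · intro b _ hb
      simp [Fin.consEquiv, hb]
    · simp

lemma trace_pow_eq_sum_closed_walks {R : Type*} [CommRing R] {N : ℕ}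
    (M : Matrix (Fin N) (Fin N) R) (k : ℕ) (hk : k ≠ 0) :
    (M ^ k).trace = ∑ f : Fin k → Fin N, ∏ i, M (f i) (f (finRotate k i)) := by
  obtain ⟨n, rfl⟩ := Nat.exists_eq_succ_of_ne_zero hk
  rw [Nat.succ_eq_add_one, pow_succ, Matrix.trace]
  simp only [Matrix.diag, Matrix.mul_apply, pow_apply_eq_sum_walks, Finset.sum_mul]
  rw [Finset.sum_congr rfl fun i _ => Finset.sum_comm, Finset.sum_comm]
  refine Finset.sum_congr rfl fun f _ => ?_
  rw [Finset.sum_eq_single (f 0), Finset.sum_eq_single (f (Fin.last n))]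
  · simp [Fin.prod_univ_castSucc]
  · intro b _ hb
    simp [hb.symm]
  · simp
  · intro b _ hb
    simp [hb.symm]
  · simp

end Traces

section Colorings

open MvPolynomial

variable {H : Type*} [Fintype H] [DecidableEq H]

/-- The number of colourings with `N` colours that are constant on the cycles of `π`, that is
`N` to the number of cycles of `π`. -/
def colorings (N : ℕ) (π : Equiv.Perm H) : ℕ :=
  Fintype.card {f : H → Fin N // ∀ h, f (π h) = f h}

/-- The rotation system on the half-edges `Σ v, Fin (μ v)`. -/
def rotation {V : Type*} (μ : V → ℕ) : Equiv.Perm (Σ v, Fin (μ v)) :=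
  Equiv.sigmaCongrRight fun v => finRotate (μ v)

/-- The Gaussian expectation of a product of traces as a sum over all gluings: a vertex of degree
`0` contributes the factor `N`, a matching `α` contributes `N ^ (number of cycles of σ α)`. -/
theorem expect_prod_trPow {V : Type*} [Fintype V] [DecidableEq V] (N : ℕ) (μ : V → ℕ) :
    expect N (∏ v, trPow N (μ v)) = (∏ v, if μ v = 0 then (N : ℚ) else 1) *
      ∑ α ∈ matchings (Finset.univ : Finset (Σ v, Fin (μ v))), (colorings N (rotation μ * α) : ℚ)
    := by
  have h1 : ∀ v, trPow N (μ v) = (if μ v = 0 then (C (N : ℚ)) else 1) *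
      ∑ f : Fin (μ v) → Fin N, ∏ i, genMat N (f i) (f (finRotate (μ v) i)) := by
    intro v
    split_ifs with h
    · rw [trPow, h, pow_zero, Matrix.trace_one]
      have : IsEmpty (Fin (μ v)) := by rw [h]; infer_instance
      simp
    · rw [trPow, trace_pow_eq_sum_closed_walks _ _ h, one_mul]
  have h2 : (∏ v, if μ v = 0 then (C (N : ℚ) : MatPoly N) else 1)
      = C (∏ v, if μ v = 0 then (N : ℚ) else 1) := by
    rw [map_prod]
    exact Finset.prod_congr rfl fun v _ => by split_ifs <;> simp
  rw [Finset.prod_congr rfl fun v _ => h1 v, Finset.prod_mul_distrib, h2, ← smul_eq_C_mul, map_smul,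
    smul_eq_mul]
  congr 1
  rw [Finset.prod_univ_sum, Fintype.piFinset_univ, map_sum]
  rw [← (Equiv.piCurry fun (v : V) (_ : Fin (μ v)) => Fin N).sum_comp]
  have h3 : ∀ f : (Σ v, Fin (μ v)) → Fin N,
      expect N (∏ v, ∏ i, genMat N (f ⟨v, i⟩) (f ⟨v, finRotate (μ v) i⟩))
        = ∑ α ∈ matchings (Finset.univ : Finset (Σ v, Fin (μ v))),
            if ∀ h, f ((rotation μ * α) h) = f h then 1 else 0 := by
    intro f
    have : (∏ v, ∏ i, genMat N (f ⟨v, i⟩) (f ⟨v, finRotate (μ v) i⟩))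
        = ∏ h : Σ v, Fin (μ v), X (f h, f (rotation μ h)) := by
      rw [Fintype.prod_sigma]
      rfl
    rw [this]
    refine (gauss_prod_X (swap_involutive N) (fun h => (f h, f (rotation μ h))) _).trans ?_
    rw [Finset.card_filter, Nat.cast_sum]
    refine Finset.sum_congr rfl fun α hα => ?_
    have inv := apply_apply_of_mul_self (mem_matchings.1 hα).1
    rw [Nat.cast_ite, Nat.cast_one, Nat.cast_zero]
    congr 1
    simp only [Finset.mem_univ, true_imp_iff, Prod.swap_prod_mk, Prod.mk.injEq,
      Equiv.Perm.mul_apply, eq_iff_iff]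
    constructor
    · exact fun h x => (h x).2
    · intro h x
      refine ⟨?_, h x⟩
      have := h (α x)
      rw [inv] at this
      exact this.symm
  refine (Finset.sum_congr rfl fun f _ => h3 f).trans ?_
  rw [Finset.sum_comm]
  refine Finset.sum_congr rfl fun α _ => ?_
  rw [colorings, Fintype.card_subtype, Finset.card_filter, Nat.cast_sum]
  exact Finset.sum_congr rfl fun f _ => by rw [Nat.cast_ite, Nat.cast_one, Nat.cast_zero]

end Colorings

/-! ### Connected gluings and the orbit decomposition -/

section Connected

variable {H V : Type*} [Fintype H] [DecidableEq H] [Fintype V] [DecidableEq V]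

/-- A set of vertices which is a union of connected components of the graph glued by `α`. Here
`v h` is the vertex of the half-edge `h`. -/
def IsClosedUnder (v : H → V) (α : Equiv.Perm H) (I : Finset V) : Prop :=
  ∀ h, v h ∈ I → v (α h) ∈ I

/-- The graph glued by `α` is connected. Connectedness refers to the vertices, so that an isolated
vertex counts as a component. -/
def IsConn (v : H → V) (α : Equiv.Perm H) : Prop :=
  ∀ I, IsClosedUnder v α I → I = ∅ ∨ I = Finset.univ

open scoped Classical in
/-- The set of vertices in the connected component of `v₀`. -/
noncomputable def component (v : H → V) (v₀ : V) (α : Equiv.Perm H) : Finset V :=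
  Finset.univ.filter fun x => ∀ I, IsClosedUnder v α I → v₀ ∈ I → x ∈ I

lemma mem_component {v : H → V} {v₀ : V} {α : Equiv.Perm H} {x : V} :
    x ∈ component v v₀ α ↔ ∀ I, IsClosedUnder v α I → v₀ ∈ I → x ∈ I := by
  simp [component]

lemma self_mem_component (v : H → V) (v₀ : V) (α : Equiv.Perm H) : v₀ ∈ component v v₀ α :=
  mem_component.2 fun _ _ h => h

lemma isClosedUnder_component (v : H → V) (v₀ : V) (α : Equiv.Perm H) :
    IsClosedUnder v α (component v v₀ α) := fun h hh =>
  mem_component.2 fun I hI h0 => hI h (mem_component.1 hh I hI h0)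

lemma component_subset {v : H → V} {v₀ : V} {α : Equiv.Perm H} {I : Finset V}
    (hI : IsClosedUnder v α I) (h0 : v₀ ∈ I) : component v v₀ α ⊆ I :=
  fun _ hx => mem_component.1 hx I hI h0

lemma IsClosedUnder.compl {v : H → V} {α : Equiv.Perm H} (hα : α * α = 1) {I : Finset V}
    (hI : IsClosedUnder v α I) : IsClosedUnder v α Iᶜ := by
  intro h hh
  rw [Finset.mem_compl] at hh ⊢
  intro h'
  apply hh
  have := hI _ h'
  rwa [apply_apply_of_mul_self hα] at this

lemma IsClosedUnder.inter {v : H → V} {α : Equiv.Perm H} {I J : Finset V}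
    (hI : IsClosedUnder v α I) (hJ : IsClosedUnder v α J) : IsClosedUnder v α (I ∩ J) := by
  intro h hh
  rw [Finset.mem_inter] at hh ⊢
  exact ⟨hI h hh.1, hJ h hh.2⟩

open scoped Classical in
/-- The connected perfect matchings of all half-edges. -/
noncomputable def connMatchings (v : H → V) : Finset (Equiv.Perm H) :=
  (matchings Finset.univ).filter fun α => IsConn v α

lemma mem_connMatchings {v : H → V} {α : Equiv.Perm H} :
    α ∈ connMatchings v ↔ α ∈ matchings Finset.univ ∧ IsConn v α := by
  simp [connMatchings]

end Connected

section Invariance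

variable {H H' V V' : Type*} [Fintype H] [DecidableEq H] [Fintype V] [DecidableEq V]
  [Fintype H'] [DecidableEq H'] [Fintype V'] [DecidableEq V']

lemma permCongr_mem_matchings (e : H ≃ H') (α : Equiv.Perm H) :
    e.permCongr α ∈ matchings Finset.univ ↔ α ∈ matchings Finset.univ := by
  have h1 : e.permCongr 1 = 1 := e.permCongr_refl
  rw [mem_matchings, mem_matchings, ← Equiv.permCongr_mul]
  refine and_congr ?_ ?_
  · exact ⟨fun h => e.permCongr.injective (h.trans h1.symm), fun h => by rw [h, h1]⟩
  · simp only [Finset.mem_univ, iff_true]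
    constructor
    · intro h x hx
      exact h (e x) (by simp [hx])
    · intro h x hx
      exact h (e.symm x) (by rwa [Equiv.eq_symm_apply])

lemma isConn_permCongr (e : H ≃ H') (f : V ≃ V') {v : H → V} {v' : H' → V'}
    (hv : ∀ h, v' (e h) = f (v h)) (α : Equiv.Perm H) :
    IsConn v' (e.permCongr α) ↔ IsConn v α := by
  have key : ∀ I : Finset V, IsClosedUnder v' (e.permCongr α) (I.map f.toEmbedding)
      ↔ IsClosedUnder v α I := by
    intro I
    constructor
    · intro h x hx
      have := h (e x) (by simpa [hv] using hx)
      simpa [hv] using this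
    · intro h x hx
      obtain ⟨x, rfl⟩ := e.surjective x
      have := h x (by simpa [hv] using hx)
      simpa [hv] using this
  constructor
  · intro h I hI
    rcases h _ ((key I).2 hI) with h' | h'
    · left; simpa using h'
    · right
      ext x
      have : f x ∈ I.map f.toEmbedding := by rw [h']; exact Finset.mem_univ _
      simpa using this
  · intro h I hI
    obtain ⟨J, rfl⟩ : ∃ J : Finset V, J.map f.toEmbedding = I :=
      ⟨I.map f.symm.toEmbedding, by simp [Finset.map_map]⟩
    rcases h J ((key J).1 hI) with rfl | rfl
    · left; simp
    · right; simp

lemma colorings_permCongr (N : ℕ) (e : H ≃ H') (π : Equiv.Perm H) :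
    colorings N (e.permCongr π) = colorings N π := by
  refine Fintype.card_congr ((e.arrowCongr (Equiv.refl (Fin N))).symm.subtypeEquiv fun f => ?_)
  constructor
  · intro h x
    simpa using h (e x)
  · intro h x
    simpa using h (e.symm x)

/-- A sum over connected matchings is invariant under relabelling. -/
lemma sum_connMatchings_congr {M : Type*} [AddCommMonoid M] (e : H ≃ H') (f : V ≃ V') {v : H → V}
    {v' : H' → V'} (hv : ∀ h, v' (e h) = f (v h)) (F : Equiv.Perm H' → M) :
    ∑ α ∈ connMatchings v', F α = ∑ α ∈ connMatchings v, F (e.permCongr α) := by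
  symm
  refine Finset.sum_bij (fun α _ => e.permCongr α) ?_ ?_ ?_ fun _ _ => rfl
  · intro α hα
    rw [mem_connMatchings] at hα ⊢
    rwa [permCongr_mem_matchings, isConn_permCongr e f hv]
  · intro α _ β _ h
    exact e.permCongr.injective h
  · intro α hα
    refine ⟨e.permCongr.symm α, ?_, e.permCongr.apply_symm_apply α⟩
    rw [mem_connMatchings] at hα ⊢
    rwa [← permCongr_mem_matchings e, ← isConn_permCongr e f hv, Equiv.apply_symm_apply]

lemma sum_matchings_congr {M : Type*} [AddCommMonoid M] (e : H ≃ H')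
    (F : Equiv.Perm H' → M) :
    ∑ α ∈ matchings Finset.univ, F α
      = ∑ α ∈ matchings (Finset.univ : Finset H), F (e.permCongr α) := by
  symm
  refine Finset.sum_bij (fun α _ => e.permCongr α) ?_ ?_ ?_ fun _ _ => rfl
  · intro α hα
    rwa [permCongr_mem_matchings]
  · intro α _ β _ h
    exact e.permCongr.injective h
  · intro α hα
    exact ⟨e.permCongr.symm α, by rwa [← permCongr_mem_matchings e, Equiv.apply_symm_apply],
      e.permCongr.apply_symm_apply α⟩

end Invariance

section Orbit

variable {H V A B : Type*} [Fintype H] [DecidableEq H] [Fintype V] [DecidableEq V]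
  [Fintype A] [DecidableEq A] [Fintype B] [DecidableEq B]

lemma colorings_sumCongr (N : ℕ) (a : Equiv.Perm A) (b : Equiv.Perm B) :
    colorings N (Equiv.Perm.sumCongr a b) = colorings N a * colorings N b := by
  rw [colorings, colorings, colorings, ← Fintype.card_prod]
  refine Fintype.card_congr
    { toFun := fun f => (⟨fun x => f.1 (Sum.inl x), fun x => f.2 (Sum.inl x)⟩,
        ⟨fun x => f.1 (Sum.inr x), fun x => f.2 (Sum.inr x)⟩)
      invFun := fun p => ⟨Sum.elim p.1.1 p.2.1, ?_⟩
      left_inv := fun f => ?_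
      right_inv := fun p => rfl }
  · rintro (x | x)
    · exact p.1.2 x
    · exact p.2.2 x
  · ext x
    rcases x with x | x <;> rfl

lemma sumCongr_mem_matchings (a : Equiv.Perm A) (b : Equiv.Perm B) :
    Equiv.Perm.sumCongr a b ∈ matchings Finset.univ
      ↔ a ∈ matchings Finset.univ ∧ b ∈ matchings Finset.univ := by
  simp only [mem_matchings, Equiv.Perm.sumCongr_mul, Finset.mem_univ, iff_true]
  constructor
  · rintro ⟨h1, h2⟩
    refine ⟨⟨?_, fun x hx => ?_⟩, ⟨?_, fun x hx => ?_⟩⟩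
    · ext x
      have := congrArg (fun π => π (Sum.inl x)) h1
      simpa using this
    · exact h2 (Sum.inl x) (by simp [hx])
    · ext x
      have := congrArg (fun π => π (Sum.inr x)) h1
      simpa using this
    · exact h2 (Sum.inr x) (by simp [hx])
  · rintro ⟨⟨h1, h2⟩, h3, h4⟩
    refine ⟨by rw [h1, h3, Equiv.Perm.sumCongr_one], ?_⟩
    rintro (x | x)
    · simpa using h2 x
    · simpa using h4 x

/-- If the half-edges at `I` are parametrized by `A` and the others by `B`, then the matchings for
which `I` is the component of `v₀` are the pairs of a connected matching of `A` and a matching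
of `B`. -/
lemma sum_component_eq {M : Type*} [AddCommMonoid M] (v : H → V) (v₀ : V) (I : Finset V)
    (h0 : v₀ ∈ I) (e : A ⊕ B ≃ H) (vA : A → {x // x ∈ I})
    (hA : ∀ a, v (e (Sum.inl a)) = vA a) (hB : ∀ b, v (e (Sum.inr b)) ∉ I)
    (F : Equiv.Perm H → M) :
    ∑ α ∈ (matchings Finset.univ).filter (fun α => component v v₀ α = I), F α
      = ∑ p ∈ connMatchings vA ×ˢ matchings Finset.univ,
          F (e.permCongr (Equiv.Perm.sumCongr p.1 p.2)) := by
  symm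
  have hcl : ∀ (a : Equiv.Perm A) (b : Equiv.Perm B) (J : Finset {x // x ∈ I}),
      IsClosedUnder v (e.permCongr (Equiv.Perm.sumCongr a b)) (J.map (Function.Embedding.subtype _))
        ↔ IsClosedUnder vA a J := by
    intro a b J
    have hm : ∀ x, v (e (Sum.inl x)) ∈ J.map (Function.Embedding.subtype _) ↔ vA x ∈ J := by
      intro x
      rw [hA]
      simp
    constructor
    · intro h x hx
      have := h (e (Sum.inl x)) ((hm x).2 hx)
      simp only [Equiv.permCongr_apply, Equiv.symm_apply_apply, Equiv.Perm.sumCongr_apply,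
        Sum.map_inl] at this
      exact (hm _).1 this
    · intro h x hx
      obtain ⟨x | x, rfl⟩ := e.surjective x
      · simp only [Equiv.permCongr_apply, Equiv.symm_apply_apply, Equiv.Perm.sumCongr_apply,
          Sum.map_inl]
        exact (hm _).2 (h x ((hm x).1 hx))
      · exfalso
        obtain ⟨y, -, hy⟩ := Finset.mem_map.1 hx
        exact hB x (hy ▸ y.2)
  refine Finset.sum_bij (fun p _ => e.permCongr (Equiv.Perm.sumCongr p.1 p.2)) ?_ ?_ ?_
    fun _ _ => rfl
  · rintro ⟨a, b⟩ hab
    rw [Finset.mem_product, mem_connMatchings] at hab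
    obtain ⟨⟨ha, hac⟩, hb⟩ := hab
    have hmem : e.permCongr (Equiv.Perm.sumCongr a b) ∈ matchings Finset.univ := by
      rw [permCongr_mem_matchings, sumCongr_mem_matchings]
      exact ⟨ha, hb⟩
    rw [Finset.mem_filter]
    refine ⟨hmem, ?_⟩
    have hI : IsClosedUnder v (e.permCongr (Equiv.Perm.sumCongr a b)) I := by
      have := (hcl a b Finset.univ).2 fun _ _ => Finset.mem_univ _
      convert this using 1
      ext x
      simp
    have hsub := component_subset hI h0
    set K := component v v₀ (e.permCongr (Equiv.Perm.sumCongr a b)) with hK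
    have hKJ : (K.subtype (· ∈ I)).map (Function.Embedding.subtype _) = K := by
      ext x
      simp only [Finset.mem_map, Finset.mem_subtype, Function.Embedding.subtype_apply,
        Subtype.exists, exists_and_right, exists_eq_right]
      exact ⟨fun h => h.2, fun h => ⟨hsub h, h⟩⟩
    have hcK := isClosedUnder_component v v₀ (e.permCongr (Equiv.Perm.sumCongr a b))
    rw [← hK, ← hKJ] at hcK
    have h0K : (⟨v₀, h0⟩ : {x // x ∈ I}) ∈ K.subtype (· ∈ I) := by
      rw [Finset.mem_subtype]
      exact self_mem_component _ _ _
    rcases hac _ ((hcl a b _).1 hcK) with h | h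
    · rw [h] at h0K
      simp at h0K
    · rw [← hKJ, h]
      ext x
      simp
  · rintro ⟨a, b⟩ _ ⟨a', b'⟩ _ h
    have h' := e.permCongr.injective h
    refine Prod.ext (Equiv.ext fun x => ?_) (Equiv.ext fun x => ?_)
    · simpa using congrArg (fun π => π (Sum.inl x)) h'
    · simpa using congrArg (fun π => π (Sum.inr x)) h'
  · intro α hα
    rw [Finset.mem_filter] at hα
    obtain ⟨hα, hI⟩ := hα
    have hcI : IsClosedUnder v α I := hI ▸ isClosedUnder_component v v₀ α
    have hmaps : Set.MapsTo (e.permCongr.symm α) (Set.range (Sum.inl : A → A ⊕ B))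
        (Set.range Sum.inl) := by
      rintro _ ⟨x, rfl⟩
      have := hcI (e (Sum.inl x)) (by rw [hA]; exact (vA x).2)
      rcases hy : (e.permCongr.symm α) (Sum.inl x) with y | y
      · exact ⟨y, rfl⟩
      · exfalso
        refine hB y ?_
        rw [← hy]
        simpa [Equiv.permCongr_symm_apply] using this
    obtain ⟨⟨a, b⟩, hab⟩ := Equiv.Perm.mem_sumCongrHom_range_of_perm_mapsTo_inl hmaps
    rw [Equiv.Perm.sumCongrHom_apply] at hab
    have hαab : e.permCongr (Equiv.Perm.sumCongr a b) = α := by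
      rw [hab, Equiv.apply_symm_apply]
    refine ⟨(a, b), ?_, hαab⟩
    have hm : a ∈ matchings Finset.univ ∧ b ∈ matchings Finset.univ := by
      rwa [← sumCongr_mem_matchings, ← permCongr_mem_matchings e, hαab]
    rw [Finset.mem_product, mem_connMatchings]
    refine ⟨⟨hm.1, fun J hJ => ?_⟩, hm.2⟩
    rw [← hcl a b J, hαab] at hJ
    have hsubI : J.map (Function.Embedding.subtype _) ⊆ I := by
      intro x hx
      obtain ⟨y, -, rfl⟩ := Finset.mem_map.1 hx
      exact y.2
    by_cases h : (⟨v₀, h0⟩ : {x // x ∈ I}) ∈ J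
    · right
      have := component_subset hJ (v₀ := v₀) (Finset.mem_map.2 ⟨_, h, rfl⟩)
      rw [hI] at this
      ext ⟨x, hx⟩
      simp only [Finset.mem_univ, iff_true]
      obtain ⟨y, hy, hyx⟩ := Finset.mem_map.1 (this hx)
      have : y = ⟨x, hx⟩ := Subtype.ext hyx
      rwa [← this]
    · left
      have hJ' := hcI.inter (hJ.compl (mem_matchings.1 hα).1)
      have := component_subset hJ' (v₀ := v₀) (by
        rw [Finset.mem_inter, Finset.mem_compl]
        refine ⟨h0, fun h' => h ?_⟩
        obtain ⟨y, hy, hyx⟩ := Finset.mem_map.1 h'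
        have : y = ⟨v₀, h0⟩ := Subtype.ext hyx
        rwa [← this])
      rw [hI] at this
      rw [Finset.eq_empty_iff_forall_notMem]
      intro y hy
      have h2 := this y.2
      rw [Finset.mem_inter, Finset.mem_compl] at h2
      exact h2.2 (Finset.mem_map.2 ⟨y, hy, rfl⟩)

end Orbit

/-! ### Sums over gluings of polygons with prescribed degrees -/

section Standard

variable {V V' : Type*} [Fintype V] [DecidableEq V] [Fintype V'] [DecidableEq V']

/-- The sum of `N ^ (number of faces)` over all gluings of vertices of degrees `μ`; an isolated
vertex has one face. -/
def gluingSum (N : ℕ) (μ : V → ℕ) : ℚ :=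
  (∏ v, if μ v = 0 then (N : ℚ) else 1) *
    ∑ α ∈ matchings (Finset.univ : Finset (Σ v, Fin (μ v))), (colorings N (rotation μ * α) : ℚ)

/-- The sum of `N ^ (number of faces)` over the connected gluings of vertices of degrees `μ`. -/
noncomputable def connSum (N : ℕ) (μ : V → ℕ) : ℚ :=
  (∏ v, if μ v = 0 then (N : ℚ) else 1) *
    ∑ α ∈ connMatchings (Sigma.fst : (Σ v, Fin (μ v)) → V), (colorings N (rotation μ * α) : ℚ)

lemma permCongr_rotation_mul (f : V ≃ V') (μ : V' → ℕ)
    (α : Equiv.Perm (Σ v, Fin (μ (f v)))) :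
    rotation μ * (Equiv.sigmaCongrLeft (β := fun v => Fin (μ v)) f).permCongr α
      = (Equiv.sigmaCongrLeft (β := fun v => Fin (μ v)) f).permCongr
          (rotation (fun v => μ (f v)) * α) := by
  ext1 x
  obtain ⟨x, rfl⟩ := (Equiv.sigmaCongrLeft (β := fun v => Fin (μ v)) f).surjective x
  simp only [Equiv.Perm.mul_apply, Equiv.permCongr_apply, Equiv.symm_apply_apply]
  rfl

lemma connSum_comp (N : ℕ) (f : V ≃ V') (μ : V' → ℕ) :
    connSum N (fun v => μ (f v)) = connSum N μ := by
  rw [connSum, connSum, f.prod_comp fun v => if μ v = 0 then (N : ℚ) else 1,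
    sum_connMatchings_congr (Equiv.sigmaCongrLeft (β := fun v => Fin (μ v)) f) f (fun _ => rfl)]
  congr 1
  exact Finset.sum_congr rfl fun α _ => by rw [permCongr_rotation_mul, colorings_permCongr]

lemma connSum_congr (N : ℕ) (f : V ≃ V') {μ : V → ℕ} {μ' : V' → ℕ} (h : ∀ v, μ' (f v) = μ v) :
    connSum N μ = connSum N μ' := by
  rw [← connSum_comp N f μ']
  congr 1
  ext v
  rw [h]

lemma gluingSum_comp (N : ℕ) (f : V ≃ V') (μ : V' → ℕ) :
    gluingSum N (fun v => μ (f v)) = gluingSum N μ := by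
  rw [gluingSum, gluingSum, f.prod_comp fun v => if μ v = 0 then (N : ℚ) else 1,
    sum_matchings_congr (Equiv.sigmaCongrLeft (β := fun v => Fin (μ v)) f)]
  congr 1
  exact Finset.sum_congr rfl fun α _ => by rw [permCongr_rotation_mul, colorings_permCongr]

/-- The half-edges at `I` and at its complement. -/
def sigmaSplit (μ : V → ℕ) (I : Finset V) :
    (Σ x : {x // x ∈ I}, Fin (μ x)) ⊕ (Σ x : {x // x ∉ I}, Fin (μ x)) ≃ Σ x, Fin (μ x) where
  toFun := Sum.elim (fun h => ⟨h.1, h.2⟩) fun h => ⟨h.1, h.2⟩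
  invFun h := if hI : h.1 ∈ I then Sum.inl ⟨⟨h.1, hI⟩, h.2⟩ else Sum.inr ⟨⟨h.1, hI⟩, h.2⟩
  left_inv := by
    rintro (⟨⟨x, hx⟩, i⟩ | ⟨⟨x, hx⟩, i⟩) <;> simp [hx]
  right_inv := by
    rintro ⟨x, i⟩
    by_cases hx : x ∈ I <;> simp [hx]

/-- Decomposition of a gluing into the component of `v₀` and the rest. -/
theorem gluingSum_eq_sum_component (N : ℕ) (μ : V → ℕ) (v₀ : V) :
    gluingSum N μ = ∑ I ∈ Finset.univ.filter fun I : Finset V => v₀ ∈ I,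
      connSum N (fun x : {x // x ∈ I} => μ x) * gluingSum N (fun x : {x // x ∉ I} => μ x) := by
  rw [gluingSum, ← Finset.sum_fiberwise_of_maps_to (g := component Sigma.fst v₀)
    (t := Finset.univ.filter fun I : Finset V => v₀ ∈ I)
    (fun α _ => by simpa using self_mem_component _ _ _), Finset.mul_sum]
  refine Finset.sum_congr rfl fun I hI => ?_
  have h0 : v₀ ∈ I := by simpa using hI
  rw [sum_component_eq _ v₀ I h0 (sigmaSplit μ I) Sigma.fst (fun _ => rfl) (fun b => b.1.2),
    Finset.sum_product, connSum, gluingSum, mul_mul_mul_comm, Finset.sum_mul_sum]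
  congr 1
  · rw [← Fintype.prod_subtype_mul_prod_subtype (· ∈ I) fun v => if μ v = 0 then (N : ℚ) else 1]
    congr 1
    exact Finset.prod_congr (by ext; simp) fun _ _ => rfl
  · refine Finset.sum_congr rfl fun a _ => Finset.sum_congr rfl fun b _ => ?_
    rw [← Nat.cast_mul, ← colorings_sumCongr, ← colorings_permCongr N (sigmaSplit μ I)]
    congr 2
    ext1 x
    obtain ⟨x | x, rfl⟩ := (sigmaSplit μ I).surjective x <;>
      simp only [Equiv.Perm.mul_apply, Equiv.permCongr_apply, Equiv.symm_apply_apply,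
        Equiv.Perm.sumCongr_apply, Sum.map_inl, Sum.map_inr] <;> rfl

end Standard

/-! ### Connected sums as cumulants -/

section Convolution

variable {U : Type*} [DecidableEq U]

/-- The product `(f ⋆ g)(S) = ∑_{I ⊆ S} f(I) g(S \ I)` of set functions. -/
def conv (f g : Finset U → ℚ) (S : Finset U) : ℚ := ∑ I ∈ S.powerset, f I * g (S \ I)

lemma conv_assoc (f g h : Finset U → ℚ) (S : Finset U) :
    conv (conv f g) h S = conv f (conv g h) S := by
  simp only [conv, Finset.sum_mul, Finset.mul_sum]
  rw [Finset.sum_sigma', Finset.sum_sigma']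
  refine Finset.sum_bij' (fun p _ => ⟨p.2, p.1 \ p.2⟩) (fun p _ => ⟨p.1 ∪ p.2, p.1⟩) ?_ ?_ ?_ ?_ ?_
  · rintro ⟨I, K⟩ hp
    simp only [Finset.mem_sigma, Finset.mem_powerset] at hp ⊢
    exact ⟨hp.2.trans hp.1, Finset.sdiff_subset_sdiff hp.1 le_rfl⟩
  · rintro ⟨K, L⟩ hp
    simp only [Finset.mem_sigma, Finset.mem_powerset] at hp ⊢
    exact ⟨Finset.union_subset hp.1 (hp.2.trans Finset.sdiff_subset), Finset.subset_union_left⟩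
  · rintro ⟨I, K⟩ hp
    simp only [Finset.mem_sigma, Finset.mem_powerset] at hp
    simp [Finset.union_sdiff_of_subset hp.2]
  · rintro ⟨K, L⟩ hp
    simp only [Finset.mem_sigma, Finset.mem_powerset] at hp
    have : Disjoint K L := (Finset.disjoint_sdiff (s := K) (t := S)).mono_right hp.2
    simp [Finset.union_sdiff_cancel_left this]
  · rintro ⟨I, K⟩ hp
    simp only [Finset.mem_sigma, Finset.mem_powerset] at hp
    dsimp only
    rw [sdiff_sdiff_left, Finset.sup_eq_union, Finset.union_sdiff_of_subset hp.2, mul_assoc]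

lemma conv_sum_erase (k : U → ℚ) (f : U → Finset U → ℚ) (g : Finset U → ℚ) (S : Finset U) :
    conv (fun I => ∑ v ∈ I, k v * f v (I.erase v)) g S
      = ∑ v ∈ S, k v * conv (f v) g (S.erase v) := by
  simp only [conv, Finset.sum_mul, Finset.mul_sum]
  rw [Finset.sum_sigma', Finset.sum_sigma']
  refine Finset.sum_bij' (fun p _ => ⟨p.2, p.1.erase p.2⟩) (fun p _ => ⟨insert p.1 p.2, p.1⟩)
    ?_ ?_ ?_ ?_ ?_
  · rintro ⟨I, v⟩ hp
    simp only [Finset.mem_sigma, Finset.mem_powerset] at hp ⊢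
    exact ⟨hp.1 hp.2, Finset.erase_subset_erase _ hp.1⟩
  · rintro ⟨v, I⟩ hp
    simp only [Finset.mem_sigma, Finset.mem_powerset] at hp ⊢
    exact ⟨Finset.insert_subset hp.1 (hp.2.trans (Finset.erase_subset _ _)),
      Finset.mem_insert_self _ _⟩
  · rintro ⟨I, v⟩ hp
    simp only [Finset.mem_sigma, Finset.mem_powerset] at hp
    simp [Finset.insert_erase hp.2]
  · rintro ⟨v, I⟩ hp
    simp only [Finset.mem_sigma, Finset.mem_powerset] at hp
    have : v ∉ I := fun h => Finset.notMem_erase v S (hp.2 h)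
    simp [Finset.erase_insert this]
  · rintro ⟨I, v⟩ hp
    simp only [Finset.mem_sigma, Finset.mem_powerset] at hp
    dsimp only
    rw [mul_assoc]
    congr 3
    ext x
    simp only [Finset.mem_sdiff, Finset.mem_erase, not_and]
    constructor
    · exact fun h => ⟨⟨fun hx => h.2 (hx ▸ hp.2), h.1⟩, fun _ => h.2⟩
    · exact fun h => ⟨h.1.2, h.2 h.1.1⟩

lemma conv_right_cancel {f g a : Finset U → ℚ} (ha : a ∅ = 1) {S₀ : Finset U}
    (h : ∀ S ⊆ S₀, conv f a S = conv g a S) : ∀ S ⊆ S₀, f S = g S := by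
  intro S
  induction S using Finset.strongInduction with
  | _ S ih =>
    intro hS
    have := h S hS
    have hmem := Finset.mem_powerset_self S
    have key : ∑ I ∈ S.powerset.erase S, f I * a (S \ I)
        = ∑ I ∈ S.powerset.erase S, g I * a (S \ I) := by
      refine Finset.sum_congr rfl fun I hI => ?_
      rw [Finset.mem_erase, Finset.mem_powerset] at hI
      rw [ih I (hI.2.ssubset_of_ne hI.1) (hI.2.trans hS)]
    rw [conv, conv, ← Finset.add_sum_erase _ _ hmem, ← Finset.add_sum_erase _ _ hmem, key] at this
    simpa [ha] using add_right_cancel this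

lemma conv_congr_right {f g g' : Finset U → ℚ} {S : Finset U} (h : ∀ I ⊆ S, g I = g' I) :
    conv f g S = conv f g' S :=
  Finset.sum_congr rfl fun I _ => by rw [h _ Finset.sdiff_subset]

lemma conv_add_left (f f' g : Finset U → ℚ) (S : Finset U) :
    conv (fun I => f I + f' I) g S = conv f g S + conv f' g S := by
  simp only [conv, add_mul, Finset.sum_add_distrib]

lemma conv_sum_left {κ : Type*} (s : Finset κ) (f : κ → Finset U → ℚ) (g : Finset U → ℚ)
    (S : Finset U) : conv (fun I => ∑ p ∈ s, f p I) g S = ∑ p ∈ s, conv (f p) g S := by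
  simp only [conv, Finset.sum_mul]
  rw [Finset.sum_comm]

end Convolution

section Labelled

/-- `connSum` for a finite set of vertices; a vertex is a pair of a degree and a label. -/
noncomputable def connSumOn (N : ℕ) (S : Finset (ℕ × ℕ)) : ℚ :=
  connSum N fun x : {x // x ∈ S} => x.1.1

/-- `gluingSum` for a finite set of vertices; a vertex is a pair of a degree and a label. -/
def gluingSumOn (N : ℕ) (S : Finset (ℕ × ℕ)) : ℚ :=
  gluingSum N fun x : {x // x ∈ S} => x.1.1

lemma gluingSumOn_eq_expect (N : ℕ) (S : Finset (ℕ × ℕ)) :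
    gluingSumOn N S = expect N (∏ v ∈ S, trPow N v.1) := by
  rw [gluingSumOn, gluingSum, ← expect_prod_trPow,
    Finset.prod_coe_sort S fun v : ℕ × ℕ => trPow N v.1]

lemma gluingSumOn_empty (N : ℕ) : gluingSumOn N ∅ = 1 := by
  rw [gluingSumOn_eq_expect, Finset.prod_empty]
  exact gauss_one _

/-- `connSumOn` depends only on the degrees. -/
lemma connSumOn_image {V : Type*} [Fintype V] [DecidableEq V] (N : ℕ) {φ : V → ℕ × ℕ}
    (hφ : Function.Injective φ) :
    connSumOn N (Finset.univ.image φ) = connSum N fun v => (φ v).1 := by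
  refine (connSum_congr N (Equiv.ofBijective
    (fun v => (⟨φ v, Finset.mem_image_of_mem φ (Finset.mem_univ v)⟩ :
      {x // x ∈ Finset.univ.image φ})) ⟨fun v w h => hφ (congrArg Subtype.val h), ?_⟩)
    fun v => rfl).symm
  rintro ⟨x, hx⟩
  obtain ⟨v, -, rfl⟩ := Finset.mem_image.1 hx
  exact ⟨v, rfl⟩

lemma gluingSumOn_eq_sum_component (N : ℕ) (S : Finset (ℕ × ℕ)) (v₀ : ℕ × ℕ) (h0 : v₀ ∈ S) :
    gluingSumOn N S = ∑ I ∈ S.powerset.filter fun I => v₀ ∈ I,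
      connSumOn N I * gluingSumOn N (S \ I) := by
  rw [gluingSumOn, gluingSum_eq_sum_component N _ ⟨v₀, h0⟩]
  refine Finset.sum_bij' (fun I _ => I.map (Function.Embedding.subtype _))
    (fun I _ => I.subtype (· ∈ S)) ?_ ?_ ?_ ?_ ?_
  · intro I hI
    simp only [Finset.mem_filter, Finset.mem_univ, true_and] at hI
    rw [Finset.mem_filter, Finset.mem_powerset]
    refine ⟨fun x hx => ?_, Finset.mem_map.2 ⟨_, hI, rfl⟩⟩
    obtain ⟨y, -, rfl⟩ := Finset.mem_map.1 hx
    exact y.2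
  · intro I hI
    simp only [Finset.mem_filter] at hI
    simpa using hI.2
  · intro I _
    ext x
    simp
  · intro I hI
    simp only [Finset.mem_filter, Finset.mem_powerset] at hI
    ext x
    simpa using fun h => hI.1 h
  · intro I _
    congr 1
    · refine connSum_congr N (Equiv.ofBijective (fun x => ⟨x.1.1, Finset.mem_map.2 ⟨x.1, x.2, rfl⟩⟩)
        ⟨fun x y h => Subtype.ext (Subtype.ext (Subtype.mk.inj h)), ?_⟩) fun v => rfl
      rintro ⟨x, hx⟩
      obtain ⟨y, hy, rfl⟩ := Finset.mem_map.1 hx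
      exact ⟨⟨y, hy⟩, rfl⟩
    · have hmem : ∀ x : {x // x ∉ I},
          x.1.1 ∈ S \ I.map (Function.Embedding.subtype _) := by
        intro x
        rw [Finset.mem_sdiff]
        refine ⟨x.1.2, fun h => ?_⟩
        obtain ⟨y, hy, hyx⟩ := Finset.mem_map.1 h
        have : y = x.1 := Subtype.ext hyx
        exact x.2 (this ▸ hy)
      refine gluingSum_comp N (Equiv.ofBijective
        (fun x : {x // x ∉ I} => (⟨x.1.1, hmem x⟩ :
          {y // y ∈ S \ I.map (Function.Embedding.subtype _)}))
        ⟨fun x y h => Subtype.ext (Subtype.ext (Subtype.mk.inj h)), ?_⟩) (fun y => y.1.1)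
      rintro ⟨x, hx⟩
      rw [Finset.mem_sdiff] at hx
      exact ⟨⟨⟨x, hx.1⟩, fun h => hx.2 (Finset.mem_map.2 ⟨_, h, rfl⟩)⟩, rfl⟩

lemma gluingSumOn_insert (N : ℕ) (S : Finset (ℕ × ℕ)) (v₀ : ℕ × ℕ) (h0 : v₀ ∉ S) :
    gluingSumOn N (insert v₀ S)
      = conv (fun I => connSumOn N (insert v₀ I)) (gluingSumOn N) S := by
  rw [gluingSumOn_eq_sum_component N _ v₀ (Finset.mem_insert_self _ _), conv]
  refine (Finset.sum_bij (fun I _ => insert v₀ I) ?_ ?_ ?_ ?_).symm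
  · intro I hI
    rw [Finset.mem_powerset] at hI
    rw [Finset.mem_filter, Finset.mem_powerset]
    exact ⟨Finset.insert_subset_insert _ hI, Finset.mem_insert_self _ _⟩
  · intro I hI J hJ h
    rw [Finset.mem_powerset] at hI hJ
    rw [← Finset.erase_insert (fun h => h0 (hI h)), h, Finset.erase_insert (fun h => h0 (hJ h))]
  · intro I hI
    rw [Finset.mem_filter, Finset.mem_powerset] at hI
    exact ⟨I.erase v₀, Finset.mem_powerset.2 (Finset.subset_insert_iff.1 hI.1),
      Finset.insert_erase hI.2⟩
  · intro I _
    congr 2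
    ext x
    simp only [Finset.mem_sdiff, Finset.mem_insert, not_or]
    constructor
    · exact fun h => ⟨Or.inr h.1, fun hx => h0 (hx ▸ h.1), h.2⟩
    · exact fun h => ⟨h.1.resolve_left h.2.1, h.2.2⟩

lemma gluingSumOn_insert_insert (N : ℕ) (S : Finset (ℕ × ℕ)) (v w : ℕ × ℕ) (hv : v ∉ S)
    (hw : w ∉ S) (hvw : v ≠ w) :
    gluingSumOn N (insert v (insert w S))
      = conv (fun I => connSumOn N (insert v (insert w I))) (gluingSumOn N) S
        + conv (fun I => connSumOn N (insert v I)) (fun J => gluingSumOn N (insert w J)) S := by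
  rw [gluingSumOn_insert N _ v (by simp [hv, hvw]), conv, Finset.sum_powerset_insert hw,
    add_comm]
  congr 1
  · refine Finset.sum_congr rfl fun I hI => ?_
    rw [Finset.mem_powerset] at hI
    congr 2
    ext x
    simp only [Finset.mem_sdiff, Finset.mem_insert, not_or]
    constructor
    · exact fun h => ⟨h.1.resolve_left h.2.1, h.2.2⟩
    · exact fun h => ⟨Or.inr h.1, fun hx => hw (hx ▸ h.1), h.2⟩
  · refine Finset.sum_congr rfl fun I hI => ?_
    rw [Finset.mem_powerset] at hI
    congr 2
    rw [Finset.insert_sdiff_of_notMem _ fun h => hw (hI h)]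

/-- The degree of a first vertex is lowered by cutting its first edge: the recursion for the
connected sums which corresponds to the loop equation. Labels `0` and `1` are reserved for the
vertices which are cut. -/
theorem connSumOn_recursion (N : ℕ) (a : ℕ) (S₀ : Finset (ℕ × ℕ)) (hS₀ : ∀ v ∈ S₀, 2 ≤ v.2) :
    connSumOn N (insert (a + 1, 0) S₀)
      = ∑ p ∈ Finset.range a,
          (connSumOn N (insert (p, 0) (insert (a - 1 - p, 1) S₀))
            + ∑ I ∈ S₀.powerset, connSumOn N (insert (p, 0) I)
                * connSumOn N (insert (a - 1 - p, 0) (S₀ \ I)))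
        + ∑ v ∈ S₀, (v.1 : ℚ) * connSumOn N (insert (a + v.1 - 1, 0) (S₀.erase v)) := by
  have fresh : ∀ S ⊆ S₀, ∀ a l, l < 2 → ((a, l) : ℕ × ℕ) ∉ S := fun S hS a l hl h => by
    have := hS₀ _ (hS h)
    simp only at this
    omega
  have relabel : ∀ S ⊆ S₀, ∀ a, connSumOn N (insert (a, 1) S) = connSumOn N (insert (a, 0) S) := by
    intro S hS a
    have e1 : ∀ l < 2, insert ((a, l) : ℕ × ℕ) S
        = Finset.univ.image (fun o : Option {x // x ∈ S} => o.elim (a, l) Subtype.val) := by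
      intro l _
      ext x
      simp [Option.exists, eq_comm]
    have inj : ∀ l < 2, Function.Injective
        (fun o : Option {x // x ∈ S} => o.elim ((a, l) : ℕ × ℕ) Subtype.val) := by
      rintro l hl (_ | x) (_ | y) h
      · rfl
      · exact absurd (show (a, l) ∈ S by have : (a, l) = y.1 := h; rw [this]; exact y.2)
          (fresh S hS a l hl)
      · exact absurd (show (a, l) ∈ S by have : x.1 = (a, l) := h; rw [← this]; exact x.2)
          (fresh S hS a l hl)
      · exact congrArg some (Subtype.ext h)
    rw [e1 1 (by norm_num), e1 0 (by norm_num), connSumOn_image N (inj 1 (by norm_num)),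
      connSumOn_image N (inj 0 (by norm_num))]
    congr 1
    ext o
    rcases o with _ | x <;> rfl
  refine conv_right_cancel (f := fun I => connSumOn N (insert (a + 1, 0) I))
    (g := fun S => ∑ p ∈ Finset.range a,
          (connSumOn N (insert (p, 0) (insert (a - 1 - p, 1) S))
            + ∑ I ∈ S.powerset, connSumOn N (insert (p, 0) I)
                * connSumOn N (insert (a - 1 - p, 0) (S \ I)))
        + ∑ v ∈ S, (v.1 : ℚ) * connSumOn N (insert (a + v.1 - 1, 0) (S.erase v)))
    (gluingSumOn_empty N) (S₀ := S₀) (fun S hS => ?_) S₀ le_rfl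
  rw [← gluingSumOn_insert N S _ (fresh S hS _ _ (by norm_num)), conv_add_left, conv_sum_left,
    conv_sum_erase (fun v => (v.1 : ℚ)) (fun v I => connSumOn N (insert (a + v.1 - 1, 0) I)),
    gluingSumOn_eq_expect, Finset.prod_insert (fresh S hS _ _ (by norm_num)), loop_equation]
  congr 1
  · refine Finset.sum_congr rfl fun p _ => ?_
    rw [conv_add_left]
    change _ = _ + conv (conv (fun I => connSumOn N (insert (p, 0) I))
      (fun I => connSumOn N (insert (a - 1 - p, 0) I))) (gluingSumOn N) S
    rw [conv_assoc, conv_congr_right (f := fun I => connSumOn N (insert (p, 0) I))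
        (g' := fun J => gluingSumOn N (insert (a - 1 - p, 1) J)),
      ← gluingSumOn_insert_insert N S _ _ (fresh S hS _ _ (by norm_num))
        (fresh S hS _ _ (by norm_num)) (by simp), gluingSumOn_eq_expect, Finset.prod_insert,
        Finset.prod_insert (fresh S hS _ _ (by norm_num)), mul_assoc]
    · rw [Finset.mem_insert, not_or]
      exact ⟨by simp, fresh S hS _ _ (by norm_num)⟩
    · intro I hI
      rw [gluingSumOn_insert N I _ (fresh I (hI.trans hS) _ _ (by norm_num))]
      refine Finset.sum_congr rfl fun J hJ => ?_
      dsimp only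
      rw [relabel J ((Finset.mem_powerset.1 hJ).trans (hI.trans hS))]
  · refine Finset.sum_congr rfl fun v _ => ?_
    have hS' := (Finset.erase_subset v S).trans hS
    rw [← gluingSumOn_insert N _ _ (fresh _ hS' _ _ (by norm_num)), gluingSumOn_eq_expect,
      Finset.prod_insert (fresh _ hS' _ _ (by norm_num))]

end Labelled

/-! ### The recursion for connected gluings of given genus -/

section Faces

/-- The number of cycles of a permutation, fixed points included. -/
noncomputable def numCycles {H : Type*} (π : Equiv.Perm H) : ℕ :=
  Nat.card (Quotient (Equiv.Perm.SameCycle.setoid π))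

lemma colorings_eq_pow {H : Type*} [Fintype H] [DecidableEq H] (N : ℕ) (π : Equiv.Perm H) :
    colorings N π = N ^ numCycles π := by
  classical
  have inv : ∀ (f : H → Fin N), (∀ h, f (π h) = f h) → ∀ x y, π.SameCycle x y → f x = f y := by
    rintro f hf x y ⟨k, rfl⟩
    induction k using Int.induction_on with
    | zero => rfl
    | succ k ih => rw [add_comm, zpow_add, zpow_one, Equiv.Perm.mul_apply, hf, ih]
    | pred k ih =>
      rw [ih, ← hf ((π ^ (-(k : ℤ) - 1)) x), ← Equiv.Perm.mul_apply, ← zpow_one_add]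
      congr 3
      ring
  rw [colorings, numCycles, Nat.card_eq_fintype_card]
  conv_rhs => rw [← Fintype.card_fin N, ← Fintype.card_fun]
  refine Fintype.card_congr
    { toFun := fun f => Quotient.lift f.1 (inv f.1 f.2)
      invFun := fun F => ⟨fun h => F (Quotient.mk _ h), fun h => ?_⟩
      left_inv := fun f => rfl
      right_inv := fun F => ?_ }
  · exact congrArg F (Quotient.sound ⟨-1, by simp⟩)
  · ext q
    induction q using Quotient.inductionOn
    rfl

variable {V : Type*} [Fintype V] [DecidableEq V]

/-- The number of faces of the gluing `α` of vertices of degrees `μ`. -/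
noncomputable def numFaces (μ : V → ℕ) (α : Equiv.Perm (Σ v, Fin (μ v))) : ℕ :=
  numCycles (rotation μ * α) + (Finset.univ.filter fun v => μ v = 0).card

/-- The generating polynomial of the connected gluings by the number of faces. -/
noncomputable def facePoly (μ : V → ℕ) : Polynomial ℚ :=
  ∑ α ∈ connMatchings (Sigma.fst : (Σ v, Fin (μ v)) → V), Polynomial.X ^ numFaces μ α

lemma eval_facePoly (N : ℕ) (μ : V → ℕ) : (facePoly μ).eval (N : ℚ) = connSum N μ := by
  rw [facePoly, connSum, Polynomial.eval_finsetSum, Finset.mul_sum]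
  refine Finset.sum_congr rfl fun α _ => ?_
  rw [Polynomial.eval_pow, Polynomial.eval_X, numFaces, pow_add, colorings_eq_pow, mul_comm,
    Finset.prod_ite, Finset.prod_const, Finset.prod_const_one, mul_one]
  push_cast
  rfl

/-- The number of connected gluings of genus `g` of `n` polygons with degrees `μ`, equivalently of
dessins with a marked half-edge at every vertex. It includes the graph which consists of a single
vertex without edges. -/
noncomputable def gluingCount (g n : ℕ) (μ : Fin n → ℕ) : ℕ := by
  classical
  exact ((connMatchings (Sigma.fst : (Σ v, Fin (μ v)) → Fin n)).filter fun α =>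
    2 * (n + numFaces μ α + 2 * g) = (∑ i, μ i) + 4).card

end Faces

section FinForm

/-- The restriction of a tuple to a set of indices, listed in increasing order. -/
def restr {α : Type*} {m : ℕ} (I : Finset (Fin m)) (f : Fin m → α) : Fin I.card → α :=
  fun k => f (I.orderEmbOfFin rfl k)

lemma sum_restr {M : Type*} [AddCommMonoid M] {m : ℕ} (I : Finset (Fin m)) (f : Fin m → M) :
    ∑ k, restr I f k = ∑ i ∈ I, f i := by
  rw [← Finset.sum_coe_sort I, ← (I.orderIsoOfFin rfl).toEquiv.sum_comp]
  rfl

lemma prod_restr {M : Type*} [CommMonoid M] {m : ℕ} (I : Finset (Fin m)) (f : Fin m → M) :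
    ∏ k, restr I f k = ∏ i ∈ I, f i := by
  rw [← Finset.prod_coe_sort I, ← (I.orderIsoOfFin rfl).toEquiv.prod_comp]
  rfl

/-- The connected sum with vertices labelled by `Fin m` and one more vertex. -/
lemma connSumOn_insert_image (N a l : ℕ) (hl : l < 2) {m : ℕ} (μ : Fin m → ℕ)
    (I : Finset (Fin m)) :
    connSumOn N (insert (a, l) (I.image fun i => (μ i, (i : ℕ) + 2)))
      = connSum N (Fin.cons a (restr I μ) : Fin (I.card + 1) → ℕ) := by
  have hinj : Function.Injective (Fin.cons (a, l) (restr I fun i => (μ i, (i : ℕ) + 2)) :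
      Fin (I.card + 1) → ℕ × ℕ) := by
    rw [Fin.cons_injective_iff]
    constructor
    · rintro ⟨k, hk⟩
      have := congrArg Prod.snd hk
      simp only [restr] at this
      omega
    · intro k k' h
      have := congrArg Prod.snd h
      simp only [restr, Nat.add_right_cancel_iff] at this
      exact (I.orderEmbOfFin rfl).injective (Fin.ext this)
  have himg : insert (a, l) (I.image fun i => (μ i, (i : ℕ) + 2))
      = Finset.univ.image (Fin.cons (a, l) (restr I fun i => (μ i, (i : ℕ) + 2)) :
        Fin (I.card + 1) → ℕ × ℕ) := by
    ext x
    rw [Finset.mem_insert, Finset.mem_image, Finset.mem_image]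
    have : (∃ i ∈ I, (μ i, (i : ℕ) + 2) = x) ↔ ∃ k : Fin I.card,
        restr I (fun i => (μ i, (i : ℕ) + 2)) k = x := by
      constructor
      · rintro ⟨i, hi, h⟩
        refine ⟨(I.orderIsoOfFin rfl).symm ⟨i, hi⟩, ?_⟩
        simp only [restr, ← Finset.coe_orderIsoOfFin_apply, OrderIso.apply_symm_apply]
        exact h
      · rintro ⟨k, h⟩
        exact ⟨_, I.orderEmbOfFin_mem rfl k, h⟩
    rw [this]
    simp [Fin.exists_fin_succ, eq_comm]
  rw [himg, connSumOn_image N hinj]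
  congr 1
  ext k
  refine Fin.cases rfl (fun k => rfl) k

lemma connSumOn_insert_insert_image (N a b : ℕ) {m : ℕ} (μ : Fin m → ℕ) :
    connSumOn N (insert (a, 0) (insert (b, 1) (Finset.univ.image fun i => (μ i, (i : ℕ) + 2))))
      = connSum N (Fin.cons a (Fin.cons b μ) : Fin (m + 2) → ℕ) := by
  have hinj : Function.Injective (Fin.cons (a, 0) (Fin.cons (b, 1)
      (fun i => (μ i, (i : ℕ) + 2))) : Fin (m + 2) → ℕ × ℕ) := by
    rw [Fin.cons_injective_iff, Fin.cons_injective_iff]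
    refine ⟨?_, ?_, ?_⟩
    · rintro ⟨k, hk⟩
      have := congrArg Prod.snd hk
      refine Fin.cases (fun h => ?_) (fun k h => ?_) k this <;> simp at h
    · rintro ⟨k, hk⟩
      have := congrArg Prod.snd hk
      simp at this
    · intro k k' h
      have := congrArg Prod.snd h
      simp only [Nat.add_right_cancel_iff] at this
      exact Fin.ext this
  have himg : insert (a, 0) (insert (b, 1) (Finset.univ.image fun i => (μ i, (i : ℕ) + 2)))
      = Finset.univ.image (Fin.cons (a, 0) (Fin.cons (b, 1)
        (fun i => (μ i, (i : ℕ) + 2))) : Fin (m + 2) → ℕ × ℕ) := by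
    ext x
    simp [Fin.exists_fin_succ, eq_comm]
  rw [himg, connSumOn_image N hinj]
  congr 1
  ext k
  refine Fin.cases rfl (fun k => Fin.cases rfl (fun k => rfl) k) k

lemma connSum_recursion (N a : ℕ) {m : ℕ} (μ : Fin m → ℕ) :
    connSum N (Fin.cons (a + 1) μ : Fin (m + 1) → ℕ)
      = ∑ p ∈ Finset.range a,
          (connSum N (Fin.cons p (Fin.cons (a - 1 - p) μ) : Fin (m + 2) → ℕ)
            + ∑ I : Finset (Fin m), connSum N (Fin.cons p (restr I μ) : Fin (I.card + 1) → ℕ)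
                * connSum N (Fin.cons (a - 1 - p) (restr Iᶜ μ) : Fin (Iᶜ.card + 1) → ℕ))
        + ∑ j, (μ j : ℚ) *
            connSum N (Fin.cons (a + μ j - 1) (restr {j}ᶜ μ) :
              Fin (({j}ᶜ : Finset (Fin m)).card + 1) → ℕ) := by
  set φ : Fin m → ℕ × ℕ := fun i => (μ i, (i : ℕ) + 2) with hφ
  have hinj : Function.Injective φ := fun i j h => by
    have := congrArg Prod.snd h
    simp only [hφ, Nat.add_right_cancel_iff] at this
    exact Fin.ext this
  have h0 : connSum N (Fin.cons (a + 1) μ : Fin (m + 1) → ℕ)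
      = connSumOn N (insert (a + 1, 0) (Finset.univ.image φ)) := by
    rw [connSumOn_insert_image N _ 0 (by norm_num)]
    refine (connSum_congr N (finCongr (by simp)) fun k => ?_).symm
    refine Fin.cases rfl (fun k => ?_) k
    have : (finCongr (by simp : (Finset.univ : Finset (Fin m)).card + 1 = m + 1)) k.succ
        = Fin.succ (finCongr (by simp) k) := rfl
    rw [this, Fin.cons_succ, Fin.cons_succ, restr]
    congr 1
    have h := Finset.orderEmbOfFin_unique (s := (Finset.univ : Finset (Fin m))) rfl
      (f := finCongr (by simp)) (fun _ => Finset.mem_univ _) (fun x y h => h)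
    exact congrFun h k
  rw [h0, connSumOn_recursion]
  · congr 1
    · refine Finset.sum_congr rfl fun p _ => ?_
      rw [connSumOn_insert_insert_image]
      congr 1
      symm
      refine Finset.sum_bij (fun I _ => I.image φ) ?_ ?_ ?_ ?_
      · intro I _
        exact Finset.mem_powerset.2 (Finset.image_subset_image (Finset.subset_univ I))
      · intro I _ J _ h
        exact Finset.image_injective hinj h
      · intro I hI
        obtain ⟨J, -, rfl⟩ := Finset.subset_image_iff.1 (Finset.mem_powerset.1 hI)
        exact ⟨J, Finset.mem_univ _, rfl⟩
      · intro I _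
        rw [← Finset.image_sdiff _ _ hinj, ← Finset.compl_eq_univ_sdiff,
          connSumOn_insert_image N _ 0 (by norm_num), connSumOn_insert_image N _ 0 (by norm_num)]
    · rw [Finset.sum_image fun i _ j _ h => hinj h]
      refine Finset.sum_congr rfl fun j _ => ?_
      rw [← Finset.image_erase hinj, show Finset.univ.erase j = ({j} : Finset (Fin m))ᶜ by
        ext; simp, connSumOn_insert_image N _ 0 (by norm_num)]
  · intro v hv
    obtain ⟨i, -, rfl⟩ := Finset.mem_image.1 hv
    simp [hφ]

lemma facePoly_recursion (a : ℕ) {m : ℕ} (μ : Fin m → ℕ) :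
    facePoly (Fin.cons (a + 1) μ : Fin (m + 1) → ℕ)
      = ∑ p ∈ Finset.range a,
          (facePoly (Fin.cons p (Fin.cons (a - 1 - p) μ) : Fin (m + 2) → ℕ)
            + ∑ I : Finset (Fin m), facePoly (Fin.cons p (restr I μ) : Fin (I.card + 1) → ℕ)
                * facePoly (Fin.cons (a - 1 - p) (restr Iᶜ μ) : Fin (Iᶜ.card + 1) → ℕ))
        + ∑ j, (Polynomial.C (μ j : ℚ)) *
            facePoly (Fin.cons (a + μ j - 1) (restr {j}ᶜ μ) :
              Fin (({j}ᶜ : Finset (Fin m)).card + 1) → ℕ) := by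
  refine Polynomial.eq_of_infinite_eval_eq _ _
    ((Set.infinite_range_of_injective (Nat.cast_injective (R := ℚ))).mono ?_)
  rintro _ ⟨N, rfl⟩
  simp only [Set.mem_ofPred_eq, Polynomial.eval_add, Polynomial.eval_finsetSum,
    Polynomial.eval_mul, Polynomial.eval_C, eval_facePoly]
  exact connSum_recursion N a μ

end FinForm

section Genus

/-- `Q` is the generating polynomial of the connected gluings by the genus: by Euler's formula it is
related to the one by the number of faces through the substitution `X ↦ s ^ 2` and `X ↦ s ^ (-4)`.
-/
def IsGenusPoly {n : ℕ} (μ : Fin n → ℕ) (Q : Polynomial ℚ) : Prop :=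
  ∀ s : ℚ, s ≠ 0 → (facePoly μ).eval (s ^ 2)
    = s ^ (((∑ i, μ i : ℕ) : ℤ) + 4 - 2 * n) * Q.eval (s ^ (-4 : ℤ))

lemma IsGenusPoly.coeff_eq {n : ℕ} {μ : Fin n → ℕ} {Q : Polynomial ℚ} (hQ : IsGenusPoly μ Q)
    (g : ℕ) : Q.coeff g = gluingCount g n μ := by
  classical
  set G := g + Q.natDegree with hG
  have hpoly : ∑ α ∈ connMatchings (Sigma.fst : (Σ v, Fin (μ v)) → Fin n),
      (Polynomial.X : Polynomial ℚ) ^ (2 * numFaces μ α + 2 * n + 4 * G)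
      = ∑ k ∈ Finset.range (G + 1),
        Polynomial.C (Q.coeff k) * Polynomial.X ^ ((∑ i, μ i) + 4 + 4 * (G - k)) := by
    refine Polynomial.eq_of_infinite_eval_eq _ _
      ((Set.infinite_range_of_injective (f := fun k : ℕ => ((k + 1 : ℕ) : ℚ))
        fun a b h => by simpa using h).mono ?_)
    rintro _ ⟨k, rfl⟩
    set s : ℚ := ((k + 1 : ℕ) : ℚ) with hs
    have hs0 : s ≠ 0 := by rw [hs]; positivity
    have h := hQ s hs0
    rw [facePoly, Polynomial.eval_finsetSum, Polynomial.eval_eq_sum_range' (n := G + 1)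
      (by omega)] at h
    simp only [Set.mem_ofPred_eq, Polynomial.eval_finsetSum, Polynomial.eval_pow,
      Polynomial.eval_X, Polynomial.eval_mul, Polynomial.eval_C] at h ⊢
    have h' := congrArg (fun x => x * s ^ (2 * n + 4 * G)) h
    simp only [Finset.sum_mul, Finset.mul_sum] at h'
    refine Eq.trans ?_ (h'.trans ?_)
    · refine Finset.sum_congr rfl fun α _ => ?_
      rw [← pow_mul, ← pow_add, add_assoc]
    · refine Finset.sum_congr rfl fun k hk => ?_
      have hk' : k ≤ G := by simpa [Nat.lt_succ_iff] using hk
      rw [← zpow_natCast, ← zpow_natCast, ← zpow_natCast, mul_left_comm, ← zpow_mul, mul_assoc,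
        ← zpow_add₀ hs0, ← zpow_add₀ hs0]
      congr 2
      push_cast [Nat.cast_sub hk']
      ring
  have hc := congrArg (fun P => Polynomial.coeff P ((∑ i, μ i) + 4 + 4 * (G - g))) hpoly
  simp only [Polynomial.finsetSum_coeff, Polynomial.coeff_X_pow, Polynomial.coeff_C_mul] at hc
  rw [Finset.sum_eq_single g] at hc
  · rw [if_pos rfl, mul_one] at hc
    rw [← hc, gluingCount, ← Finset.sum_filter, Finset.sum_const, nsmul_eq_mul, mul_one]
    congr 2
    ext α
    simp only [Finset.mem_filter]
    refine and_congr_right fun _ => ?_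
    omega
  · intro k hk hkg
    rw [Finset.mem_range] at hk
    rw [if_neg (by omega), mul_zero]
  · intro h
    exact absurd (Finset.mem_range.2 (by omega)) h

lemma facePoly_cons_zero_of_pos {m : ℕ} (hm : 0 < m) (μ : Fin m → ℕ) :
    facePoly (Fin.cons 0 μ : Fin (m + 1) → ℕ) = 0 := by
  rw [facePoly, Finset.sum_eq_zero]
  intro α hα
  exfalso
  rcases (mem_connMatchings.1 hα).2 {0} (fun h hh => by
    rw [Finset.mem_singleton] at hh
    obtain ⟨x, i⟩ := h
    simp only at hh
    subst hh
    exact i.elim0) with h | h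
  · simp at h
  · have := congrArg Finset.card h
    simp at this
    omega

lemma mem_connMatchings_of_isEmpty {H : Type*} [Fintype H] [DecidableEq H] [IsEmpty H]
    (v : H → Fin 1) (α : Equiv.Perm H) : α ∈ connMatchings v := by
  rw [mem_connMatchings, mem_matchings]
  refine ⟨⟨Subsingleton.elim _ _, fun h => isEmptyElim h⟩, fun I _ => ?_⟩
  rcases I.eq_empty_or_nonempty with h | ⟨x, hx⟩
  · exact Or.inl h
  · refine Or.inr ?_
    ext y
    exact ⟨fun _ => Finset.mem_univ y, fun _ => Subsingleton.elim x y ▸ hx⟩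

lemma facePoly_single_zero : facePoly (fun _ => 0 : Fin 1 → ℕ) = Polynomial.X := by
  have hE : IsEmpty (Σ _ : Fin 1, Fin 0) := ⟨fun h => h.2.elim0⟩
  rw [facePoly, Finset.sum_eq_single 1]
  · have : numCycles (rotation (fun _ : Fin 1 => 0) * 1) = 0 := by
      rw [numCycles, Nat.card_eq_zero]
      exact Or.inl ⟨fun q => q.inductionOn fun h => h.2.elim0⟩
    rw [numFaces, this]
    simp
  · intro α _ h
    exact absurd (Subsingleton.elim _ _) h
  · intro h
    exact absurd (mem_connMatchings_of_isEmpty _ _) h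

lemma IsGenusPoly.step {a m : ℕ} {μ : Fin m → ℕ} {Q₂ : ℕ → Polynomial ℚ}
    {Q : (I : Finset (Fin m)) → ℕ → Polynomial ℚ}
    (h₂ : ∀ p < a, IsGenusPoly (Fin.cons p (Fin.cons (a - 1 - p) μ) : Fin (m + 2) → ℕ) (Q₂ p))
    (h : ∀ I p, p < a → IsGenusPoly (Fin.cons p (restr I μ) : Fin (I.card + 1) → ℕ) (Q I p))
    (hj : ∀ j, μ j ≠ 0 → IsGenusPoly (Fin.cons (a + μ j - 1) (restr {j}ᶜ μ) :
      Fin (({j}ᶜ : Finset (Fin m)).card + 1) → ℕ) (Q {j}ᶜ (a + μ j - 1))) :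
    IsGenusPoly (Fin.cons (a + 1) μ : Fin (m + 1) → ℕ)
      (∑ p ∈ Finset.range a, (Polynomial.X * Q₂ p
          + ∑ I : Finset (Fin m), Q I p * Q Iᶜ (a - 1 - p))
        + ∑ j, Polynomial.C (μ j : ℚ) * Q {j}ᶜ (a + μ j - 1)) := by
  intro s hs
  rw [facePoly_recursion]
  simp only [Polynomial.eval_add, Polynomial.eval_finsetSum, Polynomial.eval_mul,
    Polynomial.eval_C, Polynomial.eval_X, mul_add, Finset.mul_sum]
  congr 1
  · refine Finset.sum_congr rfl fun p hp => ?_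
    rw [Finset.mem_range] at hp
    congr 1
    · rw [h₂ p hp s hs, ← mul_assoc, ← zpow_add₀ hs]
      congr 2
      simp only [Fin.sum_cons]
      push_cast [show a - 1 - p + p + 1 = a by omega]
      have : ((a - 1 - p : ℕ) : ℤ) = a - 1 - p := by omega
      rw [this]
      ring
    · refine Finset.sum_congr rfl fun I _ => ?_
      rw [h I p hp s hs, h Iᶜ (a - 1 - p) (by omega) s hs, mul_mul_mul_comm, ← zpow_add₀ hs]
      congr 2
      simp only [Fin.sum_cons, sum_restr]
      rw [← Finset.sum_add_sum_compl I μ, Finset.card_compl, Fintype.card_fin]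
      have : ((a - 1 - p : ℕ) : ℤ) = a - 1 - p := by omega
      have hI : I.card ≤ m := by simpa using Finset.card_le_univ I
      push_cast [Nat.cast_sub hI]
      rw [this]
      ring
  · refine Finset.sum_congr rfl fun j _ => ?_
    by_cases h0 : μ j = 0
    · simp [h0]
    rw [hj j h0 s hs, mul_left_comm]
    congr 2
    simp only [Fin.sum_cons, sum_restr]
    rw [← Finset.sum_add_sum_compl {j} μ, Finset.sum_singleton]
    have hm : ((({j}ᶜ : Finset (Fin m)).card : ℕ) : ℤ) = m - 1 := by
      have := j.pos
      rw [Finset.card_compl, Fintype.card_fin, Finset.card_singleton]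
      omega
    have : ((a + μ j - 1 : ℕ) : ℤ) = a + μ j - 1 := by omega
    push_cast
    rw [hm]
    rw [this]
    ring

theorem exists_isGenusPoly (m a : ℕ) (μ : Fin m → ℕ) :
    ∃ Q, IsGenusPoly (Fin.cons a μ : Fin (m + 1) → ℕ) Q := by
  induction hT : a + ∑ i, μ i using Nat.strong_induction_on generalizing m a with
  | _ T ih =>
    rcases a with _ | a
    · rcases Nat.eq_zero_or_pos m with rfl | hm
      · refine ⟨1, fun s hs => ?_⟩
        rw [show (Fin.cons 0 μ : Fin 1 → ℕ) = fun _ => 0 from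
          funext fun i => by rw [Subsingleton.elim (α := Fin 1) i 0]; rfl, facePoly_single_zero]
        simp
      · exact ⟨0, fun s hs => by rw [facePoly_cons_zero_of_pos hm]; simp⟩
    · have hle : ∀ I : Finset (Fin m), ∑ i ∈ I, μ i ≤ ∑ i, μ i := fun I =>
        Finset.sum_le_sum_of_subset (Finset.subset_univ I)
      have h₂ : ∀ p, ∃ Q, p < a →
          IsGenusPoly (Fin.cons p (Fin.cons (a - 1 - p) μ) : Fin (m + 2) → ℕ) Q := by
        intro p
        by_cases hp : p < a
        · obtain ⟨Q, hQ⟩ := ih (p + (a - 1 - p + ∑ i, μ i)) (by omega) (m + 1) p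
            (Fin.cons (a - 1 - p) μ) (by rw [Fin.sum_cons])
          exact ⟨Q, fun _ => hQ⟩
        · exact ⟨0, fun h => absurd h hp⟩
      have h : ∀ (I : Finset (Fin m)) p, ∃ Q, (p < a ∨ ∃ j, μ j ≠ 0 ∧ I = {j}ᶜ ∧ p = a + μ j - 1) →
          IsGenusPoly (Fin.cons p (restr I μ) : Fin (I.card + 1) → ℕ) Q := by
        intro I p
        by_cases hp : p < a ∨ ∃ j, μ j ≠ 0 ∧ I = {j}ᶜ ∧ p = a + μ j - 1
        · obtain ⟨Q, hQ⟩ := ih (p + ∑ i ∈ I, μ i) (by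
            rcases hp with hp | ⟨j, hj, rfl, rfl⟩
            · have := hle I
              omega
            · have := Finset.sum_add_sum_compl {j} μ
              rw [Finset.sum_singleton] at this
              omega) _ p (restr I μ) (by rw [sum_restr])
          exact ⟨Q, fun _ => hQ⟩
        · exact ⟨0, fun h => absurd h hp⟩
      choose Q₂ hQ₂ using h₂
      choose Q hQ using h
      exact ⟨_, IsGenusPoly.step hQ₂ (fun I p hp => hQ I p (Or.inl hp))
        fun j hj => hQ _ _ (Or.inr ⟨j, hj, rfl, rfl⟩)⟩

/-- The recursion for the number of connected gluings: remove the marked edge at the first vertex.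
It is a loop, which splits the vertex into two vertices, or it is contracted. -/
theorem gluingCount_cons_succ (g a : ℕ) {m : ℕ} (μ : Fin m → ℕ) :
    gluingCount g (m + 1) (Fin.cons (a + 1) μ)
      = ∑ p ∈ Finset.range a,
          ((if g = 0 then 0 else
              gluingCount (g - 1) (m + 2) (Fin.cons p (Fin.cons (a - 1 - p) μ)))
            + ∑ h ∈ Finset.HasAntidiagonal.antidiagonal g, ∑ I : Finset (Fin m),
                gluingCount h.1 (I.card + 1) (Fin.cons p (restr I μ))
                * gluingCount h.2 (Iᶜ.card + 1) (Fin.cons (a - 1 - p) (restr Iᶜ μ)))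
        + ∑ j, μ j * gluingCount g (({j}ᶜ : Finset (Fin m)).card + 1)
            (Fin.cons (a + μ j - 1) (restr {j}ᶜ μ)) := by
  have h₂ := fun p => exists_isGenusPoly (m + 1) p (Fin.cons (a - 1 - p) μ)
  have h := fun (I : Finset (Fin m)) p => exists_isGenusPoly _ p (restr I μ)
  choose Q₂ hQ₂ using h₂
  choose Q hQ using h
  have hs := IsGenusPoly.coeff_eq (IsGenusPoly.step (a := a) (fun p _ => hQ₂ p)
    (fun I p _ => hQ I p) fun j _ => hQ _ _) g
  rw [← Nat.cast_inj (R := ℚ), ← hs]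
  simp only [Polynomial.coeff_add, Polynomial.finsetSum_coeff, Polynomial.coeff_C_mul,
    (hQ _ _).coeff_eq]
  push_cast
  congr 1
  refine Finset.sum_congr rfl fun p _ => ?_
  congr 1
  · rcases g with _ | g
    · simp
    · simp [(hQ₂ p).coeff_eq]
  · simp only [Polynomial.coeff_mul, (hQ _ _).coeff_eq]
    rw [Finset.sum_comm]

lemma gluingCount_eq_zero_of_isolated (g : ℕ) {n : ℕ} (hn : 1 < n) (μ : Fin n → ℕ) (i : Fin n)
    (hi : μ i = 0) : gluingCount g n μ = 0 := by
  classical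
  rw [gluingCount, Finset.card_eq_zero, Finset.filter_eq_empty_iff]
  intro α hα
  exfalso
  rcases (mem_connMatchings.1 hα).2 {i} (fun h hh => by
    rw [Finset.mem_singleton] at hh
    obtain ⟨x, k⟩ := h
    simp only at hh
    subst hh
    exact absurd k.isLt (by omega)) with h | h
  · simp at h
  · have := congrArg Finset.card h
    simp at this
    omega

lemma gluingCount_single_zero (g : ℕ) :
    gluingCount g 1 (Fin.cons 0 Fin.elim0) = if g = 0 then 1 else 0 := by
  have h1 : (Fin.cons 0 Fin.elim0 : Fin 1 → ℕ) = fun _ => 0 :=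
    funext fun i => by rw [Subsingleton.elim (α := Fin 1) i 0]; rfl
  have h : IsGenusPoly (fun _ => 0 : Fin 1 → ℕ) 1 := by
    intro s hs
    rw [facePoly_single_zero]
    simp
  rw [h1, ← Nat.cast_inj (R := ℚ), ← h.coeff_eq g, Polynomial.coeff_one]
  push_cast
  rfl

end Genus

/-! ### Dessins up to isomorphism and gluings -/

section Data

variable {H H' : Type*} [Fintype H] [DecidableEq H] [Fintype H'] [DecidableEq H']

/-- `(σ, α, v)` is a dessin of type `(g, n)` with degrees `μ` on an arbitrary set `H` of half-edges.
Connectedness is expressed by `IsConn`. -/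
structure IsDessin (g n : ℕ) (μ : Fin n → ℕ) (σ α : Equiv.Perm H) (v : H → Fin n) : Prop where
  α_mul_self : α * α = 1
  α_ne : ∀ h, α h ≠ h
  vertex_eq_iff : ∀ h h', v h = v h' ↔ σ.SameCycle h h'
  degree : ∀ i, Nat.card {h // v h = i} = μ i
  connected : IsConn v α
  euler : 2 * (n + numCycles (σ * α) + 2 * g) = (∑ i, μ i) + 4

lemma sameCycle_permCongr (e : H ≃ H') (σ : Equiv.Perm H) (x y : H) :
    (e.permCongr σ).SameCycle (e x) (e y) ↔ σ.SameCycle x y := by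
  have h : ∀ k : ℤ, (e.permCongr σ) ^ k = e.permCongr (σ ^ k) := fun k =>
    (map_zpow e.permCongrHom σ k).symm
  simp only [Equiv.Perm.SameCycle, h, Equiv.permCongr_apply, Equiv.symm_apply_apply,
    EmbeddingLike.apply_eq_iff_eq]

lemma numCycles_permCongr (e : H ≃ H') (π : Equiv.Perm H) :
    numCycles (e.permCongr π) = numCycles π :=
  (Nat.card_congr (Quotient.congr e fun x y => (sameCycle_permCongr e π x y).symm)).symm

lemma IsDessin.transport {g n : ℕ} {μ : Fin n → ℕ} {σ α : Equiv.Perm H} {v : H → Fin n}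
    (h : IsDessin g n μ σ α v) (e : H ≃ H') :
    IsDessin g n μ (e.permCongr σ) (e.permCongr α) (v ∘ e.symm) where
  α_mul_self := by
    rw [← Equiv.permCongr_mul, h.α_mul_self]
    exact e.permCongr_refl
  α_ne x hx := by
    refine h.α_ne (e.symm x) ?_
    rwa [Equiv.eq_symm_apply]
  vertex_eq_iff x y := by
    rw [← e.apply_symm_apply x, ← e.apply_symm_apply y, sameCycle_permCongr, ← h.vertex_eq_iff]
    simp
  degree i := by
    rw [← h.degree i]
    exact Nat.card_congr (e.symm.subtypeEquiv fun x => Iff.rfl)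
  connected := by
    rw [isConn_permCongr e (Equiv.refl _) (v := v) (by simp)]
    exact h.connected
  euler := by
    rw [← Equiv.permCongr_mul, numCycles_permCongr]
    exact h.euler

lemma isPretransitive_of_isConn {n : ℕ} {σ α : Equiv.Perm H} {v : H → Fin n}
    (hv : ∀ h h', v h = v h' ↔ σ.SameCycle h h') (hc : IsConn v α) :
    MulAction.IsPretransitive (Subgroup.closure {σ, α}) H := by
  classical
  have hσ : σ ∈ Subgroup.closure {σ, α} := Subgroup.subset_closure (by simp)
  have hα : α ∈ Subgroup.closure {σ, α} := Subgroup.subset_closure (by simp)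
  have key : ∀ x y y', (∃ τ ∈ Subgroup.closure {σ, α}, τ x = y) → v y = v y' →
      ∃ τ ∈ Subgroup.closure {σ, α}, τ x = y' := by
    rintro x y y' ⟨τ, hτ, rfl⟩ hy
    obtain ⟨k, hk⟩ := (hv _ _).1 hy
    exact ⟨σ ^ k * τ, mul_mem (zpow_mem hσ k) hτ, hk⟩
  refine ⟨fun x y => ?_⟩
  have hclosed : IsClosedUnder v α (Finset.univ.filter fun i =>
      ∃ h, (∃ τ ∈ Subgroup.closure {σ, α}, τ x = h) ∧ v h = i) := by
    intro h hh
    rw [Finset.mem_filter] at hh ⊢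
    obtain ⟨-, h', hh', hv'⟩ := hh
    obtain ⟨τ, hτ, hτx⟩ := key x h' h hh' hv'
    exact ⟨Finset.mem_univ _, _, ⟨α * τ, mul_mem hα hτ, by rw [← hτx]; rfl⟩, rfl⟩
  rcases hc _ hclosed with h | h
  · have : v x ∈ (∅ : Finset (Fin n)) := by
      rw [← h, Finset.mem_filter]
      exact ⟨Finset.mem_univ _, x, ⟨1, one_mem _, rfl⟩, rfl⟩
    simp at this
  · have : v y ∈ (Finset.univ : Finset (Fin n)) := Finset.mem_univ _
    rw [← h, Finset.mem_filter] at this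
    obtain ⟨-, h', hh', hv'⟩ := this
    obtain ⟨τ, hτ, hτx⟩ := key x h' y hh' hv'
    exact ⟨⟨τ, hτ⟩, hτx⟩

lemma isConn_of_isPretransitive {n : ℕ} {σ α : Equiv.Perm H} {v : H → Fin n} (hα : α * α = 1)
    (hv : ∀ h h', v h = v h' ↔ σ.SameCycle h h') (hsurj : Function.Surjective v)
    (hc : MulAction.IsPretransitive (Subgroup.closure {σ, α}) H) : IsConn v α := by
  intro I hI
  rcases I.eq_empty_or_nonempty with h | ⟨i, hi⟩
  · exact Or.inl h
  right
  obtain ⟨x, rfl⟩ := hsurj i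
  have key : ∀ τ ∈ Subgroup.closure {σ, α}, ∀ h, v (τ h) ∈ I ↔ v h ∈ I := by
    intro τ hτ
    induction hτ using Subgroup.closure_induction with
    | mem τ hτ =>
      rcases hτ with rfl | rfl
      · intro h
        rw [(hv (τ h) h).2 ⟨-1, by simp⟩]
      · intro h
        refine ⟨fun h' => ?_, hI h⟩
        have := hI _ h'
        rwa [apply_apply_of_mul_self hα] at this
    | one => exact fun h => Iff.rfl
    | mul τ τ' _ _ h1 h2 =>
      intro h
      rw [Equiv.Perm.mul_apply, h1, h2]
    | inv τ _ h1 =>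
      intro h
      rw [← h1 (τ⁻¹ h), ← Equiv.Perm.mul_apply, mul_inv_cancel, Equiv.Perm.one_apply]
  ext j
  obtain ⟨y, rfl⟩ := hsurj j
  obtain ⟨⟨τ, hτ⟩, hτx⟩ := hc.exists_smul_eq x y
  have : τ x = y := hτx
  rw [← this, key τ hτ]
  simp [hi]

end Data

section Count

variable {g n : ℕ} {μ : Fin n → ℕ}

lemma isDessin_of_dessin (hμ : ∀ i, 0 < μ i) (γ : Dessin g n μ) :
    IsDessin g n μ γ.σ γ.α γ.vertex where
  α_mul_self := γ.α_mul_self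
  α_ne := γ.α_ne
  vertex_eq_iff := γ.vertex_eq_iff
  degree := γ.degree
  connected := by
    refine isConn_of_isPretransitive γ.α_mul_self γ.vertex_eq_iff (fun i => ?_) γ.connected
    have h : 0 < Nat.card {h // γ.vertex h = i} := by rw [γ.degree]; exact hμ i
    obtain ⟨x⟩ := (Nat.card_pos_iff.1 h).1
    exact ⟨x.1, x.2⟩
  euler := γ.euler

/-- The dessin with half-edges `Fin (∑ i, μ i)` given by its structure maps. -/
def IsDessin.toDessin {σ α : Equiv.Perm (Fin (∑ i, μ i))} {v : Fin (∑ i, μ i) → Fin n}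
    (h : IsDessin g n μ σ α v) : Dessin g n μ where
  σ := σ
  α := α
  vertex := v
  α_mul_self := h.α_mul_self
  α_ne := h.α_ne
  vertex_eq_iff := h.vertex_eq_iff
  degree := h.degree
  connected := isPretransitive_of_isConn h.vertex_eq_iff h.connected
  euler := h.euler

lemma dessin_ext {γ γ' : Dessin g n μ} (h1 : γ.σ = γ'.σ) (h2 : γ.α = γ'.α)
    (h3 : γ.vertex = γ'.vertex) : γ = γ' := by
  cases γ
  cases γ'
  simp only at h1 h2 h3
  subst h1 h2 h3
  rfl

instance : Finite (Dessin g n μ) :=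
  Finite.of_injective (fun γ : Dessin g n μ => (γ.σ, γ.α, γ.vertex)) fun γ γ' h => by
    simp only [Prod.mk.injEq] at h
    exact dessin_ext h.1 h.2.1 h.2.2

/-- The relabelling of the half-edges of a dessin by a permutation. -/
def relabelDessin (hμ : ∀ i, 0 < μ i) (τ : Equiv.Perm (Fin (∑ i, μ i))) (γ : Dessin g n μ) :
    Dessin g n μ :=
  ((isDessin_of_dessin hμ γ).transport τ).toDessin

lemma isIso_iff (hμ : ∀ i, 0 < μ i) (γ γ' : Dessin g n μ) (τ : Equiv.Perm (Fin (∑ i, μ i))) :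
    Dessin.IsIso γ γ' τ ↔ relabelDessin hμ τ γ = γ' := by
  constructor
  · rintro ⟨h1, h2, h3⟩
    refine dessin_ext ?_ ?_ ?_
    · ext1 x
      have : τ (γ.σ (τ.symm x)) = γ'.σ (τ (τ.symm x)) := congrArg (fun π => π (τ.symm x)) h1
      rwa [Equiv.apply_symm_apply] at this
    · ext1 x
      have : τ (γ.α (τ.symm x)) = γ'.α (τ (τ.symm x)) := congrArg (fun π => π (τ.symm x)) h2
      rwa [Equiv.apply_symm_apply] at this
    · ext1 x
      have := h3 (τ.symm x)
      rw [Equiv.apply_symm_apply] at this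
      exact this.symm
  · rintro rfl
    refine ⟨?_, ?_, fun h => ?_⟩
    · ext1 x
      change τ (γ.σ x) = τ (γ.σ (τ.symm (τ x)))
      rw [Equiv.symm_apply_apply]
    · ext1 x
      change τ (γ.α x) = τ (γ.α (τ.symm (τ x)))
      rw [Equiv.symm_apply_apply]
    · change γ.vertex (τ.symm (τ h)) = _
      rw [Equiv.symm_apply_apply]

/-- Orbit-stabilizer for the relabelling action. -/
lemma card_class_mul_autCard (hμ : ∀ i, 0 < μ i) (γ : Dessin g n μ) :
    Nat.card {γ' // (Dessin.isoSetoid g n μ).r γ γ'} * Dessin.autCard γ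
      = (∑ i, μ i).factorial := by
  have hcomp : ∀ (τ τ' : Equiv.Perm (Fin (∑ i, μ i))) (γ : Dessin g n μ),
      relabelDessin hμ (τ * τ') γ = relabelDessin hμ τ (relabelDessin hμ τ' γ) :=
    fun _ _ _ => dessin_ext rfl rfl rfl
  let act : MulAction (Equiv.Perm (Fin (∑ i, μ i))) (Dessin g n μ) :=
    { smul := relabelDessin hμ
      one_smul := fun γ => dessin_ext rfl rfl rfl
      mul_smul := hcomp }
  have := Fintype.ofFinite (MulAction.orbit (Equiv.Perm (Fin (∑ i, μ i))) γ)
  have := Fintype.ofFinite (MulAction.stabilizer (Equiv.Perm (Fin (∑ i, μ i))) γ)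
  have h := MulAction.card_orbit_mul_card_stabilizer_eq_card_group
    (Equiv.Perm (Fin (∑ i, μ i))) γ
  rw [← Nat.card_eq_fintype_card, ← Nat.card_eq_fintype_card, ← Nat.card_eq_fintype_card,
    Nat.card_perm, Nat.card_eq_fintype_card (α := Fin _), Fintype.card_fin] at h
  rw [← h]
  congr 1
  · refine Nat.card_congr (Equiv.subtypeEquivRight fun γ' => ?_)
    exact exists_congr fun τ => isIso_iff hμ γ γ' τ
  · exact Nat.card_congr (Equiv.subtypeEquivRight fun τ => isIso_iff hμ γ γ τ)

lemma dessinCount_eq_card_div (hμ : ∀ i, 0 < μ i) :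
    dessinCount g n μ = (Nat.card (Dessin g n μ) : ℚ) / ((∑ i, μ i).factorial : ℚ) := by
  classical
  have := Fintype.ofFinite (Dessin g n μ)
  have := Fintype.ofFinite (Quotient (Dessin.isoSetoid g n μ))
  rw [dessinCount, finsum_eq_sum_of_fintype]
  have key : ∀ c : Quotient (Dessin.isoSetoid g n μ), (1 : ℚ) / Dessin.autCard c.out
      = (Nat.card {γ : Dessin g n μ // Quotient.mk _ γ = c} : ℚ)
        / ((∑ i, μ i).factorial : ℚ) := by
    intro c
    have h := card_class_mul_autCard hμ c.out
    have h' : Nat.card {γ : Dessin g n μ // Quotient.mk _ γ = c}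
        = Nat.card {γ' // (Dessin.isoSetoid g n μ).r c.out γ'} := by
      refine Nat.card_congr (Equiv.subtypeEquivRight fun γ => ?_)
      conv_lhs => rw [← c.out_eq]
      rw [eq_comm]
      exact Quotient.eq
    rw [h', ← h]
    have hpos := Nat.factorial_pos (∑ i, μ i)
    rw [← h] at hpos
    have h1 : (Dessin.autCard c.out : ℚ) ≠ 0 := by
      exact_mod_cast (Nat.pos_of_mul_pos_left hpos).ne'
    have h2 : (Nat.card {γ' // (Dessin.isoSetoid g n μ).r c.out γ'} : ℚ) ≠ 0 := by
      exact_mod_cast (Nat.pos_of_mul_pos_right hpos).ne'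
    push_cast
    field_simp
  rw [Finset.sum_congr rfl fun c _ => key c, ← Finset.sum_div, ← Nat.cast_sum]
  congr 2
  simp only [Nat.card_eq_fintype_card]
  rw [← Fintype.card_sigma]
  exact Fintype.card_congr (Equiv.sigmaFiberEquiv _)

lemma val_finRotate {k : ℕ} (i : Fin k) : (finRotate k i : ℕ) = (i + 1) % k := by
  rcases k with _ | k
  · exact i.elim0
  · rw [finRotate_apply, Fin.val_add, Fin.val_one', Nat.add_mod_mod]

lemma rotation_pow_zero (v : Fin n) (k : ℕ) (hk : k < μ v) :
    ((rotation μ) ^ k) ⟨v, ⟨0, by omega⟩⟩ = ⟨v, ⟨k, hk⟩⟩ := by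
  induction k with
  | zero => rfl
  | succ k ih =>
    rw [pow_succ', Equiv.Perm.mul_apply, ih (by omega)]
    change (⟨v, finRotate (μ v) ⟨k, _⟩⟩ : Σ v, Fin (μ v)) = _
    congr 1
    ext
    rw [val_finRotate, Nat.mod_eq_of_lt hk]

lemma sameCycle_rotation_iff (h h' : Σ v, Fin (μ v)) :
    h.1 = h'.1 ↔ (rotation μ).SameCycle h h' := by
  constructor
  · obtain ⟨v, k⟩ := h
    obtain ⟨v', k'⟩ := h'
    rintro rfl
    have h0 : 0 < μ v := k.pos
    have h1 : (rotation μ).SameCycle ⟨v, ⟨0, h0⟩⟩ ⟨v, k⟩ :=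
      ⟨(k : ℕ), by rw [zpow_natCast, rotation_pow_zero v k k.2]⟩
    have h2 : (rotation μ).SameCycle ⟨v, ⟨0, h0⟩⟩ ⟨v, k'⟩ :=
      ⟨(k' : ℕ), by rw [zpow_natCast, rotation_pow_zero v k' k'.2]⟩
    exact h1.symm.trans h2
  · have hfst : ∀ x, (rotation μ x).1 = x.1 := fun x => rfl
    rintro ⟨k, rfl⟩
    induction k using Int.induction_on with
    | zero => rfl
    | succ k ih => rw [add_comm, zpow_add, zpow_one, Equiv.Perm.mul_apply, hfst, ← ih]
    | pred k ih =>
      rw [ih, ← hfst (((rotation μ) ^ (-(k : ℤ) - 1)) h), ← Equiv.Perm.mul_apply,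
        ← zpow_one_add]
      congr 3
      ring

/-- The parametrizations of the half-edges of a dessin by `Σ i, Fin (μ i)` which are compatible
with the rotations and the vertices. -/
abbrev Parametrization (γ : Dessin g n μ) : Type :=
  {e : (Σ v, Fin (μ v)) ≃ Fin (∑ i, μ i) //
    (∀ h, e (rotation μ h) = γ.σ (e h)) ∧ ∀ h, γ.vertex (e h) = h.1}

lemma minimalPeriod_eq_degree (γ : Dessin g n μ) (x : Fin (∑ i, μ i)) :
    Function.minimalPeriod γ.σ x = μ (γ.vertex x) := by
  classical
  have h := MulAction.minimalPeriod_eq_card γ.σ x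
  rw [← γ.degree, ← Nat.card_eq_fintype_card] at *
  refine h.trans (Nat.card_congr (Equiv.subtypeEquivRight fun y => ?_))
  rw [eq_comm, γ.vertex_eq_iff, MulAction.mem_orbit_iff]
  constructor
  · rintro ⟨⟨_, k, rfl⟩, hk⟩
    exact ⟨k, hk⟩
  · rintro ⟨k, hk⟩
    exact ⟨⟨_, k, rfl⟩, hk⟩

/-- A parametrization is determined by the half-edges at which it starts. -/
lemma card_parametrization (hμ : ∀ i, 0 < μ i) (γ : Dessin g n μ) :
    Nat.card (Parametrization γ) = ∏ i, μ i := by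
  rw [← Finset.prod_congr rfl fun i _ => γ.degree i, ← Nat.card_pi]
  refine Nat.card_congr (Equiv.ofBijective
    (fun e i => (⟨e.1 ⟨i, ⟨0, hμ i⟩⟩, e.2.2 _⟩ : {h // γ.vertex h = i})) ⟨?_, ?_⟩)
  · intro e e' h
    refine Subtype.ext (Equiv.ext ?_)
    rintro ⟨i, k, hk⟩
    have hpow : ∀ (e : Parametrization γ) (k : ℕ) (x : Σ v, Fin (μ v)),
        e.1 ((rotation μ ^ k) x) = (γ.σ ^ k) (e.1 x) := by
      intro e k x
      induction k with
      | zero => rfl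
      | succ k ih =>
        rw [pow_succ', pow_succ', Equiv.Perm.mul_apply, Equiv.Perm.mul_apply, e.2.1, ih]
    have hi : e.1 ⟨i, ⟨0, hμ i⟩⟩ = e'.1 ⟨i, ⟨0, hμ i⟩⟩ := congrArg Subtype.val (congrFun h i)
    rw [← rotation_pow_zero i k hk, hpow, hpow, hi]
  · intro b
    have hper : ∀ i, Function.minimalPeriod γ.σ (b i).1 = μ i := fun i => by
      rw [minimalPeriod_eq_degree, (b i).2]
    have hvert : ∀ (k : ℕ) x, γ.vertex (γ.σ^[k] x) = γ.vertex x := by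
      intro k x
      rw [eq_comm, γ.vertex_eq_iff]
      exact ⟨k, by rw [zpow_natCast, Equiv.Perm.iterate_eq_pow]⟩
    have hinj : Function.Injective (fun h : Σ v, Fin (μ v) => γ.σ^[(h.2 : ℕ)] (b h.1).1) := by
      rintro ⟨i, k⟩ ⟨j, l⟩ h
      simp only at h
      have hij : i = j := by
        have := congrArg γ.vertex h
        rwa [hvert, hvert, (b i).2, (b j).2] at this
      subst hij
      have := Function.iterate_injOn_Iio_minimalPeriod (f := γ.σ) (x := (b i).1)
        (by rw [hper, Set.mem_Iio]; exact k.2) (by rw [hper, Set.mem_Iio]; exact l.2) h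
      rw [Fin.ext this]
    have hbij := (Fintype.bijective_iff_injective_and_card _).2 ⟨hinj, by simp⟩
    refine ⟨⟨Equiv.ofBijective _ hbij, ?_, ?_⟩, ?_⟩
    · rintro ⟨i, k⟩
      change γ.σ^[(finRotate (μ i) k : ℕ)] (b i).1 = γ.σ (γ.σ^[(k : ℕ)] (b i).1)
      rw [val_finRotate, ← Function.iterate_succ_apply' γ.σ,
        ← Function.iterate_mod_minimalPeriod_eq (n := (k : ℕ).succ), hper]
    · rintro ⟨i, k⟩
      change γ.vertex (γ.σ^[(k : ℕ)] (b i).1) = i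
      rw [hvert, (b i).2]
    · ext i
      rfl

/-- The gluings which are counted by `gluingCount` are the dessins on `Σ i, Fin (μ i)` with the
standard rotation. -/
lemma gluingCount_eq_card (hμ : ∀ i, 0 < μ i) :
    gluingCount g n μ = Nat.card {α : Equiv.Perm (Σ v, Fin (μ v)) //
      IsDessin g n μ (rotation μ) α Sigma.fst} := by
  classical
  rw [gluingCount, Nat.card_eq_fintype_card, Fintype.card_subtype]
  congr 1
  ext α
  have hF : numFaces μ α = numCycles (rotation μ * α) := by
    rw [numFaces, Finset.filter_eq_empty_iff.2 fun i _ => (hμ i).ne']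
    rfl
  rw [Finset.mem_filter, Finset.mem_filter, mem_connMatchings, mem_matchings, hF]
  constructor
  · rintro ⟨⟨⟨h1, h2⟩, h3⟩, h4⟩
    refine ⟨Finset.mem_univ _, h1, fun h => (h2 h).2 (Finset.mem_univ _),
      sameCycle_rotation_iff, fun i => ?_, h3, h4⟩
    rw [Nat.card_congr (Equiv.sigmaSubtype i), Nat.card_eq_fintype_card, Fintype.card_fin]
  · rintro ⟨-, h⟩
    exact ⟨⟨⟨h.α_mul_self, fun x => ⟨fun _ => Finset.mem_univ _, fun _ => h.α_ne x⟩⟩, h.connected⟩,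
      h.euler⟩

/-- The weighted count of dessins in terms of the count of gluings. -/
theorem dessinCount_mul_prod (hμ : ∀ i, 0 < μ i) :
    dessinCount g n μ * ∏ i, (μ i : ℚ) = gluingCount g n μ := by
  have hcard : Nat.card (Dessin g n μ) * ∏ i, μ i
      = (∑ i, μ i).factorial * gluingCount g n μ := by
    have h1 : Nat.card (Σ γ : Dessin g n μ, Parametrization γ)
        = Nat.card (Dessin g n μ) * ∏ i, μ i := by
      have := Fintype.ofFinite (Dessin g n μ)
      rw [Nat.card_sigma, Finset.sum_congr rfl fun γ _ => card_parametrization hμ γ]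
      simp
    have h2 : Nat.card (((Σ v, Fin (μ v)) ≃ Fin (∑ i, μ i)) ×
        {α : Equiv.Perm (Σ v, Fin (μ v)) // IsDessin g n μ (rotation μ) α Sigma.fst})
        = (∑ i, μ i).factorial * gluingCount g n μ := by
      rw [Nat.card_prod, ← gluingCount_eq_card hμ, Nat.card_eq_fintype_card,
        Fintype.card_equiv finSigmaFinEquiv]
      simp
    rw [← h1, ← h2]
    refine Nat.card_congr
      { toFun := fun p => (p.2.1, ⟨p.2.1.symm.permCongr p.1.α, ?_⟩)
        invFun := fun p => ⟨(p.2.2.transport p.1).toDessin, p.1, fun h => ?_, fun h => ?_⟩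
        left_inv := ?_
        right_inv := ?_ }
    · have h := (isDessin_of_dessin hμ p.1).transport p.2.1.symm
      have hr : p.2.1.symm.permCongr p.1.σ = rotation μ := by
        ext1 x
        rw [Equiv.permCongr_apply, Equiv.symm_symm, ← p.2.2.1, Equiv.symm_apply_apply]
      have hv : p.1.vertex ∘ p.2.1.symm.symm = Sigma.fst := funext p.2.2.2
      rwa [hr, hv] at h
    · change p.1 _ = p.1 (rotation μ (p.1.symm (p.1 h)))
      rw [Equiv.symm_apply_apply]
    · change (p.1.symm (p.1 h)).1 = _
      rw [Equiv.symm_apply_apply]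
    · rintro ⟨γ, e, he1, he2⟩
      have hγ : ∀ γ' : Dessin g n μ, ∀ hp, γ' = γ → (⟨γ', ⟨e, hp⟩⟩ : Σ γ : Dessin g n μ,
          Parametrization γ) = ⟨γ, ⟨e, he1, he2⟩⟩ := by
        rintro _ _ rfl
        rfl
      refine hγ _ _ (dessin_ext ?_ ?_ ?_)
      · ext1 x
        change e (rotation μ (e.symm x)) = _
        rw [he1, Equiv.apply_symm_apply]
      · ext1 x
        change e (e.symm (γ.α (e (e.symm x)))) = _
        rw [Equiv.apply_symm_apply, Equiv.apply_symm_apply]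
      · ext1 x
        change (e.symm x).1 = _
        rw [← he2, Equiv.apply_symm_apply]
    · rintro ⟨e, α, hα⟩
      refine Prod.ext rfl (Subtype.ext ?_)
      ext1 x
      change e.symm (e (α (e.symm (e x)))) = _
      rw [Equiv.symm_apply_apply, Equiv.symm_apply_apply]
  rw [dessinCount_eq_card_div hμ, div_mul_eq_mul_div, div_eq_iff (by positivity)]
  have := congrArg (Nat.cast (R := ℚ)) hcard
  push_cast at this
  rw [this, mul_comm]

end Count

/-! ### Restriction of tuples to sets of indices -/

section Restr

variable {α β : Type*} {m : ℕ}

lemma apply_cons_restr_empty (F : (n : ℕ) → (Fin n → α) → β) (a : α) (f : Fin m → α) :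
    F ((∅ : Finset (Fin m)).card + 1) (Fin.cons a (restr ∅ f)) = F 1 ![a] := by
  change F 1 (Fin.cons a (restr ∅ f)) = F 1 ![a]
  congr 1
  ext i
  rw [Subsingleton.elim (α := Fin 1) i 0]
  rfl

lemma apply_cons_restr_singleton (F : (n : ℕ) → (Fin n → α) → β) (a : α) (f : Fin m → α)
    (j : Fin m) :
    F (({j} : Finset (Fin m)).card + 1) (Fin.cons a (restr {j} f)) = F 2 ![a, f j] := by
  change F 2 (Fin.cons a (restr {j} f)) = F 2 ![a, f j]
  congr 1
  ext i
  refine Fin.cases rfl (fun i => ?_) i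
  rw [Subsingleton.elim (α := Fin 1) i 0]
  have := ({j} : Finset (Fin m)).orderEmbOfFin_mem rfl (0 : Fin 1)
  rw [Finset.mem_singleton] at this
  exact congrArg f this

lemma apply_cons_restr_univ (F : (n : ℕ) → (Fin n → α) → β) (a : α) (f : Fin m → α) :
    F ((Finset.univ : Finset (Fin m)).card + 1) (Fin.cons a (restr Finset.univ f))
      = F (m + 1) (Fin.cons a f) := by
  have key : ∀ (k : ℕ) (_ : k = m) (φ : Fin k ↪o Fin m),
      F (k + 1) (Fin.cons a fun i => f (φ i)) = F (m + 1) (Fin.cons a f) := by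
    rintro k rfl φ
    have hsurj : Function.Surjective φ := Finite.surjective_of_injective φ.injective
    have : (φ : Fin k → Fin k) = id := by
      refine (φ.strictMono.range_inj strictMono_id).1 ?_
      rw [hsurj.range_eq, Set.range_id]
    rw [this]
    rfl
  exact key _ (by simp) _

lemma restr_comp {γ : Type*} (I : Finset (Fin m)) (f : Fin m → α) (h : α → γ) :
    (fun k => h (restr I f k)) = restr I fun i => h (f i) := rfl

lemma sum_antidiagonal_ite_empty {M : Type*} [AddCommMonoid M] (g : ℕ) (x : M) :
    (∑ h ∈ Finset.HasAntidiagonal.antidiagonal g, ∑ I : Finset (Fin m),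
      if h.1 = 0 ∧ I = ∅ then x else 0) = x := by
  rw [Finset.sum_eq_single (0, g), Finset.sum_eq_single ∅]
  · simp
  · intro I _ hI
    simp [hI]
  · simp
  · rintro ⟨a, b⟩ hab h
    rw [Finset.HasAntidiagonal.mem_antidiagonal] at hab
    refine Finset.sum_eq_zero fun I _ => if_neg ?_
    rintro ⟨h1, -⟩
    simp only at hab h1
    subst h1
    exact h (by rw [← hab, zero_add])
  · simp

lemma sum_antidiagonal_ite_compl_empty {M : Type*} [AddCommMonoid M] (g : ℕ) (x : M) :
    (∑ h ∈ Finset.HasAntidiagonal.antidiagonal g, ∑ I : Finset (Fin m),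
      if h.2 = 0 ∧ Iᶜ = ∅ then x else 0) = x := by
  rw [Finset.sum_eq_single (g, 0), Finset.sum_eq_single Finset.univ]
  · simp
  · intro I _ hI
    simp [hI]
  · simp
  · rintro ⟨a, b⟩ hab h
    rw [Finset.HasAntidiagonal.mem_antidiagonal] at hab
    refine Finset.sum_eq_zero fun I _ => if_neg ?_
    rintro ⟨h1, -⟩
    simp only at hab h1
    subst h1
    exact h (by rw [← hab, add_zero])
  · simp

end Restr

/-! ### Exponential bounds for the number of gluings of fixed genus -/

section Growth

lemma gluingCount_zero_one_zero : gluingCount 0 1 ![0] = 1 := gluingCount_single_zero 0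

lemma gluingCount_zero_one_succ (a : ℕ) :
    gluingCount 0 1 ![a + 1]
      = ∑ p ∈ Finset.range a, gluingCount 0 1 ![p] * gluingCount 0 1 ![a - 1 - p] := by
  have h := gluingCount_cons_succ 0 a (![] : Fin 0 → ℕ)
  change gluingCount 0 1 ![a + 1] = _ at h
  rw [h, Finset.univ_eq_empty (α := Fin 0), Finset.sum_empty, add_zero]
  refine Finset.sum_congr rfl fun p _ => ?_
  rw [if_pos rfl, zero_add, Finset.Nat.antidiagonal_zero, Finset.sum_singleton,
    Fintype.sum_eq_single ∅ fun I hI => absurd (Finset.eq_empty_of_isEmpty I) hI]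
  rw [show (∅ᶜ : Finset (Fin 0)) = ∅ from rfl, apply_cons_restr_empty (gluingCount 0),
    apply_cons_restr_empty (gluingCount 0)]

/-- The number of gluings of one vertex in genus `0` is at most a Catalan number. -/
lemma gluingCount_zero_one_le (k : ℕ) : gluingCount 0 1 ![k] ≤ 4 ^ k := by
  have hmono : ∀ n, catalan n ≤ catalan (n + 1) := fun n => by
    rw [catalan_succ']
    refine le_trans (b := catalan 0 * catalan n) (by simp) (Finset.single_le_sum (f := fun ij : ℕ × ℕ =>
      catalan ij.1 * catalan ij.2) (a := (0, n)) (fun _ _ => Nat.zero_le _)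
      (Finset.HasAntidiagonal.mem_antidiagonal.2 (zero_add n)))
  have hcat : ∀ k, gluingCount 0 1 ![k] ≤ catalan k := by
    intro k
    induction k using Nat.strong_induction_on with
    | _ k ih =>
      rcases k with _ | _ | k
      · rw [gluingCount_zero_one_zero, catalan_zero]
      · rw [gluingCount_zero_one_succ]
        simp
      · refine le_trans ?_ (hmono (k + 1))
        rw [gluingCount_zero_one_succ, catalan_succ',
          Finset.Nat.sum_antidiagonal_eq_sum_range_succ (fun i j => catalan i * catalan j)]
        refine Finset.sum_le_sum fun p hp => ?_
        rw [Finset.mem_range] at hp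
        exact Nat.mul_le_mul (ih p (by omega)) (ih _ (by omega))
  refine (hcat k).trans ?_
  rw [catalan_eq_centralBinom_div]
  refine (Nat.div_le_self _ _).trans ?_
  rcases Nat.eq_zero_or_pos k with rfl | hk
  · simp
  · have := Nat.four_pow_le_two_mul_self_mul_centralBinom k hk
    rw [Nat.centralBinom_eq_two_mul_choose]
    calc (2 * k).choose k ≤ 2 ^ (2 * k) := Nat.choose_le_two_pow _ _
      _ = 4 ^ k := by rw [pow_mul]; norm_num

lemma gluingCount_cons_zero {g m : ℕ} (h : (g, m) ≠ (0, 0)) (μ : Fin m → ℕ) :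
    gluingCount g (m + 1) (Fin.cons 0 μ) = 0 := by
  rcases Nat.eq_zero_or_pos m with rfl | hm
  · rw [Subsingleton.elim μ Fin.elim0, gluingCount_single_zero, if_neg]
    rintro rfl
    exact h rfl
  · exact gluingCount_eq_zero_of_isolated g (by omega) _ 0 rfl

/-- One step of the induction for `exists_gluingCount_le`: an exponential bound for all types of
smaller complexity `2 g + m + 1` gives one for the type `(g, m + 1)`. -/
lemma gluingCount_le_step {L g m : ℕ} {K ρ : ℝ} (hK : 1 ≤ K) (hρ : 16 ≤ ρ)
    (hL : 2 * g + m + 1 ≤ L + 1) (hgm : (g, m) ≠ (0, 0))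
    (ih : ∀ g m, 2 * g + m + 1 ≤ L → ∀ μ : Fin (m + 1) → ℕ,
      (gluingCount g (m + 1) μ : ℝ) ≤ K * ρ ^ (∑ i, μ i))
    {M : ℝ} (hM : (1 + (g + 1) * 2 ^ m) * K ^ 2 ≤ M) (a : ℕ) (μ : Fin m → ℕ) :
    (gluingCount g (m + 1) (Fin.cons a μ) : ℝ) ≤ 2 * M * (2 * ρ) ^ (a + ∑ i, μ i) := by
  have hM0 : 0 ≤ M := le_trans (by positivity) hM
  induction a using Nat.strong_induction_on with
  | _ a iha =>
  rcases a with _ | a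
  · rw [gluingCount_cons_zero hgm]
    push_cast
    positivity
  set s := ∑ i, μ i with hs
  rw [gluingCount_cons_succ]
  push_cast
  have hρ1 : 1 ≤ ρ := by linarith
  -- the terms of smaller complexity
  have hterm : ∀ p ∈ Finset.range a,
      ((if g = 0 then 0 else
          gluingCount (g - 1) (m + 2) (Fin.cons p (Fin.cons (a - 1 - p) μ)) : ℕ) : ℝ)
        + ∑ h ∈ Finset.HasAntidiagonal.antidiagonal g, ∑ I : Finset (Fin m),
            (gluingCount h.1 (I.card + 1) (Fin.cons p (restr I μ)) : ℝ)
            * (gluingCount h.2 (Iᶜ.card + 1) (Fin.cons (a - 1 - p) (restr Iᶜ μ)) : ℝ)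
      ≤ M * ρ ^ (a + s) + 2 * M * (2 * ρ) ^ (a + s) * (1 / 8) ^ (p + 1)
        + 2 * M * (2 * ρ) ^ (a + s) * (1 / 8) ^ (a - 1 - p + 1) := by
    intro p hp
    rw [Finset.mem_range] at hp
    have hpa : p + (a - 1 - p) + 1 = a := by omega
    have h1 : ((if g = 0 then 0 else
          gluingCount (g - 1) (m + 2) (Fin.cons p (Fin.cons (a - 1 - p) μ)) : ℕ) : ℝ)
        ≤ K ^ 2 * ρ ^ (a + s) := by
      split_ifs with hg
      · push_cast; positivity
      · refine (ih (g - 1) (m + 1) (by omega) _).trans ?_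
        rw [Fin.sum_cons, Fin.sum_cons, ← hs]
        have : K ≤ K ^ 2 := by nlinarith
        exact mul_le_mul this (pow_le_pow_right₀ hρ1 (by omega)) (by positivity) (by positivity)
    have hself : ∀ p q, p + q + 1 = a →
        (gluingCount 0 1 ![p] : ℝ) * gluingCount g (m + 1) (Fin.cons q μ)
          ≤ 2 * M * (2 * ρ) ^ (a + s) * (1 / 8) ^ (p + 1) := by
      intro p q hpq
      have h4 : (gluingCount 0 1 ![p] : ℝ) ≤ 4 ^ p := by exact_mod_cast gluingCount_zero_one_le p
      calc (gluingCount 0 1 ![p] : ℝ) * gluingCount g (m + 1) (Fin.cons q μ)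
          ≤ 4 ^ p * (2 * M * (2 * ρ) ^ (q + s)) :=
            mul_le_mul h4 (iha q (by omega)) (by positivity) (by positivity)
        _ = 2 * M * (2 * ρ) ^ (q + s) * 4 ^ p := by ring
        _ ≤ 2 * M * (2 * ρ) ^ (q + s) * ((2 * ρ) ^ (p + 1) * (1 / 8) ^ (p + 1)) := by
            gcongr
            rw [← mul_pow]
            calc (4 : ℝ) ^ p ≤ 4 ^ (p + 1) := pow_le_pow_right₀ (by norm_num) (by omega)
              _ ≤ _ := by gcongr; linarith
        _ = 2 * M * (2 * ρ) ^ (a + s) * (1 / 8) ^ (p + 1) := by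
            rw [← hpq]; ring
    have h2 : ∀ h ∈ Finset.HasAntidiagonal.antidiagonal g, ∀ I : Finset (Fin m),
        (gluingCount h.1 (I.card + 1) (Fin.cons p (restr I μ)) : ℝ)
            * (gluingCount h.2 (Iᶜ.card + 1) (Fin.cons (a - 1 - p) (restr Iᶜ μ)) : ℝ)
        ≤ K ^ 2 * ρ ^ (a + s)
          + (if h.1 = 0 ∧ I = ∅ then 2 * M * (2 * ρ) ^ (a + s) * (1 / 8) ^ (p + 1) else 0)
          + (if h.2 = 0 ∧ Iᶜ = ∅ then
              2 * M * (2 * ρ) ^ (a + s) * (1 / 8) ^ (a - 1 - p + 1) else 0) := by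
      rintro ⟨g₁, g₂⟩ hg I
      rw [Finset.HasAntidiagonal.mem_antidiagonal] at hg
      simp only at hg ⊢
      have hpos1 : (0 : ℝ) ≤ K ^ 2 * ρ ^ (a + s) := by positivity
      have hnn : ∀ (c : Prop) [Decidable c] (k : ℕ),
          (0 : ℝ) ≤ if c then 2 * M * (2 * ρ) ^ (a + s) * (1 / 8) ^ k else 0 := by
        intro c _ k
        split_ifs
        · positivity
        · exact le_rfl
      by_cases hI : g₁ = 0 ∧ I = ∅
      · obtain ⟨rfl, rfl⟩ := hI
        rw [zero_add] at hg
        subst hg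
        rw [if_pos ⟨rfl, rfl⟩, Finset.compl_empty, apply_cons_restr_empty (gluingCount 0),
          apply_cons_restr_univ (gluingCount g₂)]
        have := hself p (a - 1 - p) hpa
        have := hnn (g₂ = 0 ∧ Finset.univ = (∅ : Finset (Fin m))) (a - 1 - p + 1)
        linarith
      by_cases hJ : g₂ = 0 ∧ Iᶜ = ∅
      · obtain ⟨rfl, hJ⟩ := hJ
        rw [add_zero] at hg
        subst hg
        obtain rfl : I = Finset.univ := by rwa [Finset.compl_eq_empty_iff] at hJ
        rw [if_pos (show 0 = 0 ∧ Finset.univᶜ = (∅ : Finset (Fin m)) from ⟨rfl, hJ⟩),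
          Finset.compl_univ, apply_cons_restr_empty (gluingCount 0),
          apply_cons_restr_univ (gluingCount g₁), mul_comm]
        have := hself (a - 1 - p) p (by omega)
        have := hnn (g₁ = 0 ∧ Finset.univ = (∅ : Finset (Fin m))) (p + 1)
        linarith
      rw [if_neg hI, if_neg hJ, add_zero, add_zero]
      have hcard : I.card + Iᶜ.card = m := by
        rw [Finset.card_add_card_compl, Fintype.card_fin]
      have hI' : g₁ = 0 → I.card ≠ 0 := fun h h' => hI ⟨h, Finset.card_eq_zero.1 h'⟩
      have hJ' : g₂ = 0 → Iᶜ.card ≠ 0 := fun h h' => hJ ⟨h, Finset.card_eq_zero.1 h'⟩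
      refine (mul_le_mul (ih g₁ I.card (by omega) _) (ih g₂ Iᶜ.card (by omega) _) (by positivity)
        (by positivity)).trans ?_
      rw [Fin.sum_cons, Fin.sum_cons, sum_restr, sum_restr, mul_mul_mul_comm, ← pow_add, ← sq]
      have : p + ∑ i ∈ I, μ i + (a - 1 - p + ∑ i ∈ Iᶜ, μ i) ≤ a + s := by
        rw [hs, ← Finset.sum_add_sum_compl I μ]
        omega
      gcongr
    have h3 := Finset.sum_le_sum fun h hh => Finset.sum_le_sum fun I (_ : I ∈ Finset.univ) =>
      h2 h hh I
    simp only [Finset.sum_add_distrib] at h3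
    rw [sum_antidiagonal_ite_empty, sum_antidiagonal_ite_compl_empty] at h3
    simp only [Finset.sum_const, Finset.card_univ, Fintype.card_finset, Fintype.card_fin,
      Finset.Nat.card_antidiagonal, nsmul_eq_mul] at h3
    push_cast at h3
    have h4 : (1 + (g + 1) * 2 ^ m) * K ^ 2 * ρ ^ (a + s) ≤ M * ρ ^ (a + s) := by gcongr
    nlinarith [h1, h3, h4]
  have hj : ∀ j ∈ Finset.univ, (μ j : ℝ) * (gluingCount g (({j}ᶜ : Finset (Fin m)).card + 1)
      (Fin.cons (a + μ j - 1) (restr {j}ᶜ μ)) : ℝ) ≤ μ j * (M * ρ ^ (a + s)) := by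
    intro j _
    have hcard : ({j}ᶜ : Finset (Fin m)).card + 1 = m := by
      rw [Finset.card_compl, Fintype.card_fin, Finset.card_singleton]
      have := j.pos
      omega
    have hsum : μ j + ∑ i ∈ {j}ᶜ, μ i = s := by
      rw [hs, ← Finset.sum_add_sum_compl {j} μ, Finset.sum_singleton]
    gcongr
    refine (ih g _ (by omega) _).trans ?_
    rw [Fin.sum_cons, sum_restr]
    have h1 : K ≤ M := by
      have h0 : (0 : ℝ) ≤ (g + 1) * 2 ^ m := by positivity
      nlinarith
    exact mul_le_mul h1 (pow_le_pow_right₀ hρ1 (by omega)) (by positivity) hM0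
  have hgeom : ∀ b : ℕ, ∑ p ∈ Finset.range b, (1 / 8 : ℝ) ^ (p + 1) ≤ 1 / 7 := by
    intro b
    have : ∑ p ∈ Finset.range b, (1 / 8 : ℝ) ^ (p + 1) = 1 / 7 * (1 - (1 / 8) ^ b) := by
      induction b with
      | zero => simp
      | succ b ihb => rw [Finset.sum_range_succ, ihb]; ring
    rw [this]
    have : (0 : ℝ) ≤ (1 / 8) ^ b := by positivity
    linarith
  have hgeom' : ∑ p ∈ Finset.range a, (1 / 8 : ℝ) ^ (a - 1 - p + 1) ≤ 1 / 7 := by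
    rw [Finset.sum_range_reflect (fun p => (1 / 8 : ℝ) ^ (p + 1)) a]
    exact hgeom a
  have hsum1 := Finset.sum_le_sum hterm
  have hsum2 := Finset.sum_le_sum hj
  rw [← Finset.sum_mul] at hsum2
  simp only [Finset.sum_add_distrib, ← Finset.mul_sum, Finset.sum_const, Finset.card_range,
    nsmul_eq_mul] at hsum1
  have hs' : (∑ j, (μ j : ℝ)) = s := by rw [hs]; push_cast; rfl
  rw [hs'] at hsum2
  have hlin : ((a : ℝ) + s) * ρ ^ (a + s) ≤ (2 * ρ) ^ (a + s) := by
    rw [mul_pow]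
    gcongr
    exact_mod_cast (Nat.lt_two_pow_self (n := a + s)).le
  simp only [Finset.sum_add_distrib] at hsum1 ⊢
  have e1 : 2 * M * (2 * ρ) ^ (a + s) * ∑ p ∈ Finset.range a, (1 / 8 : ℝ) ^ (p + 1)
      ≤ 2 * M * (2 * ρ) ^ (a + s) * (1 / 7) := by gcongr; exact hgeom a
  have e2 : 2 * M * (2 * ρ) ^ (a + s) * ∑ p ∈ Finset.range a, (1 / 8 : ℝ) ^ (a - 1 - p + 1)
      ≤ 2 * M * (2 * ρ) ^ (a + s) * (1 / 7) := by gcongr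
  have e3 : M * (((a : ℝ) + s) * ρ ^ (a + s)) ≤ M * (2 * ρ) ^ (a + s) := by gcongr
  have e4 : 2 * M * (2 * ρ) ^ (a + 1 + s) = 2 * ρ * (2 * M * (2 * ρ) ^ (a + s)) := by ring
  have e5 : 4 * (M * (2 * ρ) ^ (a + s)) ≤ 2 * ρ * (2 * M * (2 * ρ) ^ (a + s)) := by
    have : (0 : ℝ) ≤ M * (2 * ρ) ^ (a + s) := by positivity
    nlinarith
  have e6 : (0 : ℝ) ≤ M * (2 * ρ) ^ (a + s) := by positivity
  rw [e4]
  simp only [Nat.cast_ite, Nat.cast_zero] at hsum1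
  nlinarith [hsum1, hsum2, e1, e2, e3, e5, e6]

/-- For bounded complexity `2 g + m + 1` the numbers of gluings grow at most exponentially. -/
theorem exists_gluingCount_le (L : ℕ) : ∃ K ρ : ℝ, 1 ≤ K ∧ 16 ≤ ρ ∧
    ∀ g m, 2 * g + m + 1 ≤ L → ∀ μ : Fin (m + 1) → ℕ,
      (gluingCount g (m + 1) μ : ℝ) ≤ K * ρ ^ (∑ i, μ i) := by
  induction L with
  | zero => exact ⟨1, 16, le_rfl, le_rfl, fun g m h => by omega⟩
  | succ L ihL =>
    obtain ⟨K, ρ, hK, hρ, ih⟩ := ihL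
    set M : ℝ := (1 + (L + 1) * 2 ^ L) * K ^ 2 with hM
    have hM1 : 1 ≤ M := by
      have : (0 : ℝ) ≤ (L + 1) * 2 ^ L := by positivity
      have : 1 ≤ K ^ 2 := by nlinarith
      rw [hM]
      nlinarith
    refine ⟨2 * M, 2 * ρ, by linarith, by linarith, fun g m h μ => ?_⟩
    rw [← Fin.cons_self_tail μ, Fin.sum_cons]
    by_cases hgm : (g, m) = (0, 0)
    · obtain ⟨rfl, rfl⟩ := Prod.mk.inj hgm
      have h1 : (Fin.cons (μ 0) (Fin.tail μ) : Fin 1 → ℕ) = ![μ 0] := by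
        ext i
        rw [Subsingleton.elim (α := Fin 1) i 0]
        rfl
      rw [h1, Finset.univ_eq_empty, Finset.sum_empty, add_zero]
      calc (gluingCount 0 1 ![μ 0] : ℝ) ≤ 4 ^ μ 0 := by
            exact_mod_cast gluingCount_zero_one_le _
        _ ≤ 1 * (2 * ρ) ^ μ 0 := by rw [one_mul]; gcongr; linarith
        _ ≤ 2 * M * (2 * ρ) ^ μ 0 := by gcongr; linarith
    · refine gluingCount_le_step hK hρ h hgm ih ?_ _ _
      rw [hM]
      have : (g : ℝ) ≤ L := by exact_mod_cast (by omega : g ≤ L)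
      gcongr
      · norm_num
      · omega

end Growth

/-! ### Generating functions of gluings -/

section Summation

/-- The monomial `y_1 ^ μ_1 ⋯ y_n ^ μ_n`. -/
def weight {n : ℕ} (y : Fin n → ℂ) (μ : Fin n → ℕ) : ℂ := ∏ i, y i ^ μ i

lemma weight_cons {n : ℕ} (a : ℂ) (y : Fin n → ℂ) (k : ℕ) (μ : Fin n → ℕ) :
    weight (Fin.cons a y) (Fin.cons k μ) = a ^ k * weight y μ := by
  simp [weight, Fin.prod_univ_succ]

lemma weight_eq_restr_mul {m : ℕ} (I : Finset (Fin m)) (y : Fin m → ℂ) (μ : Fin m → ℕ) :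
    weight y μ = weight (restr I y) (restr I μ) * weight (restr Iᶜ y) (restr Iᶜ μ) := by
  have h (J : Finset (Fin m)) : weight (restr J y) (restr J μ) = ∏ i ∈ J, y i ^ μ i :=
    prod_restr J fun i => y i ^ μ i
  rw [h, h, Finset.prod_mul_prod_compl]
  rfl

/-- Splitting the indices of a tuple into a set and its complement. -/
def restrEquiv {m : ℕ} (I : Finset (Fin m)) (α : Type*) :
    (Fin m → α) ≃ (Fin I.card → α) × (Fin Iᶜ.card → α) :=
  (Equiv.arrowCongr (finSumEquivOfFinset (s := I) rfl rfl).symm (Equiv.refl α)).trans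
    (Equiv.sumArrowEquivProdArrow _ _ _)

/-- Separating one entry of a tuple from the others. -/
def singleEquiv {m : ℕ} (j : Fin m) (α : Type*) :
    (Fin m → α) ≃ α × (Fin ({j}ᶜ : Finset (Fin m)).card → α) :=
  (restrEquiv {j} α).trans (Equiv.prodCongr (Equiv.funUnique (Fin 1) α) (Equiv.refl _))

lemma restr_singleton {m : ℕ} (j : Fin m) {α : Type*} (f : Fin m → α) (k : Fin 1) :
    restr {j} f k = f j := by
  have := ({j} : Finset (Fin m)).orderEmbOfFin_mem rfl k
  rw [Finset.mem_singleton] at this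
  exact congrArg f this

lemma singleEquiv_apply {m : ℕ} (j : Fin m) {α : Type*} (f : Fin m → α) :
    singleEquiv j α f = (f j, restr {j}ᶜ f) :=
  Prod.ext (restr_singleton j f 0) rfl

lemma weight_eq_single_mul {m : ℕ} (j : Fin m) (y : Fin m → ℂ) (μ : Fin m → ℕ) :
    weight y μ = y j ^ μ j * weight (restr {j}ᶜ y) (restr {j}ᶜ μ) := by
  rw [weight_eq_restr_mul {j}]
  congr 1
  change ∏ k : Fin 1, _ = _
  rw [Fin.prod_univ_one, restr_singleton, restr_singleton]

lemma hasSum_antidiagonal {X : Type*} {F : (ℕ × ℕ) × X → ℂ} {S : ℂ} (h : HasSum F S) :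
    HasSum (fun p : ℕ × X => ∑ q ∈ Finset.HasAntidiagonal.antidiagonal p.1, F (q, p.2)) S := by
  let i : (Σ p : ℕ × X, (Finset.HasAntidiagonal.antidiagonal p.1 : Finset (ℕ × ℕ))) →
      (ℕ × ℕ) × X := fun q => (q.2.1, q.1.2)
  have hi : Function.Bijective i := by
    constructor
    · rintro ⟨⟨n, x⟩, ⟨⟨a, b⟩, hq⟩⟩ ⟨⟨n', x'⟩, ⟨⟨a', b'⟩, hq'⟩⟩ he
      simp only [i, Prod.mk.injEq] at he
      obtain ⟨⟨rfl, rfl⟩, rfl⟩ := he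
      rw [Finset.HasAntidiagonal.mem_antidiagonal] at hq hq'
      simp only at hq hq'
      subst hq
      subst hq'
      rfl
    · rintro ⟨⟨a, b⟩, x⟩
      exact ⟨⟨(a + b, x), ⟨(a, b), Finset.HasAntidiagonal.mem_antidiagonal.2 rfl⟩⟩, rfl⟩
  have h2 := (Equiv.ofBijective i hi).hasSum_iff.2 h
  refine h2.sigma fun p => ?_
  have := hasSum_fintype fun q : (Finset.HasAntidiagonal.antidiagonal p.1 : Finset (ℕ × ℕ)) =>
    F (q.1, p.2)
  rwa [Finset.sum_coe_sort (Finset.HasAntidiagonal.antidiagonal p.1)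
    (fun q => F (q, p.2))] at this

/-- Terms which vanish in degree `0` may be summed over positive degrees. -/
lemma hasSum_succ_iff {X : Type*} {F : ℕ × X → ℂ} {S : ℂ} (h0 : ∀ x, F (0, x) = 0) :
    HasSum (fun p : ℕ × X => F (p.1 + 1, p.2)) S ↔ HasSum F S := by
  have hinj : Function.Injective fun p : ℕ × X => (p.1 + 1, p.2) := by
    rintro ⟨a, x⟩ ⟨b, y⟩ h
    simpa using h
  refine hinj.hasSum_iff (f := F) ?_
  rintro ⟨a, x⟩ hx
  rcases a with _ | a
  · exact h0 x
  · exact absurd ⟨(a, x), rfl⟩ hx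

lemma summable_prod_pow {n : ℕ} (r : Fin n → ℝ) (h0 : ∀ i, 0 ≤ r i) (h1 : ∀ i, r i < 1) :
    Summable fun μ : Fin n → ℕ => ∏ i, r i ^ μ i := by
  induction n with
  | zero => exact Summable.of_finite
  | succ n ih =>
    rw [← (Fin.consEquiv fun _ => ℕ).summable_iff]
    have := (summable_geometric_of_lt_one (h0 0) (h1 0)).mul_of_nonneg
      (ih (fun i => r i.succ) (fun i => h0 _) fun i => h1 _)
      (fun k => pow_nonneg (h0 0) k)
      (fun μ => Finset.prod_nonneg fun i _ => pow_nonneg (h0 _) _)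
    refine this.congr fun p => ?_
    simp [Fin.consEquiv, Fin.prod_univ_succ]

/-- A power series with exponentially bounded coefficients converges in a polydisc. -/
lemma summable_mul_weight {n : ℕ} {K ρ : ℝ} (hρ : 0 < ρ) {c : (Fin n → ℕ) → ℂ}
    (hc : ∀ μ, ‖c μ‖ ≤ K * ρ ^ (∑ i, μ i)) {y : Fin n → ℂ} (hy : ∀ i, ‖y i‖ < 1 / ρ) :
    Summable fun μ => c μ * weight y μ := by
  have h := (summable_prod_pow (fun i => ρ * ‖y i‖) (fun i => by positivity)
    fun i => by have := hy i; rwa [lt_div_iff₀' hρ] at this).mul_left K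
  refine Summable.of_norm_bounded h fun μ => ?_
  rw [norm_mul, weight, norm_prod]
  simp only [norm_pow, mul_pow, Finset.prod_mul_distrib]
  rw [Finset.prod_pow_eq_pow_sum, ← mul_assoc]
  exact mul_le_mul_of_nonneg_right (hc μ) (Finset.prod_nonneg fun i _ => by positivity)

end Summation

section GenFun

/-- The generating function of gluings of genus `g` with `n` labelled vertices. -/
noncomputable def genFun (g n : ℕ) (y : Fin n → ℂ) : ℂ :=
  ∑' μ : Fin n → ℕ, (gluingCount g n μ : ℂ) * weight y μ

/-- The generating function `y_1 ∂/∂y_1` of `genFun`. -/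
noncomputable def eulerGenFun (g n : ℕ) (y : Fin (n + 1) → ℂ) : ℂ :=
  ∑' μ : Fin (n + 1) → ℕ, (μ 0 : ℂ) * (gluingCount g (n + 1) μ : ℂ) * weight y μ

/-- An exponential bound for all numbers of gluings of complexity at most `L`. -/
def GrowthBound (L : ℕ) (K ρ : ℝ) : Prop :=
  1 ≤ K ∧ 16 ≤ ρ ∧ ∀ g m, 2 * g + m + 1 ≤ L → ∀ μ : Fin (m + 1) → ℕ,
    (gluingCount g (m + 1) μ : ℝ) ≤ K * ρ ^ (∑ i, μ i)

variable {L : ℕ} {K ρ : ℝ}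

lemma GrowthBound.pos (hB : GrowthBound L K ρ) : 0 < ρ := by linarith [hB.2.1]

lemma GrowthBound.norm_le (hB : GrowthBound L K ρ) {g m : ℕ} (hL : 2 * g + m + 1 ≤ L)
    (μ : Fin (m + 1) → ℕ) : ‖(gluingCount g (m + 1) μ : ℂ)‖ ≤ K * ρ ^ (∑ i, μ i) := by
  rw [Complex.norm_natCast]
  exact hB.2.2 g m hL μ

lemma GrowthBound.summable (hB : GrowthBound L K ρ) {g m : ℕ} (hL : 2 * g + m + 1 ≤ L)
    {y : Fin (m + 1) → ℂ} (hy : ∀ i, ‖y i‖ < 1 / ρ) :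
    Summable fun μ : Fin (m + 1) → ℕ => (gluingCount g (m + 1) μ : ℂ) * weight y μ :=
  summable_mul_weight hB.pos (hB.norm_le hL) hy

lemma lt_one_div_of_lt {ρ x : ℝ} (hρ : 0 < ρ) (h : x < 1 / (2 * ρ)) : x < 1 / ρ :=
  h.trans_le (one_div_le_one_div_of_le hρ (by linarith))

lemma natCast_mul_pow_le (hρ : 0 < ρ) {m : ℕ} (μ : Fin m → ℕ) (j : Fin m) :
    (μ j : ℝ) * ρ ^ (∑ i, μ i) ≤ (2 * ρ) ^ (∑ i, μ i) := by
  rw [mul_pow]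
  gcongr
  have h1 : μ j ≤ ∑ i, μ i := Finset.single_le_sum (fun _ _ => Nat.zero_le _) (Finset.mem_univ j)
  exact_mod_cast h1.trans Nat.lt_two_pow_self.le

lemma GrowthBound.summable_euler (hB : GrowthBound L K ρ) {g m : ℕ} (hL : 2 * g + m + 1 ≤ L)
    {y : Fin (m + 1) → ℂ} (hy : ∀ i, ‖y i‖ < 1 / (2 * ρ)) :
    Summable fun μ : Fin (m + 1) → ℕ =>
      (μ 0 : ℂ) * (gluingCount g (m + 1) μ : ℂ) * weight y μ := by
  have hK : 0 ≤ K := by linarith [hB.1]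
  refine summable_mul_weight (K := K) (by linarith [hB.pos]) (fun μ => ?_) hy
  rw [norm_mul, Complex.norm_natCast]
  calc (μ 0 : ℝ) * ‖(gluingCount g (m + 1) μ : ℂ)‖ ≤ μ 0 * (K * ρ ^ (∑ i, μ i)) := by
        gcongr; exact hB.norm_le hL μ
    _ = K * (μ 0 * ρ ^ (∑ i, μ i)) := by ring
    _ ≤ _ := by gcongr; exact natCast_mul_pow_le hB.pos μ 0

lemma hasSum_cons {m : ℕ} {c : (Fin (m + 1) → ℕ) → ℂ} {a : ℂ} {y : Fin m → ℂ} {S : ℂ}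
    (h : HasSum (fun μ => c μ * weight (Fin.cons a y) μ) S) :
    HasSum (fun p : ℕ × (Fin m → ℕ) => c (Fin.cons p.1 p.2) * (a ^ p.1 * weight y p.2)) S := by
  have := (Fin.consEquiv fun _ : Fin (m + 1) => ℕ).hasSum_iff.2 h
  refine this.congr_fun fun p => ?_
  rw [← weight_cons]
  rfl

lemma hasSum_range {X : Type*} {F : (ℕ × ℕ) × X → ℂ} {S : ℂ} (h : HasSum F S) :
    HasSum (fun p : ℕ × X => ∑ k ∈ Finset.range p.1, F ((k, p.1 - 1 - k), p.2)) S := by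
  rw [← hasSum_succ_iff (by simp)]
  refine (hasSum_antidiagonal h).congr_fun fun p => ?_
  rw [Finset.Nat.sum_antidiagonal_eq_sum_range_succ_mk]
  rfl

lemma hasSum_cons_cons {m : ℕ} {c : (Fin (m + 2) → ℕ) → ℂ} {a b : ℂ} {y : Fin m → ℂ} {S : ℂ}
    (h : HasSum (fun μ => c μ * weight (Fin.cons a (Fin.cons b y)) μ) S) :
    HasSum (fun p : (ℕ × ℕ) × (Fin m → ℕ) => c (Fin.cons p.1.1 (Fin.cons p.1.2 p.2))
      * (a ^ p.1.1 * b ^ p.1.2 * weight y p.2)) S := by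
  have := ((Equiv.prodAssoc ℕ ℕ (Fin m → ℕ)).trans (Equiv.prodCongr (Equiv.refl ℕ)
    (Fin.consEquiv fun _ : Fin (m + 1) => ℕ))).hasSum_iff.2 (hasSum_cons (c := c) h)
  refine this.congr_fun fun p => ?_
  rw [mul_assoc (a ^ _), ← weight_cons]
  simp only [Function.comp_apply, Equiv.trans_apply, Equiv.prodCongr_apply, Prod.map,
    Equiv.prodAssoc_apply, Equiv.refl_apply]
  rfl

lemma hasSum_mul_prod {X Y : Type*} {f : X → ℂ} {g : Y → ℂ} {S T : ℂ} (hf : HasSum f S)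
    (hg : HasSum g T) : HasSum (fun p : X × Y => f p.1 * g p.2) (S * T) :=
  hf.mul hg (summable_mul_of_summable_norm hf.summable.norm hg.summable.norm)

lemma hasSum_split {m : ℕ} (I : Finset (Fin m)) {c : (Fin (I.card + 1) → ℕ) → ℂ}
    {d : (Fin (Iᶜ.card + 1) → ℕ) → ℂ} {a b : ℂ} {y : Fin m → ℂ} {S T : ℂ}
    (hc : HasSum (fun μ => c μ * weight (Fin.cons a (restr I y)) μ) S)
    (hd : HasSum (fun μ => d μ * weight (Fin.cons b (restr Iᶜ y)) μ) T) :
    HasSum (fun p : (ℕ × ℕ) × (Fin m → ℕ) =>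
      c (Fin.cons p.1.1 (restr I p.2)) * d (Fin.cons p.1.2 (restr Iᶜ p.2))
      * (a ^ p.1.1 * b ^ p.1.2 * weight y p.2)) (S * T) := by
  replace hc := hasSum_cons (c := c) hc
  replace hd := hasSum_cons (c := d) hd
  have h := hasSum_mul_prod hc hd
  have := ((Equiv.prodCongr (Equiv.refl (ℕ × ℕ)) (restrEquiv I ℕ)).trans
    (Equiv.prodProdProdComm _ _ _ _)).hasSum_iff.2 h
  refine this.congr_fun fun p => ?_
  rw [weight_eq_restr_mul I]
  change _ = c (Fin.cons p.1.1 (restr I p.2)) * (a ^ p.1.1 * weight (restr I y) (restr I p.2))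
    * (d (Fin.cons p.1.2 (restr Iᶜ p.2)) * (b ^ p.1.2 * weight (restr Iᶜ y) (restr Iᶜ p.2)))
  ring

lemma sum_antidiagonal_natCast_mul (a b : ℂ) (k : ℕ) :
    (b - a) ^ 2 * ∑ q ∈ Finset.HasAntidiagonal.antidiagonal (k + 1), (q.2 : ℂ) * (a ^ q.1 * b ^ q.2)
      = b * ((k + 2) * b ^ (k + 1) * (b - a) - (b ^ (k + 2) - a ^ (k + 2))) := by
  induction k with
  | zero =>
    simp [Finset.Nat.sum_antidiagonal_succ]
    ring
  | succ k ih =>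
    rw [Finset.Nat.sum_antidiagonal_succ]
    have h (x : ℕ × ℕ) : (x.2 : ℂ) * (a ^ (x.1 + 1) * b ^ x.2)
        = a * (x.2 * (a ^ x.1 * b ^ x.2)) := by ring
    simp only [h]
    rw [← Finset.mul_sum, mul_add, mul_left_comm ((b - a) ^ 2) a, ih]
    push_cast
    ring

/-- The contribution of the edges joining the first vertex to the `j`-th one, in the loop equation
for generating functions; here `H` and `S` are values of the generating function and of its
derivative `y_1 ∂/∂y_1`. -/
noncomputable def edgeTerm (y₁ y S H H₁ : ℂ) : ℂ :=
  y₁ * y / (y - y₁) ^ 2 * (y * (y - y₁) * (2 * H + S) - y ^ 2 * H + y₁ ^ 2 * H₁)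

lemma GrowthBound.hasSum_edgeTerm (hB : GrowthBound L K ρ) {g k : ℕ} (hL : 2 * g + k + 1 ≤ L)
    {y₁ b : ℂ} {y : Fin k → ℂ} (h1 : ‖y₁‖ < 1 / (2 * ρ)) (hb : ‖b‖ < 1 / (2 * ρ))
    (hy : ∀ i, ‖y i‖ < 1 / (2 * ρ)) (hne : y₁ ≠ b) :
    HasSum (fun p : (ℕ × ℕ) × (Fin k → ℕ) => (p.1.2 : ℂ) *
      (gluingCount g (k + 1) (Fin.cons (p.1.1 + p.1.2 - 1) p.2) : ℂ)
      * (y₁ ^ (p.1.1 + 1) * b ^ p.1.2 * weight y p.2))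
      (edgeTerm y₁ b (eulerGenFun g k (Fin.cons b y)) (genFun g (k + 1) (Fin.cons b y))
        (genFun g (k + 1) (Fin.cons y₁ y))) := by
  have hρ := hB.pos
  have hK : 0 ≤ K := by linarith [hB.1]
  have hsummable : Summable (fun p : (ℕ × ℕ) × (Fin k → ℕ) => (p.1.2 : ℂ) *
      (gluingCount g (k + 1) (Fin.cons (p.1.1 + p.1.2 - 1) p.2) : ℂ)
      * (y₁ ^ (p.1.1 + 1) * b ^ p.1.2 * weight y p.2)) := by
    have h := summable_mul_weight (K := K) (ρ := 2 * ρ) (by linarith) (c := fun μ : Fin (k + 2) → ℕ =>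
        (μ 1 : ℂ) * (gluingCount g (k + 1) (Fin.cons (μ 0 + μ 1 - 1) (Fin.tail (Fin.tail μ))) : ℂ))
      (y := Fin.cons y₁ (Fin.cons b y)) (fun μ => ?_)
      (fun i => by
        refine Fin.cases h1 (fun i => ?_) i
        exact Fin.cases hb hy i)
    · refine ((hasSum_cons_cons h.hasSum).summable.mul_left y₁).congr fun p => ?_
      simp only [Fin.tail_cons, Fin.cons_zero, Fin.cons_one]
      ring
    · rw [norm_mul, Complex.norm_natCast]
      have hsum : ∑ i, μ i = μ 0 + μ 1 + ∑ i, Fin.tail (Fin.tail μ) i := by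
        rw [Fin.sum_univ_succ, Fin.sum_univ_succ, ← add_assoc]
        rfl
      calc (μ 1 : ℝ) * ‖(gluingCount g (k + 1)
            (Fin.cons (μ 0 + μ 1 - 1) (Fin.tail (Fin.tail μ))) : ℂ)‖
          ≤ μ 1 * (K * ρ ^ (∑ i, μ i)) := by
            gcongr
            refine (hB.norm_le hL _).trans ?_
            gcongr
            · linarith [hB.2.1]
            · rw [Fin.sum_cons, hsum]
              omega
        _ = K * (μ 1 * ρ ^ (∑ i, μ i)) := by ring
        _ ≤ _ := by gcongr; exact natCast_mul_pow_le hρ μ 1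
  have hsub : b - y₁ ≠ 0 := sub_ne_zero.2 hne.symm
  have hall (c : ℂ) (hc : ‖c‖ < 1 / (2 * ρ)) :
      ∀ i, ‖(Fin.cons c y : Fin (k + 1) → ℂ) i‖ < 1 / (2 * ρ) := fun i => by
    exact Fin.cases hc hy i
  have H1 := hasSum_cons (hB.summable hL fun i => lt_one_div_of_lt hρ (hall y₁ h1 i)).hasSum
  have H2 := hasSum_cons (hB.summable hL fun i => lt_one_div_of_lt hρ (hall b hb i)).hasSum
  have H3 := hasSum_cons (hB.summable_euler hL (hall b hb)).hasSum
  have H := ((((H2.mul_left 2).add H3).mul_left (b * (b - y₁))).sub (H2.mul_left (b ^ 2))).add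
    (H1.mul_left (y₁ ^ 2))
  have H' := H.mul_left (y₁ * b / (b - y₁) ^ 2)
  have hA := hasSum_antidiagonal hsummable.hasSum
  have hA' := (hasSum_succ_iff (F := fun p : ℕ × (Fin k → ℕ) =>
    ∑ q ∈ Finset.HasAntidiagonal.antidiagonal p.1, (q.2 : ℂ) *
      (gluingCount g (k + 1) (Fin.cons (q.1 + q.2 - 1) p.2) : ℂ)
      * (y₁ ^ (q.1 + 1) * b ^ q.2 * weight y p.2)) (by simp)).2 hA
  have key : ∀ p : ℕ × (Fin k → ℕ),
      (∑ q ∈ Finset.HasAntidiagonal.antidiagonal (p.1 + 1), (q.2 : ℂ) *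
        (gluingCount g (k + 1) (Fin.cons (q.1 + q.2 - 1) p.2) : ℂ)
        * (y₁ ^ (q.1 + 1) * b ^ q.2 * weight y p.2))
      = y₁ * weight y p.2 * (gluingCount g (k + 1) (Fin.cons p.1 p.2) : ℂ)
        * ∑ q ∈ Finset.HasAntidiagonal.antidiagonal (p.1 + 1), (q.2 : ℂ) * (y₁ ^ q.1 * b ^ q.2) := by
    intro p
    rw [Finset.mul_sum]
    refine Finset.sum_congr rfl fun q hq => ?_
    rw [Finset.HasAntidiagonal.mem_antidiagonal] at hq
    rw [hq, Nat.add_sub_cancel]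
    ring
  simp only [key] at hA'
  have heq := hA'.unique (H'.congr_fun fun p => ?_)
  · rw [edgeTerm]
    convert! hsummable.hasSum using 1
    exact heq.symm
  · have := sum_antidiagonal_natCast_mul y₁ b p.1
    rw [mul_comm, ← eq_div_iff (pow_ne_zero 2 hsub)] at this
    rw [this]
    simp only [Fin.cons_zero]
    field_simp
    ring

/-- The loop equation for the generating functions of gluings. -/
theorem genFun_loop (hB : GrowthBound L K ρ) {g m : ℕ} (hL : 2 * g + m + 1 ≤ L)
    (hgm : (g, m) ≠ (0, 0)) {y₁ : ℂ} {y : Fin m → ℂ} (h1 : ‖y₁‖ < 1 / (2 * ρ))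
    (hy : ∀ i, ‖y i‖ < 1 / (2 * ρ)) (hne : ∀ j, y₁ ≠ y j) :
    genFun g (m + 1) (Fin.cons y₁ y)
      = y₁ ^ 2 * ((if g = 0 then 0 else genFun (g - 1) (m + 2) (Fin.cons y₁ (Fin.cons y₁ y)))
          + ∑ h ∈ Finset.HasAntidiagonal.antidiagonal g, ∑ I : Finset (Fin m),
            genFun h.1 (I.card + 1) (Fin.cons y₁ (restr I y))
              * genFun h.2 (Iᶜ.card + 1) (Fin.cons y₁ (restr Iᶜ y)))
        + ∑ j, edgeTerm y₁ (y j)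
            (eulerGenFun g _ (Fin.cons (y j) (restr {j}ᶜ y)))
            (genFun g _ (Fin.cons (y j) (restr {j}ᶜ y)))
            (genFun g _ (Fin.cons y₁ (restr {j}ᶜ y))) := by
  have hρ := hB.pos
  have hcons {k : ℕ} (c : ℂ) (hc : ‖c‖ < 1 / (2 * ρ)) (u : Fin k → ℂ)
      (hu : ∀ i, ‖u i‖ < 1 / (2 * ρ)) :
      ∀ i, ‖(Fin.cons c u : Fin (k + 1) → ℂ) i‖ < 1 / (2 * ρ) := fun i => by
    exact Fin.cases hc hu i
  have hsum {g k : ℕ} (hL : 2 * g + k + 1 ≤ L) (u : Fin (k + 1) → ℂ)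
      (hu : ∀ i, ‖u i‖ < 1 / (2 * ρ)) :
      HasSum (fun μ => (gluingCount g (k + 1) μ : ℂ) * weight u μ) (genFun g (k + 1) u) :=
    (hB.summable hL fun i => lt_one_div_of_lt hρ (hu i)).hasSum
  have hT := hasSum_cons (c := fun μ => (gluingCount g (m + 1) μ : ℂ)) (hsum hL _ (hcons y₁ h1 y hy))
  rw [← hasSum_succ_iff fun x => by rw [gluingCount_cons_zero hgm]; simp] at hT
  refine hT.unique ?_
  -- the loops at the first vertex
  have hC : HasSum (fun p : (ℕ × ℕ) × (Fin m → ℕ) => ((if g = 0 then 0 else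
      gluingCount (g - 1) (m + 2) (Fin.cons p.1.1 (Fin.cons p.1.2 p.2)) : ℕ) : ℂ)
      * (y₁ ^ p.1.1 * y₁ ^ p.1.2 * weight y p.2))
      (if g = 0 then 0 else genFun (g - 1) (m + 2) (Fin.cons y₁ (Fin.cons y₁ y))) := by
    split_ifs with hg
    · simp
    · exact hasSum_cons_cons (c := fun μ => (gluingCount (g - 1) (m + 2) μ : ℂ)) (hsum (by omega) _ (hcons y₁ h1 _ (hcons y₁ h1 y hy)))
  have hS : ∀ h ∈ Finset.HasAntidiagonal.antidiagonal g, HasSum (fun p : (ℕ × ℕ) × (Fin m → ℕ) =>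
      ∑ I : Finset (Fin m), (gluingCount h.1 (I.card + 1) (Fin.cons p.1.1 (restr I p.2)) : ℂ)
        * (gluingCount h.2 (Iᶜ.card + 1) (Fin.cons p.1.2 (restr Iᶜ p.2)) : ℂ)
        * (y₁ ^ p.1.1 * y₁ ^ p.1.2 * weight y p.2))
      (∑ I : Finset (Fin m), genFun h.1 (I.card + 1) (Fin.cons y₁ (restr I y))
        * genFun h.2 (Iᶜ.card + 1) (Fin.cons y₁ (restr Iᶜ y))) := by
    intro h hh
    rw [Finset.HasAntidiagonal.mem_antidiagonal] at hh
    refine hasSum_sum fun I _ => ?_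
    have hcard : I.card + Iᶜ.card = m := by
      rw [Finset.card_add_card_compl, Fintype.card_fin]
    exact hasSum_split I (c := fun μ => (gluingCount h.1 (I.card + 1) μ : ℂ))
      (d := fun μ => (gluingCount h.2 (Iᶜ.card + 1) μ : ℂ)) (hsum (by omega) _ (hcons y₁ h1 _ fun i => hy _))
      (hsum (by omega) _ (hcons y₁ h1 _ fun i => hy _))
  have hR := hasSum_range ((hC.add (hasSum_sum hS)).mul_left (y₁ ^ 2))
  -- the edges from the first vertex to the others
  have hE := hasSum_sum fun j (_ : j ∈ (Finset.univ : Finset (Fin m))) =>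
    ((Equiv.prodCongr (Equiv.refl ℕ) (singleEquiv j ℕ)).trans
      (Equiv.prodAssoc ℕ ℕ _).symm).hasSum_iff.2
      (hB.hasSum_edgeTerm (g := g) (k := ({j}ᶜ : Finset (Fin m)).card) (by
        rw [Finset.card_compl, Fintype.card_fin]; omega) h1 (hy j) (fun i => hy _) (hne j)
        (y := restr {j}ᶜ y))
  refine (hR.add hE).congr_fun fun p => ?_
  rw [gluingCount_cons_succ]
  push_cast
  rw [add_mul, Finset.sum_mul, Finset.sum_mul]
  congr 1
  · refine Finset.sum_congr rfl fun q hq => ?_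
    rw [Finset.mem_range] at hq
    have hpow : y₁ ^ (p.1 + 1) = y₁ ^ 2 * (y₁ ^ q * y₁ ^ (p.1 - 1 - q)) := by
      rw [← pow_add, ← pow_add]
      congr 1
      omega
    simp only [← Finset.sum_mul, ← add_mul]
    rw [hpow]
    ring
  · refine Finset.sum_congr rfl fun j _ => ?_
    simp only [Function.comp_apply, Equiv.trans_apply, Equiv.prodCongr_apply, Prod.map,
      singleEquiv_apply, Equiv.prodAssoc_symm_apply, Equiv.refl_apply]
    rw [weight_eq_single_mul j]
    ring

end GenFun

/-! ### Laplace transforms as power series in `1 / x` -/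

section PowerSeries

lemma weight_update {n : ℕ} (y : Fin n → ℂ) (i : Fin n) (s : ℂ) (μ : Fin n → ℕ) :
    weight (Function.update y i s) μ = (∏ j ∈ {i}ᶜ, y j ^ μ j) * s ^ μ i := by
  rw [weight, ← Finset.prod_compl_mul_prod {i}, Finset.prod_singleton, Function.update_self]
  congr 1
  refine Finset.prod_congr rfl fun j hj => ?_
  rw [Finset.mem_compl, Finset.mem_singleton] at hj
  rw [Function.update_of_ne hj]

/-- Termwise differentiation of a power series with exponentially bounded coefficients. -/
lemma exists_hasDerivAt_tsum_weight {n : ℕ} {K ρ : ℝ} (hρ : 0 < ρ) {c : (Fin n → ℕ) → ℂ}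
    (hc : ∀ μ, ‖c μ‖ ≤ K * ρ ^ (∑ i, μ i)) {y : Fin n → ℂ} (hy : ∀ i, ‖y i‖ < 1 / (2 * ρ))
    (i : Fin n) :
    ∃ D, HasDerivAt (fun s => ∑' μ, c μ * weight (Function.update y i s) μ) D (y i) ∧
      y i * D = ∑' μ, (μ i : ℂ) * c μ * weight y μ := by
  have hK : 0 ≤ K := by
    have := (norm_nonneg _).trans (hc 0)
    simpa using this
  set r : Fin n → ℝ := Function.update (fun j => ‖y j‖) i (1 / (2 * ρ)) with hr
  have hr0 : ∀ j, 0 ≤ r j := fun j => by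
    rcases eq_or_ne j i with rfl | hj
    · rw [hr, Function.update_self]; positivity
    · rw [hr, Function.update_of_ne hj]; positivity
  have hr1 : ∀ j, ρ * r j < 1 := fun j => by
    have h2 : ρ * (1 / (2 * ρ)) < 1 := by
      field_simp
      norm_num
    rcases eq_or_ne j i with rfl | hj
    · rwa [hr, Function.update_self]
    · rw [hr, Function.update_of_ne hj]
      exact lt_of_le_of_lt (by gcongr; exact (hy j).le) h2
  have hu : Summable fun μ : Fin n → ℕ => K * ∏ j, (ρ * r j) ^ μ j :=
    (summable_prod_pow _ (fun j => mul_nonneg hρ.le (hr0 j)) hr1).mul_left K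
  have hle : ∀ (μ : Fin n → ℕ) (s : ℂ), s ∈ Metric.ball (0 : ℂ) (1 / (2 * ρ)) →
      ‖c μ * weight (Function.update y i s) μ‖ ≤ K * ∏ j, (ρ * r j) ^ μ j := by
    intro μ s hs
    rw [mem_ball_zero_iff] at hs
    rw [norm_mul, weight, norm_prod]
    simp only [norm_pow, mul_pow, Finset.prod_mul_distrib]
    rw [Finset.prod_pow_eq_pow_sum, ← mul_assoc]
    refine mul_le_mul (hc μ) (Finset.prod_le_prod (fun _ _ => by positivity) fun j _ => ?_)
      (Finset.prod_nonneg fun _ _ => by positivity) (by positivity)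
    gcongr
    rcases eq_or_ne j i with rfl | hj
    · rw [hr, Function.update_self, Function.update_self]
      exact hs.le
    · rw [hr, Function.update_of_ne hj, Function.update_of_ne hj]
  have hdiff : ∀ μ : Fin n → ℕ, DifferentiableOn ℂ
      (fun s => c μ * weight (Function.update y i s) μ) (Metric.ball (0 : ℂ) (1 / (2 * ρ))) := by
    intro μ
    simp only [weight_update]
    fun_prop
  have hmem : y i ∈ Metric.ball (0 : ℂ) (1 / (2 * ρ)) := by
    rw [mem_ball_zero_iff]; exact hy i
  have h1 := Complex.hasSum_deriv_of_summable_norm hu hdiff Metric.isOpen_ball hle hmem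
  have h2 := Complex.differentiableOn_tsum_of_summable_norm hu hdiff Metric.isOpen_ball hle
  refine ⟨_, (h2.differentiableAt (Metric.isOpen_ball.mem_nhds hmem)).hasDerivAt, ?_⟩
  refine (h1.mul_left (y i)).tsum_eq.symm.trans (tsum_congr fun μ => ?_)
  have h3 : weight y μ = (∏ j ∈ {i}ᶜ, y j ^ μ j) * y i ^ μ i := by
    rw [← weight_update, Function.update_eq_self]
  simp only [weight_update]
  rw [h3, ((((hasDerivAt_pow (μ i) (y i)).const_mul _).const_mul (c μ))).deriv]
  rcases Nat.eq_zero_or_pos (μ i) with h | h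
  · simp [h]
  · obtain ⟨k, hk⟩ := Nat.exists_eq_add_of_lt h
    rw [hk]
    simp only [zero_add, Nat.add_sub_cancel]
    ring

end PowerSeries

section Curve

/-- The local coordinate `1 / x` at `x = ∞`. -/
noncomputable def recip (t : ℂ) : ℂ := (t ^ 2 - 1) / (2 * (t ^ 2 + 1))

/-- The logarithmic derivative of `1 / x`. -/
noncomputable def recipLog (t : ℂ) : ℂ := 4 * t / ((t ^ 2 + 1) * (t ^ 2 - 1))

/-- No case distinction is needed: at `t = ± 1` and `t = ± i` both sides vanish. -/
lemma inv_xOf (t : ℂ) : (xOf t)⁻¹ = recip t := by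
  unfold xOf zOf recip
  by_cases h1 : t - 1 = 0
  · obtain rfl : t = 1 := sub_eq_zero.1 h1
    simp
  by_cases h2 : t + 1 = 0
  · obtain rfl : t = -1 := eq_neg_of_add_eq_zero_left h2
    norm_num
  have : (t + 1) / (t - 1) + 1 / ((t + 1) / (t - 1)) = 2 * (t ^ 2 + 1) / (t ^ 2 - 1) := by
    have h3 : t ^ 2 - 1 ≠ 0 := by
      rw [show t ^ 2 - 1 = (t - 1) * (t + 1) by ring]
      exact mul_ne_zero h1 h2
    field_simp
    ring
  rw [this, inv_div]

/-- The points of the sheet `Re t < 0` with `0 < |1 / x| < r`. -/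
def sheet (r : ℝ) : Set ℂ := {t | t.re < 0 ∧ recip t ≠ 0 ∧ ‖recip t‖ < r}

lemma sheet_mono {r r' : ℝ} (h : r ≤ r') : sheet r ⊆ sheet r' :=
  fun _ ht => ⟨ht.1, ht.2.1, ht.2.2.trans_le h⟩

lemma sq_add_one_ne_zero {t : ℂ} (ht : t.re < 0) : t ^ 2 + 1 ≠ 0 := by
  intro h
  have : (t - Complex.I) * (t + Complex.I) = 0 := by
    have := Complex.I_sq
    linear_combination h - this
  rcases mul_eq_zero.1 this with h | h
  · rw [sub_eq_zero.1 h] at ht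
    simp at ht
  · rw [eq_neg_of_add_eq_zero_left h] at ht
    simp at ht

lemma ne_zero_of_re_neg {t : ℂ} (ht : t.re < 0) : t ≠ 0 := by
  rintro rfl
  simp at ht

lemma sq_sub_one_ne_zero {t : ℂ} (ht : recip t ≠ 0) : t ^ 2 - 1 ≠ 0 := by
  intro h
  exact ht (by simp [recip, h])

lemma hasDerivAt_recip {t : ℂ} (h : t ^ 2 + 1 ≠ 0) (h' : t ^ 2 - 1 ≠ 0) :
    HasDerivAt recip (recipLog t * recip t) t := by
  have h1 : HasDerivAt (fun t : ℂ => t ^ 2 - 1) (2 * t) t := by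
    simpa using (hasDerivAt_pow 2 t).sub_const 1
  have h2 : HasDerivAt (fun t : ℂ => 2 * (t ^ 2 + 1)) (2 * (2 * t)) t := by
    simpa using ((hasDerivAt_pow 2 t).add_const 1).const_mul 2
  convert! h1.div h2 (mul_ne_zero two_ne_zero h) using 1
  unfold recipLog recip
  field_simp
  ring

lemma isOpen_sheet (r : ℝ) : IsOpen (sheet r) := by
  have hc : ContinuousOn recip {t : ℂ | t.re < 0} := fun t ht =>
    ContinuousAt.continuousWithinAt (by
      unfold recip
      exact ContinuousAt.div (by fun_prop) (by fun_prop)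
        (mul_ne_zero two_ne_zero (sq_add_one_ne_zero ht)))
  have ho : IsOpen {t : ℂ | t.re < 0} := isOpen_lt Complex.continuous_re continuous_const
  have h := hc.isOpen_inter_preimage ho
    ((isOpen_compl_singleton (x := (0 : ℂ))).inter (Metric.isOpen_ball (x := (0 : ℂ)) (ε := r)))
  convert h using 1
  ext t
  simp [sheet]

lemma recip_injOn {s t : ℂ} (hs : s.re < 0) (ht : t.re < 0) (h : recip s = recip t) : s = t := by
  have h1 := sq_add_one_ne_zero hs
  have h2 := sq_add_one_ne_zero ht
  unfold recip at h
  rw [div_eq_div_iff (by simpa using h1) (by simpa using h2)] at h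
  have : (s - t) * (s + t) = 0 := by linear_combination h / 4
  rcases mul_eq_zero.1 this with h | h
  · exact sub_eq_zero.1 h
  · have := congrArg Complex.re h
    simp at this
    linarith

lemma mem_sheet_of_mem_nearInfinity {n : ℕ} {R r : ℝ} (hr : 0 < r) (hR : 1 / r ≤ R)
    {t : Fin n → ℂ} (ht : t ∈ nearInfinity n R) (i : Fin n) : t i ∈ sheet r := by
  obtain ⟨h1, h2⟩ := ht i
  have hx : 0 < ‖xOf (t i)‖ := (one_div_pos.2 hr).trans (hR.trans_lt h2)
  refine ⟨h1, ?_, ?_⟩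
  · rw [← inv_xOf]
    exact inv_ne_zero (norm_pos_iff.1 hx)
  · rw [← inv_xOf, norm_inv, inv_eq_one_div, one_div_lt hx hr]
    exact hR.trans_lt h2

lemma laplaceWeight_eq {n : ℕ} (μ : Fin n → ℕ+) (t : Fin n → ℂ) :
    laplaceWeight μ t = weight (fun i => recip (t i)) fun i => (μ i : ℕ) := by
  simp only [laplaceWeight, inv_xOf]
  rfl

end Curve

section MixedDeriv

lemma norm_list_prod_mul_le {n : ℕ} {K ρ : ℝ} (hρ : 0 < ρ) {c : (Fin n → ℕ) → ℂ}
    (hc : ∀ μ, ‖c μ‖ ≤ K * ρ ^ (∑ i, μ i)) (l : List (Fin n)) (μ : Fin n → ℕ) :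
    ‖(l.map fun i => (μ i : ℂ)).prod * c μ‖ ≤ K * (2 ^ l.length * ρ) ^ (∑ i, μ i) := by
  have hK : 0 ≤ K := by
    have := (norm_nonneg _).trans (hc 0)
    simpa using this
  induction l with
  | nil => simpa using hc μ
  | cons i l ih =>
    rw [List.map_cons, List.prod_cons, mul_assoc, norm_mul, Complex.norm_natCast]
    calc (μ i : ℝ) * ‖(l.map fun i => (μ i : ℂ)).prod * c μ‖
        ≤ μ i * (K * (2 ^ l.length * ρ) ^ (∑ i, μ i)) := by gcongr
      _ = K * (μ i * (2 ^ l.length * ρ) ^ (∑ i, μ i)) := by ring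
      _ ≤ K * (2 * (2 ^ l.length * ρ)) ^ (∑ i, μ i) := by
        gcongr; exact natCast_mul_pow_le (by positivity) μ i
      _ = _ := by rw [List.length_cons, pow_succ]; ring_nf

lemma foldr_partialDeriv_tsum {n : ℕ} {K ρ : ℝ} (hρ : 0 < ρ) {c : (Fin n → ℕ) → ℂ}
    (hc : ∀ μ, ‖c μ‖ ≤ K * ρ ^ (∑ i, μ i)) (l : List (Fin n)) (hl : l.Nodup) {t : Fin n → ℂ}
    (ht : ∀ i, t i ∈ sheet (1 / (2 ^ l.length * ρ))) :
    l.foldr partialDeriv (fun t => ∑' μ, c μ * weight (fun i => recip (t i)) μ) t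
      = (l.map fun i => recipLog (t i)).prod *
        ∑' μ, (l.map fun i => (μ i : ℂ)).prod * c μ * weight (fun i => recip (t i)) μ := by
  induction l generalizing t with
  | nil => simp
  | cons i l ih =>
    have hmono : sheet (1 / (2 ^ (i :: l).length * ρ)) ⊆ sheet (1 / (2 ^ l.length * ρ)) := by
      refine sheet_mono (one_div_le_one_div_of_le (by positivity) ?_)
      gcongr
      · norm_num
      · simp
    obtain ⟨hil, hl'⟩ := List.nodup_cons.1 hl
    obtain ⟨D, hD, hD'⟩ := exists_hasDerivAt_tsum_weight (ρ := 2 ^ l.length * ρ) (by positivity)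
      (norm_list_prod_mul_le hρ hc l) (y := fun i => recip (t i)) (fun j => by
        refine (ht j).2.2.trans_le (le_of_eq ?_)
        rw [List.length_cons, pow_succ]
        ring_nf) i
    have hcomp := hD.comp (t i) (hasDerivAt_recip (sq_add_one_ne_zero (ht i).1)
      (sq_sub_one_ne_zero (ht i).2.1))
    rw [List.foldr_cons, partialDeriv]
    have hev : (fun s => l.foldr partialDeriv
        (fun t => ∑' μ, c μ * weight (fun i => recip (t i)) μ) (Function.update t i s))
        =ᶠ[nhds (t i)] fun s => (l.map fun i => recipLog (t i)).prod *
          ∑' μ, (l.map fun i => (μ i : ℂ)).prod * c μ *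
            weight (Function.update (fun i => recip (t i)) i (recip s)) μ := by
      filter_upwards [(isOpen_sheet _).mem_nhds (ht i)] with s hs
      rw [ih hl']
      · congr 1
        · congr 1
          refine List.map_congr_left fun j hj => ?_
          rw [Function.update_of_ne]
          rintro rfl
          exact hil hj
        · refine tsum_congr fun μ => ?_
          congr 2
          ext j
          rcases eq_or_ne j i with rfl | hj
          · rw [Function.update_self, Function.update_self]
          · rw [Function.update_of_ne hj, Function.update_of_ne hj]
      · intro j
        refine hmono ?_
        rcases eq_or_ne j i with rfl | hj
        · rwa [Function.update_self]
        · rw [Function.update_of_ne hj]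
          exact ht j
    have hder := (hcomp.const_mul (l.map fun i => recipLog (t i)).prod).deriv
    simp only [Function.comp_apply] at hder
    rw [hev.deriv_eq, hder, mul_left_comm D, mul_comm D, hD', List.map_cons,
      List.prod_cons, mul_left_comm, ← mul_assoc]
    simp only [List.map_cons, List.prod_cons, mul_assoc]

/-- The coefficient of `d_1 ⋯ d_n F_{g,n}` on the sheet `z ∼ 1 / x`, including for `(g,n) = (0,1)`
the summand of degree zero. -/
noncomputable def sheetForm (g n : ℕ) (t : Fin n → ℂ) : ℂ :=
  (∏ i, recipLog (t i)) * genFun g n fun i => recip (t i)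

lemma dessinCount_eq_div {g n : ℕ} {μ : Fin n → ℕ} (hμ : ∀ i, 0 < μ i) :
    dessinCount g n μ = gluingCount g n μ / ∏ i, (μ i : ℚ) := by
  rw [← dessinCount_mul_prod hμ, mul_div_cancel_right₀]
  exact Finset.prod_ne_zero_iff.2 fun i _ => by exact_mod_cast (hμ i).ne'

/-- The dessin count, set to zero if some degree is zero. -/
noncomputable def dessinCoeff (g n : ℕ) (μ : Fin n → ℕ) : ℂ :=
  if ∀ i, 0 < μ i then (dessinCount g n μ : ℂ) else 0

lemma dessinCoeff_mul_prod {g m : ℕ} (μ : Fin (m + 1) → ℕ) :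
    (∏ i, (μ i : ℂ)) * dessinCoeff g (m + 1) μ
      = gluingCount g (m + 1) μ - if (g, m) = (0, 0) ∧ μ = 0 then 1 else 0 := by
  unfold dessinCoeff
  split_ifs with h1 h2 h2
  · exact absurd (h1 0) (by simp [h2.2])
  · have := congrArg (fun q : ℚ => (q : ℂ)) (dessinCount_mul_prod (g := g) h1)
    push_cast at this
    rw [mul_comm, this, sub_zero]
  · obtain ⟨h2, rfl⟩ := h2
    obtain ⟨rfl, rfl⟩ := Prod.mk.inj h2
    have : (0 : Fin 1 → ℕ) = ![0] := by ext i; simp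
    rw [zero_add, this, gluingCount_zero_one_zero]
    simp
  · simp only [not_forall, not_lt, nonpos_iff_eq_zero] at h1
    obtain ⟨i, hi⟩ := h1
    have h0 : gluingCount g (m + 1) μ = 0 := by
      rcases Nat.eq_zero_or_pos m with rfl | hm
      · have hμ : μ = Fin.cons 0 Fin.elim0 := by
          ext k
          rw [Subsingleton.elim (α := Fin 1) k i, hi, Subsingleton.elim (α := Fin 1) i 0]
          rfl
        rw [hμ]
        refine gluingCount_cons_zero (fun h => h2 ⟨h, ?_⟩) _
        ext k
        rw [Subsingleton.elim (α := Fin 1) k i, hi]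
        rfl
      · exact gluingCount_eq_zero_of_isolated g (by omega) μ i hi
    rw [h0]
    simp

variable {L : ℕ} {K ρ : ℝ}

lemma GrowthBound.norm_dessinCoeff_le (hB : GrowthBound L K ρ) {g m : ℕ}
    (hL : 2 * g + m + 1 ≤ L) (μ : Fin (m + 1) → ℕ) :
    ‖dessinCoeff g (m + 1) μ‖ ≤ K * ρ ^ (∑ i, μ i) := by
  unfold dessinCoeff
  split_ifs with h
  · rw [dessinCount_eq_div h]
    push_cast
    rw [norm_div]
    refine (div_le_self (norm_nonneg _) ?_).trans (hB.norm_le hL μ)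
    rw [norm_prod]
    refine Finset.one_le_prod fun i _ => ?_
    rw [Complex.norm_natCast]
    exact_mod_cast h i
  · have := hB.1
    have := hB.pos
    rw [norm_zero]
    positivity

lemma injective_coe_pnat (n : ℕ) :
    Function.Injective fun (μ : Fin n → ℕ+) (i : Fin n) => (μ i : ℕ) := fun μ ν h => by
  funext i
  exact PNat.eq (congrFun h i)

lemma dessinCoeff_coe (g n : ℕ) (μ : Fin n → ℕ+) :
    dessinCoeff g n (fun i => (μ i : ℕ)) = dessinCount g n (fun i => (μ i : ℕ)) :=
  if_pos fun i => (μ i).pos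

lemma dessinLaplace_eq_tsum (g n : ℕ) (t : Fin n → ℂ) :
    dessinLaplace g n t = ∑' μ : Fin n → ℕ, dessinCoeff g n μ * weight (fun i => recip (t i)) μ := by
  rw [← (injective_coe_pnat n).tsum_eq]
  · refine tsum_congr fun μ => ?_
    rw [dessinCoeff_coe, laplaceWeight_eq]
  · intro μ hμ
    have : ∀ i, 0 < μ i := by
      by_contra h
      exact hμ (by simp only [dessinCoeff, if_neg h, zero_mul])
    exact ⟨fun i => ⟨μ i, this i⟩, rfl⟩

lemma GrowthBound.summable_dessinCount (hB : GrowthBound L K ρ) {g m : ℕ}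
    (hL : 2 * g + m + 1 ≤ L) {t : Fin (m + 1) → ℂ} (ht : ∀ i, t i ∈ sheet (1 / ρ)) :
    Summable fun μ : Fin (m + 1) → ℕ+ =>
      (dessinCount g (m + 1) (fun i => (μ i : ℕ)) : ℂ) * laplaceWeight μ t := by
  have h := summable_mul_weight hB.pos (hB.norm_dessinCoeff_le hL) fun i => (ht i).2.2
  refine (h.comp_injective (injective_coe_pnat (m + 1))).congr fun μ => ?_
  rw [laplaceWeight_eq, Function.comp_apply, dessinCoeff_coe]

lemma GrowthBound.mixedDeriv_dessinLaplace (hB : GrowthBound L K ρ) {g m : ℕ}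
    (hL : 2 * g + m + 1 ≤ L) {t : Fin (m + 1) → ℂ}
    (ht : ∀ i, t i ∈ sheet (1 / (2 ^ (m + 1) * ρ))) :
    mixedDeriv (dessinLaplace g (m + 1)) t
      = sheetForm g (m + 1) t - if (g, m) = (0, 0) then recipLog (t 0) else 0 := by
  have hρ := hB.pos
  have h := foldr_partialDeriv_tsum hρ (hB.norm_dessinCoeff_le hL) (List.finRange (m + 1))
    (List.nodup_finRange _) (by rwa [List.length_finRange])
  rw [mixedDeriv, show dessinLaplace g (m + 1) = _ from funext (dessinLaplace_eq_tsum g (m + 1)), h]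
  have hprod (f : Fin (m + 1) → ℂ) : ((List.finRange (m + 1)).map f).prod = ∏ i, f i :=
    (Fin.prod_univ_def f).symm
  simp only [hprod, dessinCoeff_mul_prod, sub_mul]
  have hsum : Summable fun μ : Fin (m + 1) → ℕ =>
      (gluingCount g (m + 1) μ : ℂ) * weight (fun i => recip (t i)) μ :=
    hB.summable hL fun i => (ht i).2.2.trans_le
      (one_div_le_one_div_of_le hρ (le_mul_of_one_le_left hρ.le (one_le_pow₀ (by norm_num))))
  have h0 : HasSum (fun μ : Fin (m + 1) → ℕ =>
      (if (g, m) = (0, 0) ∧ μ = 0 then 1 else 0) * weight (fun i => recip (t i)) μ)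
      (if (g, m) = (0, 0) then 1 else 0) := by
    convert! hasSum_ite_eq (0 : Fin (m + 1) → ℕ) (if (g, m) = (0, 0) then (1 : ℂ) else 0) using 2
      with μ
    by_cases hμ : μ = 0
    · subst hμ
      simp [weight]
    · simp [hμ]
  rw [(hsum.hasSum.sub h0).tsum_eq, mul_sub]
  congr 1
  split_ifs with hgm
  · obtain ⟨rfl, rfl⟩ := Prod.mk.inj hgm
    simp
  · simp

end MixedDeriv

/-! ### The loop equation on the spectral curve -/

section Unstable

/-- The factor `(t² - 1)³ / (32 t²)` of the recursion kernel. -/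
noncomputable def kern (t : ℂ) : ℂ := (t ^ 2 - 1) ^ 3 / (32 * t ^ 2)

variable {L : ℕ} {K ρ : ℝ}

lemma xOf_eq {t : ℂ} : xOf t = (recip t)⁻¹ := by rw [← inv_xOf, inv_inv]

lemma sub_one_mul_add_one_ne {t : ℂ} (h' : t ^ 2 - 1 ≠ 0) : t - 1 ≠ 0 ∧ t + 1 ≠ 0 := by
  rw [show t ^ 2 - 1 = (t - 1) * (t + 1) by ring] at h'
  exact ⟨left_ne_zero_of_mul h', right_ne_zero_of_mul h'⟩

lemma deriv_xOf {t : ℂ} (h : t ^ 2 - 1 ≠ 0) : deriv xOf t = -(8 * t) / (t ^ 2 - 1) ^ 2 := by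
  obtain ⟨h1, h2⟩ := sub_one_mul_add_one_ne h
  have hz : HasDerivAt zOf ((1 * (t - 1) - (t + 1) * 1) / (t - 1) ^ 2) t :=
    ((hasDerivAt_id t).add_const 1).div ((hasDerivAt_id t).sub_const 1) h1
  have hx : HasDerivAt xOf _ t := hz.add ((hasDerivAt_const t 1).div hz (div_ne_zero h2 h1))
  rw [hx.deriv, zOf, show t ^ 2 - 1 = (t - 1) * (t + 1) by ring]
  field_simp
  ring

lemma w01_eq {t : ℂ} (h : t ^ 2 - 1 ≠ 0) : w01 t = 8 * t * (t + 1) ^ 2 / (t ^ 2 - 1) ^ 3 := by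
  obtain ⟨h1, h2⟩ := sub_one_mul_add_one_ne h
  rw [w01, deriv_xOf h, yOf, zOf, show t ^ 2 - 1 = (t - 1) * (t + 1) by ring]
  field_simp

lemma norm_zOf_lt_one {t : ℂ} (ht : t.re < 0) : ‖zOf t‖ < 1 := by
  have h1 : t - 1 ≠ 0 := by
    intro h
    rw [sub_eq_zero.1 h] at ht
    simp at ht
    linarith
  rw [zOf, norm_div, div_lt_one (norm_pos_iff.2 h1)]
  refine lt_of_pow_lt_pow_left₀ 2 (norm_nonneg _) ?_
  rw [← Complex.normSq_eq_norm_sq, ← Complex.normSq_eq_norm_sq, Complex.normSq_apply,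
    Complex.normSq_apply]
  simp
  nlinarith

lemma GrowthBound.genFun_zero_one (hB : GrowthBound L K ρ) (hL : 1 ≤ L) {y : ℂ}
    (hy : ‖y‖ < 1 / (2 * ρ)) : genFun 0 1 ![y] = 1 + y ^ 2 * genFun 0 1 ![y] ^ 2 := by
  have hsum : HasSum (fun μ => (gluingCount 0 1 μ : ℂ) * weight ![y] μ) (genFun 0 1 ![y]) :=
    (hB.summable (g := 0) (m := 0) (by omega) fun i => by
      rw [Subsingleton.elim (α := Fin 1) i 0]
      exact lt_one_div_of_lt hB.pos hy).hasSum
  have h1 : HasSum (fun n : ℕ => (gluingCount 0 1 ![n] : ℂ) * y ^ n) (genFun 0 1 ![y]) := by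
    refine ((Equiv.funUnique (Fin 1) ℕ).symm.hasSum_iff.2 hsum).congr_fun fun n => ?_
    have : ((Equiv.funUnique (Fin 1) ℕ).symm n) = ![n] := by
      ext i
      rw [Subsingleton.elim (α := Fin 1) i 0]
      rfl
    rw [Function.comp_apply, this, weight, Fin.prod_univ_one]
    rfl
  have h2 := hasSum_range ((Equiv.prodPUnit.{0} (ℕ × ℕ)).hasSum_iff.2
    ((hasSum_mul_prod h1 h1).mul_left (y ^ 2)))
  have h3 := (Equiv.prodPUnit.{0} ℕ).symm.hasSum_iff.2 h2
  have h4 := (hasSum_nat_add_iff' 1).2 h1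
  rw [Finset.sum_range_one, gluingCount_zero_one_zero, pow_zero, Nat.cast_one, mul_one] at h4
  have := h4.unique (h3.congr_fun fun n => ?_)
  · rw [sub_eq_iff_eq_add] at this
    rw [add_comm, sq (genFun 0 1 ![y])]
    exact this
  · rw [gluingCount_zero_one_succ]
    push_cast
    rw [Finset.sum_mul]
    refine Finset.sum_congr rfl fun p hp => ?_
    rw [Equiv.prodPUnit_symm_apply, Finset.mem_range] at hp
    simp only [Function.comp_apply, Equiv.prodPUnit_apply, Equiv.prodPUnit_symm_apply]
    have hpow : y ^ (n + 1) = y ^ 2 * (y ^ p * y ^ (n - 1 - p)) := by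
      rw [← pow_add, ← pow_add]
      congr 1
      simp only at hp
      omega
    rw [hpow]
    ring

lemma GrowthBound.norm_genFun_zero_one_le (hB : GrowthBound L K ρ) {y : ℂ}
    (hy : ‖y‖ < 1 / (2 * ρ)) : ‖genFun 0 1 ![y]‖ ≤ 2 := by
  have hy' : ‖y‖ < 1 / 8 := by
    refine hy.trans_le (one_div_le_one_div_of_le (by norm_num) ?_)
    linarith [hB.2.1]
  have hgeo := (hasSum_geometric_of_lt_one (r := 4 * ‖y‖) (by positivity) (by linarith))
  have : ‖genFun 0 1 ![y]‖ ≤ (1 - 4 * ‖y‖)⁻¹ := by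
    refine tsum_of_norm_bounded ((Equiv.funUnique (Fin 1) ℕ).hasSum_iff.2 hgeo) fun μ => ?_
    have hμ : μ = ![μ 0] := by
      ext i
      rw [Subsingleton.elim (α := Fin 1) i 0]
      rfl
    rw [norm_mul, weight, Fin.prod_univ_one, norm_pow, Complex.norm_natCast, Function.comp_apply,
      mul_pow]
    change _ ≤ 4 ^ μ 0 * ‖y‖ ^ μ 0
    refine mul_le_mul_of_nonneg_right ?_ (by positivity)
    rw [hμ]
    exact_mod_cast gluingCount_zero_one_le _
  refine this.trans ?_
  rw [inv_le_comm₀ (by linarith) two_pos]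
  linarith

/-- Type `(0,1)`: the generating function is the solution of a quadratic equation which is small
at `x = ∞`. -/
lemma GrowthBound.sheetForm_zero_one (hB : GrowthBound L K ρ) (hL : 1 ≤ L) {t : ℂ}
    (ht : t ∈ sheet (1 / (2 * ρ))) : sheetForm 0 1 ![t] = w01 t := by
  obtain ⟨hre, hy0, hy⟩ := ht
  have h := sq_add_one_ne_zero hre
  have h' := sq_sub_one_ne_zero hy0
  obtain ⟨h1, h2⟩ := sub_one_mul_add_one_ne h'
  have hquad := hB.genFun_zero_one hL hy
  have hle := hB.norm_genFun_zero_one_le hy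
  have hform : sheetForm 0 1 ![t] = recipLog t * genFun 0 1 ![recip t] := by
    rw [sheetForm, Fin.prod_univ_one]
    congr 2
    ext i
    rw [Subsingleton.elim (α := Fin 1) i 0]
    rfl
  set G := genFun 0 1 ![recip t] with hG
  have hx : zOf t + 1 / zOf t = (recip t)⁻¹ := xOf_eq
  have hz : zOf t ≠ 0 := div_ne_zero h2 h1
  have hfac : (recip t * G - zOf t) * (recip t * G * zOf t - 1) = 0 := by
    have : recip t * (zOf t ^ 2 + 1) = zOf t := by
      field_simp at hx
      linear_combination hx
    linear_combination (-G) * this - zOf t * hquad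
  have hzlt := norm_zOf_lt_one hre
  have hZ : recip t * G = zOf t := by
    rcases mul_eq_zero.1 hfac with h | h
    · exact sub_eq_zero.1 h
    · exfalso
      have h3 : ‖recip t * G * zOf t‖ = 1 := by rw [sub_eq_zero.1 h, norm_one]
      have h4 : ‖recip t‖ < 1 / 2 := by
        refine hy.trans_le (one_div_le_one_div_of_le (by norm_num) ?_)
        linarith [hB.2.1]
      rw [norm_mul, norm_mul] at h3
      nlinarith [norm_nonneg (recip t), norm_nonneg G, norm_nonneg (zOf t),
        mul_nonneg (norm_nonneg (recip t)) (norm_nonneg G)]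
  have hG' : G = zOf t / recip t := by rw [eq_div_iff hy0, mul_comm, hZ]
  rw [hform, hG', w01_eq h', zOf, recipLog, recip, show t ^ 2 - 1 = (t - 1) * (t + 1) by ring]
  field_simp
  ring

end Unstable

section EdgeIdentity

/-- The contribution of the `j`-th vertex to the recursion which involves the values `φ` and `φ'`
of a function and its derivative at `b = t_j`. -/
noncomputable def residueTerm (t₁ b φ φ' : ℂ) : ℂ :=
  (2 * φ + 2 * b * φ') / (b ^ 2 - t₁ ^ 2) - 4 * b ^ 2 * φ / (b ^ 2 - t₁ ^ 2) ^ 2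

lemma hasDerivAt_recipLog {t : ℂ} (h : t ^ 2 + 1 ≠ 0) (h' : t ^ 2 - 1 ≠ 0) :
    HasDerivAt recipLog (-4 * (3 * t ^ 4 + 1) / ((t ^ 2 + 1) ^ 2 * (t ^ 2 - 1) ^ 2)) t := by
  have h1 : HasDerivAt (fun t : ℂ => 4 * t) 4 t := by
    simpa using (hasDerivAt_id t).const_mul 4
  have h2 : HasDerivAt (fun t : ℂ => (t ^ 2 + 1) * (t ^ 2 - 1))
      (2 * t * (t ^ 2 - 1) + (t ^ 2 + 1) * (2 * t)) t := by
    simpa using ((hasDerivAt_pow 2 t).add_const 1).fun_mul ((hasDerivAt_pow 2 t).sub_const 1)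
  convert! h1.div h2 (mul_ne_zero h h') using 1
  field_simp
  ring

lemma hasDerivAt_kern {t : ℂ} (h : t ≠ 0) :
    HasDerivAt kern ((t ^ 2 - 1) ^ 2 * (2 * t ^ 2 + 1) / (16 * t ^ 3)) t := by
  have h1 : HasDerivAt (fun t : ℂ => (t ^ 2 - 1) ^ 3) (3 * (t ^ 2 - 1) ^ 2 * (2 * t)) t := by
    simpa using ((hasDerivAt_pow 2 t).sub_const 1).fun_pow 3
  have h2 : HasDerivAt (fun t : ℂ => 32 * t ^ 2) (32 * (2 * t)) t := by
    simpa using (hasDerivAt_pow 2 t).const_mul 32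
  convert! h1.div h2 (mul_ne_zero (by norm_num) (pow_ne_zero 2 h)) using 1
  field_simp
  ring

lemma edgeTerm_eq {a b v v' v₁ : ℂ} (hb : b ≠ 0) (ha1 : a ^ 2 + 1 ≠ 0)
    (hb1 : b ^ 2 + 1 ≠ 0) (ha2 : a ^ 2 - 1 ≠ 0) (hb2 : b ^ 2 - 1 ≠ 0) (hab : b - a ≠ 0)
    (hab' : b + a ≠ 0) :
    recipLog a / recip a ^ 2 * edgeTerm (recip a) (recip b)
        (recipLog a * ((v' - -4 * (3 * b ^ 4 + 1) / ((b ^ 2 + 1) ^ 2 * (b ^ 2 - 1) ^ 2)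
          / recipLog b * v) / recipLog b)) (recipLog a * v) (recipLog b * v₁)
      = v₁ * (1 / (a - b) ^ 2 - 1 / (a + b) ^ 2)
        + residueTerm a b (kern b * v)
          ((b ^ 2 - 1) ^ 2 * (2 * b ^ 2 + 1) / (16 * b ^ 3) * v + kern b * v') / kern a := by
  have hsub : recip b - recip a = (b - a) * (b + a) / ((a ^ 2 + 1) * (b ^ 2 + 1)) := by
    unfold recip
    field_simp
    ring
  have h1 : b ^ 2 - a ^ 2 = (b - a) * (b + a) := by ring
  have h2 : (a - b) ^ 2 = (b - a) ^ 2 := by ring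
  have h3 : a + b = b + a := add_comm _ _
  unfold edgeTerm residueTerm
  rw [hsub, h1, h2, h3]
  unfold recip recipLog kern
  field_simp
  ring

end EdgeIdentity

section Loop

variable {L : ℕ} {K ρ : ℝ}

lemma comp_cons {α β : Type*} {m : ℕ} (f : α → β) (a : α) (u : Fin m → α) :
    (fun i => f ((Fin.cons a u : Fin (m + 1) → α) i)) = Fin.cons (f a) fun i => f (u i) := by
  ext i
  exact Fin.cases rfl (fun i => rfl) i

lemma sheetForm_cons (g : ℕ) {m : ℕ} (s : ℂ) (u : Fin m → ℂ) :
    sheetForm g (m + 1) (Fin.cons s u)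
      = recipLog s * (∏ i, recipLog (u i)) * genFun g (m + 1) (Fin.cons (recip s)
        fun i => recip (u i)) := by
  rw [sheetForm, Fin.prod_univ_succ, comp_cons]
  rfl

lemma recipLog_ne_zero {t : ℂ} (ht0 : t ≠ 0) (h : t ^ 2 + 1 ≠ 0) (h' : t ^ 2 - 1 ≠ 0) :
    recipLog t ≠ 0 :=
  div_ne_zero (mul_ne_zero (by norm_num) ht0) (mul_ne_zero h h')

lemma edgeTerm_mul (c y₁ y S H H₁ : ℂ) :
    c * edgeTerm y₁ y S H H₁ = edgeTerm y₁ y (c * S) (c * H) (c * H₁) := by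
  unfold edgeTerm
  ring

lemma GrowthBound.hasDerivAt_sheetForm (hB : GrowthBound L K ρ) {g m : ℕ}
    (hL : 2 * g + m + 1 ≤ L) {s : ℂ} {u : Fin m → ℂ} (hs : s ∈ sheet (1 / (2 * ρ)))
    (hu : ∀ i, u i ∈ sheet (1 / (2 * ρ))) :
    HasDerivAt (fun s => sheetForm g (m + 1) (Fin.cons s u))
      ((∏ i, recipLog (u i)) *
        (-4 * (3 * s ^ 4 + 1) / ((s ^ 2 + 1) ^ 2 * (s ^ 2 - 1) ^ 2)
          * genFun g (m + 1) (Fin.cons (recip s) fun i => recip (u i))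
        + recipLog s ^ 2 * eulerGenFun g m (Fin.cons (recip s) fun i => recip (u i)))) s := by
  have h1 := sq_add_one_ne_zero hs.1
  have h2 := sq_sub_one_ne_zero hs.2.1
  obtain ⟨D, hD, hD'⟩ := exists_hasDerivAt_tsum_weight hB.pos (hB.norm_le hL)
    (y := Fin.cons (recip s) fun i => recip (u i)) (fun i => by
      refine Fin.cases hs.2.2 (fun i => (hu i).2.2) i) 0
  simp only [Fin.update_cons_zero, Fin.cons_zero] at hD hD'
  have h := ((hasDerivAt_recipLog h1 h2).mul_const (∏ i, recipLog (u i))).fun_mul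
    (hD.comp s (hasDerivAt_recip h1 h2))
  have hfun : (fun s => sheetForm g (m + 1) (Fin.cons s u))
      = fun s => recipLog s * (∏ i, recipLog (u i)) * genFun g (m + 1) (Fin.cons (recip s)
        fun i => recip (u i)) := funext fun s => sheetForm_cons g s u
  rw [hfun]
  convert! h using 1
  rw [eulerGenFun, ← hD', Function.comp_apply, genFun]
  ring

/-- The loop equation for the differentials `d_1 ⋯ d_n F_{g,n}` on the sheet `z ∼ 1 / x`, with all
terms included. -/
theorem GrowthBound.sheetForm_loop (hB : GrowthBound L K ρ) {g m : ℕ} (hL : 2 * g + m + 1 ≤ L)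
    (hgm : (g, m) ≠ (0, 0)) {s : ℂ} {u : Fin m → ℂ} (hs : s ∈ sheet (1 / (2 * ρ)))
    (hu : ∀ i, u i ∈ sheet (1 / (2 * ρ))) (hne : ∀ j, s ≠ u j) (φ' : Fin m → ℂ)
    (hφ : ∀ j, HasDerivAt (fun x => kern x * sheetForm g _ (Fin.cons x (restr {j}ᶜ u)))
      (φ' j) (u j)) :
    recipLog s / recip s ^ 2 * sheetForm g (m + 1) (Fin.cons s u)
      = (if g = 0 then 0 else sheetForm (g - 1) (m + 2) (Fin.cons s (Fin.cons s u)))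
        + ∑ h ∈ Finset.HasAntidiagonal.antidiagonal g, ∑ I : Finset (Fin m),
            sheetForm h.1 (I.card + 1) (Fin.cons s (restr I u))
              * sheetForm h.2 (Iᶜ.card + 1) (Fin.cons s (restr Iᶜ u))
        + ∑ j, (sheetForm g _ (Fin.cons s (restr {j}ᶜ u))
              * (1 / (s - u j) ^ 2 - 1 / (s + u j) ^ 2)
            + residueTerm s (u j)
              (kern (u j) * sheetForm g _ (Fin.cons (u j) (restr {j}ᶜ u))) (φ' j) / kern s) := by
  have hs1 := sq_add_one_ne_zero hs.1
  have hs2 := sq_sub_one_ne_zero hs.2.1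
  have hψ := recipLog_ne_zero (ne_zero_of_re_neg hs.1) hs1 hs2
  have hy := hs.2.1
  have hprod : ∏ i, recipLog (u i) ≠ 0 := Finset.prod_ne_zero_iff.2 fun i _ =>
    recipLog_ne_zero (ne_zero_of_re_neg (hu i).1) (sq_add_one_ne_zero (hu i).1)
      (sq_sub_one_ne_zero (hu i).2.1)
  have hloop := genFun_loop hB hL hgm hs.2.2 (y := fun i => recip (u i)) (fun i => (hu i).2.2)
    (fun j h => hne j (recip_injOn hs.1 (hu j).1 h))
  rw [sheetForm_cons, hloop, mul_add, mul_add]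
  congr 1
  · rw [mul_add (recip s ^ 2), mul_add, mul_add]
    congr 1
    · split_ifs with hg
      · simp
      · rw [sheetForm_cons, comp_cons, Fin.prod_univ_succ]
        simp only [Fin.cons_zero, Fin.cons_succ, comp_cons]
        field_simp
    · simp only [Finset.mul_sum]
      refine Finset.sum_congr rfl fun h _ => Finset.sum_congr rfl fun I _ => ?_
      rw [sheetForm_cons, sheetForm_cons]
      have hI : ∏ i, recipLog (u i) = (∏ i, recipLog (restr I u i))
          * ∏ i, recipLog (restr Iᶜ u i) := by
        have h1 (J : Finset (Fin m)) : ∏ i, recipLog (restr J u i) = ∏ i ∈ J, recipLog (u i) :=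
          prod_restr J fun i => recipLog (u i)
        rw [h1, h1, Finset.prod_mul_prod_compl]
      rw [hI]
      simp only [restr_comp]
      field_simp
  · simp only [Finset.mul_sum]
    refine Finset.sum_congr rfl fun j _ => ?_
    have hj1 := sq_add_one_ne_zero (hu j).1
    have hj2 := sq_sub_one_ne_zero (hu j).2.1
    have hj0 := ne_zero_of_re_neg (hu j).1
    have hψj := recipLog_ne_zero hj0 hj1 hj2
    have hsub : u j - s ≠ 0 := sub_ne_zero.2 (hne j).symm
    have hadd : u j + s ≠ 0 := by
      intro h
      have := congrArg Complex.re h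
      simp only [Complex.add_re, Complex.zero_re] at this
      linarith [hs.1, (hu j).1]
    have hLj : 2 * g + ({j}ᶜ : Finset (Fin m)).card + 1 ≤ L := by
      rw [Finset.card_compl, Fintype.card_fin]; omega
    have hv := hB.hasDerivAt_sheetForm hLj (hu j) (u := restr {j}ᶜ u) fun i => hu _
    have hφj := (hφ j).unique ((hasDerivAt_kern hj0).fun_mul hv)
    have hI : ∏ i, recipLog (u i) = recipLog (u j) * ∏ i, recipLog (restr {j}ᶜ u i) := by
      have h1 : ∏ i, recipLog (restr {j}ᶜ u i) = ∏ i ∈ {j}ᶜ, recipLog (u i) :=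
        prod_restr {j}ᶜ fun i => recipLog (u i)
      rw [h1, ← Finset.prod_mul_prod_compl {j}, Finset.prod_singleton]
    rw [hφj, ← edgeTerm_eq hj0 hs1 hj1 hs2 hj2 hsub hadd, edgeTerm_mul, hI]
    simp only [sheetForm_cons, restr_comp]
    congr 2
    · field_simp
      ring
    · ring
    · ring

lemma kern_ne_zero {t : ℂ} (h0 : t ≠ 0) (h : t ^ 2 - 1 ≠ 0) : kern t ≠ 0 :=
  div_ne_zero (pow_ne_zero 3 h) (mul_ne_zero (by norm_num) (pow_ne_zero 2 h0))

lemma recipLog_div_sub_w01 {t : ℂ} (h0 : t ≠ 0) (_h : t ^ 2 + 1 ≠ 0) (h' : t ^ 2 - 1 ≠ 0) :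
    recipLog t / recip t ^ 2 - 2 * w01 t = -1 / kern t := by
  rw [w01_eq h']
  unfold recipLog recip kern
  field_simp
  ring

/-- The right-hand side of the recursion after evaluation of the contour integral; `φ' j` stands
for the derivative of `kern x * w (x, t_2, …, t_n without t_j)` at `x = t_j`. -/
noncomputable def evaluatedRecursion {m : ℕ} (w : (g n : ℕ) → (Fin n → ℂ) → ℂ)
    (g : ℕ) (s : ℂ) (u φ' : Fin m → ℂ) : ℂ :=
  -kern s * ((if g = 0 then 0 else w (g - 1) (m + 2) (Fin.cons s (Fin.cons s u)))
      + (∑ h ∈ Finset.HasAntidiagonal.antidiagonal g, ∑ I : Finset (Fin m),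
          if (h.1 = 0 ∧ I = ∅) ∨ (h.2 = 0 ∧ Iᶜ = ∅) then 0
          else w h.1 (I.card + 1) (Fin.cons s (restr I u))
            * w h.2 (Iᶜ.card + 1) (Fin.cons s (restr Iᶜ u)))
      + ∑ j, w g _ (Fin.cons s (restr {j}ᶜ u)) * (1 / (s - u j) ^ 2 - 1 / (s + u j) ^ 2))
    - ∑ j, residueTerm s (u j) (kern (u j) * w g _ (Fin.cons (u j) (restr {j}ᶜ u))) (φ' j)

/-- The loop equation solved for the differential of type `(g, m + 1)`: the terms of type `(0,1)`
are moved to the left hand side. -/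
theorem GrowthBound.sheetForm_recursion (hB : GrowthBound L K ρ) {g m : ℕ}
    (hL : 2 * g + m + 1 ≤ L)
    (hgm : (g, m) ≠ (0, 0)) {s : ℂ} {u : Fin m → ℂ} (hs : s ∈ sheet (1 / (2 * ρ)))
    (hu : ∀ i, u i ∈ sheet (1 / (2 * ρ))) (hne : ∀ j, s ≠ u j) (φ' : Fin m → ℂ)
    (hφ : ∀ j, HasDerivAt (fun x => kern x * sheetForm g _ (Fin.cons x (restr {j}ᶜ u)))
      (φ' j) (u j)) :
    sheetForm g (m + 1) (Fin.cons s u) = evaluatedRecursion sheetForm g s u φ' := by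
  unfold evaluatedRecursion
  have hs1 := sq_add_one_ne_zero hs.1
  have hs2 := sq_sub_one_ne_zero hs.2.1
  have hs0 := ne_zero_of_re_neg hs.1
  have hk := kern_ne_zero hs0 hs2
  have hloop := hB.sheetForm_loop hL hgm hs hu hne φ' hφ
  have h01 := hB.sheetForm_zero_one (by omega) hs
  have hsplit : (∑ h ∈ Finset.HasAntidiagonal.antidiagonal g, ∑ I : Finset (Fin m),
      sheetForm h.1 (I.card + 1) (Fin.cons s (restr I u))
        * sheetForm h.2 (Iᶜ.card + 1) (Fin.cons s (restr Iᶜ u)))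
      = (∑ h ∈ Finset.HasAntidiagonal.antidiagonal g, ∑ I : Finset (Fin m),
            if (h.1 = 0 ∧ I = ∅) ∨ (h.2 = 0 ∧ Iᶜ = ∅) then 0 else
            sheetForm h.1 (I.card + 1) (Fin.cons s (restr I u))
              * sheetForm h.2 (Iᶜ.card + 1) (Fin.cons s (restr Iᶜ u)))
        + w01 s * sheetForm g (m + 1) (Fin.cons s u)
        + w01 s * sheetForm g (m + 1) (Fin.cons s u) := by
    have e1 := sum_antidiagonal_ite_empty (m := m) g (w01 s * sheetForm g (m + 1) (Fin.cons s u))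
    have e2 := sum_antidiagonal_ite_compl_empty (m := m) g
      (w01 s * sheetForm g (m + 1) (Fin.cons s u))
    conv_rhs => rw [← e1]
    conv_rhs => enter [2]; rw [e1, ← e2]
    simp only [← Finset.sum_add_distrib]
    refine Finset.sum_congr rfl fun h hh => Finset.sum_congr rfl fun I _ => ?_
    rw [Finset.HasAntidiagonal.mem_antidiagonal] at hh
    obtain ⟨g₁, g₂⟩ := h
    simp only at hh ⊢
    by_cases hA : g₁ = 0 ∧ I = ∅
    · obtain ⟨rfl, rfl⟩ := hA
      rw [zero_add] at hh
      subst hh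
      have hB' : ¬(g₂ = 0 ∧ (∅ᶜ : Finset (Fin m)) = ∅) := by
        rintro ⟨rfl, h⟩
        have h2 := congrArg Finset.card h
        rw [Finset.card_compl, Fintype.card_fin, Finset.card_empty, Nat.sub_zero] at h2
        exact hgm (by rw [h2])
      rw [if_pos (Or.inl ⟨rfl, rfl⟩), if_pos ⟨rfl, rfl⟩, if_neg hB', Finset.compl_empty,
        apply_cons_restr_empty (sheetForm 0), apply_cons_restr_univ (sheetForm g₂), h01]
      ring
    · by_cases hJ : g₂ = 0 ∧ Iᶜ = ∅
      · obtain ⟨rfl, hJ⟩ := hJ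
        rw [add_zero] at hh
        subst hh
        obtain rfl : I = Finset.univ := by rwa [Finset.compl_eq_empty_iff] at hJ
        rw [if_pos (Or.inr ⟨rfl, hJ⟩), if_neg hA,
          if_pos (show 0 = 0 ∧ Finset.univᶜ = (∅ : Finset (Fin m)) from ⟨rfl, hJ⟩),
          Finset.compl_univ, apply_cons_restr_empty (sheetForm 0),
          apply_cons_restr_univ (sheetForm g₁), h01]
        ring
      · rw [if_neg (by tauto), if_neg hA, if_neg hJ]
        ring
  rw [hsplit] at hloop
  simp only [Finset.sum_add_distrib, ← Finset.sum_div] at hloop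
  have hcoef := recipLog_div_sub_w01 hs0 hs1 hs2
  generalize (∑ j, residueTerm s (u j)
    (kern (u j) * sheetForm g _ (Fin.cons (u j) (restr {j}ᶜ u))) (φ' j)) = Y at *
  rw [eq_div_iff hk] at hcoef
  have hY : kern s * (Y / kern s) = Y := mul_div_cancel₀ _ hk
  linear_combination sheetForm g (m + 1) (Fin.cons s u) * hcoef - kern s * hloop - hY

lemma eq_of_eventually_ne {f h : ℂ → ℂ} {b : ℂ} (hf : ContinuousAt f b) (hh : ContinuousAt h b)
    {U : Set ℂ} (hU : IsOpen U) (hb : b ∈ U) {m : ℕ} (u : Fin m → ℂ)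
    (heq : ∀ s ∈ U, (∀ j, s ≠ u j) → f s = h s) : f b = h b := by
  have hev : f =ᶠ[nhdsWithin b {b}ᶜ] h := by
    have hfin : (Set.range u \ {b}).Finite := (Set.finite_range u).subset Set.sdiff_subset
    have h1 : ∀ᶠ s in nhds b, s ∈ (Set.range u \ {b})ᶜ :=
      hfin.isClosed.isOpen_compl.mem_nhds fun h => h.2 rfl
    filter_upwards [nhdsWithin_le_nhds h1, nhdsWithin_le_nhds (hU.mem_nhds hb),
      self_mem_nhdsWithin] with s hs1 hs2 hs3
    refine heq s hs2 fun j hj => hs1 ⟨⟨j, hj.symm⟩, hs3⟩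
  exact tendsto_nhds_unique (hf.tendsto.mono_left nhdsWithin_le_nhds)
    ((hh.tendsto.mono_left nhdsWithin_le_nhds).congr' hev.symm)

/-- Type `(0,2)`. -/
lemma GrowthBound.sheetForm_zero_two (hB : GrowthBound L K ρ) (hL : 2 ≤ L) {s b : ℂ}
    (hs : s ∈ sheet (1 / (2 * ρ))) (hb : b ∈ sheet (1 / (2 * ρ))) :
    sheetForm 0 2 ![s, b] = w02 s b := by
  have hu : ∀ i : Fin 1, (![b] : Fin 1 → ℂ) i ∈ sheet (1 / (2 * ρ)) := fun i => by
    rw [Subsingleton.elim (α := Fin 1) i 0]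
    exact hb
  have hb0 := ne_zero_of_re_neg hb.1
  have hb1 := sq_add_one_ne_zero hb.1
  have hb2 := sq_sub_one_ne_zero hb.2.1
  obtain ⟨hb3, hb4⟩ := sub_one_mul_add_one_ne hb2
  have hadd : ∀ {s : ℂ}, s ∈ sheet (1 / (2 * ρ)) → s + b ≠ 0 := by
    intro s hs h
    have := congrArg Complex.re h
    simp only [Complex.add_re, Complex.zero_re] at this
    linarith [hs.1, hb.1]
  have hcompl : ({0}ᶜ : Finset (Fin 1)) = ∅ := rfl
  refine eq_of_eventually_ne (f := fun s => sheetForm 0 2 ![s, b]) (h := fun s => w02 s b)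
    (hB.hasDerivAt_sheetForm (g := 0) (m := 1) (by omega) hs hu).continuousAt ?_
    (isOpen_sheet _) hs ![b] ?_
  · unfold w02
    exact ContinuousAt.div (by fun_prop) (by fun_prop) (pow_ne_zero 2 (hadd hs))
  · intro s hs hne
    have hs0 := ne_zero_of_re_neg hs.1
    have hs1 := sq_add_one_ne_zero hs.1
    have hs2 := sq_sub_one_ne_zero hs.2.1
    obtain ⟨hs3, hs4⟩ := sub_one_mul_add_one_ne hs2
    have hsb : s - b ≠ 0 := sub_ne_zero.2 (hne 0)
    have hsb' := hadd hs
    have hw : ∀ x ∈ sheet (1 / (2 * ρ)), kern x * sheetForm 0 _ (Fin.cons x (restr {0}ᶜ ![b]))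
        = (x + 1) ^ 2 / (4 * x) := by
      intro x hx
      have hx0 := ne_zero_of_re_neg hx.1
      have hx2 := sq_sub_one_ne_zero hx.2.1
      rw [hcompl, apply_cons_restr_empty (sheetForm 0), hB.sheetForm_zero_one (by omega) hx,
        w01_eq hx2]
      unfold kern
      field_simp
      ring
    have hder : HasDerivAt (fun x : ℂ => (x + 1) ^ 2 / (4 * x)) ((b ^ 2 - 1) / (4 * b ^ 2)) b := by
      have h1 : HasDerivAt (fun t : ℂ => (t + 1) ^ 2) (2 * (b + 1)) b := by
        simpa using ((hasDerivAt_id b).add_const 1).fun_pow 2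
      have h2 : HasDerivAt (fun t : ℂ => 4 * t) 4 b := by
        simpa using (hasDerivAt_id b).const_mul 4
      convert! h1.div h2 (mul_ne_zero (by norm_num) hb0) using 1
      field_simp
      ring
    have hrec := hB.sheetForm_recursion (g := 0) (m := 1) (by omega) (by simp) hs hu hne
      (fun _ => (b ^ 2 - 1) / (4 * b ^ 2)) (fun j => by
        rw [Subsingleton.elim (α := Fin 1) j 0]
        refine hder.congr_of_eventuallyEq ?_
        filter_upwards [(isOpen_sheet _).mem_nhds hb] with x hx using hw x hx)
    change sheetForm 0 2 ![s, b] = _ at hrec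
    unfold evaluatedRecursion at hrec
    have hI : ∀ I : Finset (Fin 1), I = ∅ ∨ Iᶜ = ∅ := by decide
    simp only [Fin.sum_univ_one, Matrix.cons_val_zero, hw b hb, if_true] at hrec
    rw [hrec, Finset.Nat.antidiagonal_zero, Finset.sum_singleton,
      Finset.sum_eq_zero (fun I _ => if_pos ((hI I).imp (⟨rfl, ·⟩) (⟨rfl, ·⟩))),
      hcompl, apply_cons_restr_empty (sheetForm 0), hB.sheetForm_zero_one (by omega) hs,
      w01_eq hs2]
    unfold residueTerm kern w02
    rw [show b ^ 2 - s ^ 2 = (s - b) * -(s + b) by ring]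
    have : s ^ 2 - 1 ≠ 0 := hs2
    field_simp
    ring

end Loop

/-! ### Even Laurent polynomials -/

section EvenLaurent

/-- Functions which agree, where all coordinates are nonzero, with a Laurent polynomial in the
squares of the coordinates. The inductive form gives an induction over monomials and sums. -/
inductive EvenLaurent {n : ℕ} : ((Fin n → ℂ) → ℂ) → Prop
  | mono (c : ℂ) (κ : Fin n → ℤ) : EvenLaurent fun t => c * ∏ i, (t i ^ 2) ^ κ i
  | add {f g : (Fin n → ℂ) → ℂ} : EvenLaurent f → EvenLaurent g → EvenLaurent fun t => f t + g t
  | congr {f g : (Fin n → ℂ) → ℂ} : EvenLaurent f →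
      (∀ t : Fin n → ℂ, (∀ i, t i ≠ 0) → f t = g t) → EvenLaurent g

namespace EvenLaurent

variable {n m : ℕ} {f g : (Fin n → ℂ) → ℂ}

lemma const (c : ℂ) : EvenLaurent fun _ : Fin n → ℂ => c :=
  (mono c 0).congr fun t _ => by simp

lemma coord (i : Fin n) (k : ℤ) : EvenLaurent fun t : Fin n → ℂ => (t i ^ 2) ^ k :=
  (mono 1 (Pi.single i k)).congr fun t _ => by
    rw [one_mul, Finset.prod_eq_single i]
    · simp
    · intro j _ hj
      simp [Pi.single_eq_of_ne hj]
    · simp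

lemma mul (hf : EvenLaurent f) (hg : EvenLaurent g) : EvenLaurent fun t => f t * g t := by
  induction hf generalizing g with
  | mono c κ =>
    induction hg with
    | mono d ν =>
      refine (mono (c * d) (κ + ν)).congr fun t ht => ?_
      simp only [Pi.add_apply, zpow_add₀ (pow_ne_zero 2 (ht _)), Finset.prod_mul_distrib]
      ring
    | add _ _ h1 h2 => exact (h1.add h2).congr fun t _ => by ring
    | congr _ h h1 => exact h1.congr fun t ht => by rw [h t ht]
  | add _ _ h1 h2 => exact ((h1 hg).add (h2 hg)).congr fun t _ => by ring
  | congr _ h h1 => exact (h1 hg).congr fun t ht => by rw [h t ht]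

lemma const_mul (hf : EvenLaurent f) (c : ℂ) : EvenLaurent fun t => c * f t := (const c).mul hf

lemma neg (hf : EvenLaurent f) : EvenLaurent fun t => -f t :=
  (hf.const_mul (-1)).congr fun t _ => by ring

lemma sum {ι : Type*} (s : Finset ι) {F : ι → (Fin n → ℂ) → ℂ} (h : ∀ i ∈ s, EvenLaurent (F i)) :
    EvenLaurent fun t => ∑ i ∈ s, F i t := by
  classical
  induction s using Finset.induction_on with
  | empty => simpa using const 0
  | insert i s hi ih =>
    refine ((h i (Finset.mem_insert_self i s)).add
      (ih fun j hj => h j (Finset.mem_insert_of_mem hj))).congr fun t _ => ?_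
    rw [Finset.sum_insert hi]

lemma prod {ι : Type*} (s : Finset ι) {F : ι → (Fin n → ℂ) → ℂ} (h : ∀ i ∈ s, EvenLaurent (F i)) :
    EvenLaurent fun t => ∏ i ∈ s, F i t := by
  classical
  induction s using Finset.induction_on with
  | empty => simpa using const 1
  | insert i s hi ih =>
    refine ((h i (Finset.mem_insert_self i s)).mul
      (ih fun j hj => h j (Finset.mem_insert_of_mem hj))).congr fun t _ => ?_
    rw [Finset.prod_insert hi]

lemma comp (hf : EvenLaurent f) (σ : Fin n → Fin m) :
    EvenLaurent fun t : Fin m → ℂ => f fun i => t (σ i) := by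
  induction hf with
  | mono c κ => exact (prod _ fun i _ => coord (σ i) (κ i)).const_mul c
  | add _ _ h1 h2 => exact h1.add h2
  | congr _ h h1 => exact h1.congr fun t ht => h _ fun i => ht _

/-- Even Laurent polynomials take the same values at tuples with the same squares. -/
lemma eq_of_sq_eq (hf : EvenLaurent f) {t u : Fin n → ℂ} (ht : ∀ i, t i ≠ 0) (hu : ∀ i, u i ≠ 0)
    (h : ∀ i, t i ^ 2 = u i ^ 2) : f t = f u := by
  induction hf with
  | mono c κ => simp only [h]
  | add _ _ h1 h2 => exact congrArg₂ (· + ·) h1 h2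
  | congr _ hfg h1 => rw [← hfg t ht, ← hfg u hu, h1]

lemma exists_hasDerivAt {f : (Fin (n + 1) → ℂ) → ℂ} (hf : EvenLaurent f) {x : ℂ} {u : Fin n → ℂ}
    (hx : x ≠ 0) (hu : ∀ i, u i ≠ 0) : ∃ D, HasDerivAt (fun s => f (Fin.cons s u)) D x := by
  induction hf with
  | mono c κ =>
    refine ⟨_, DifferentiableAt.hasDerivAt ?_⟩
    simp only [Fin.prod_univ_succ, Fin.cons_zero, Fin.cons_succ]
    refine (DifferentiableAt.mul_const ?_ _).const_mul c
    exact DifferentiableAt.zpow (by fun_prop) (Or.inl (pow_ne_zero 2 hx))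
  | add _ _ h1 h2 =>
    obtain ⟨D, hD⟩ := h1
    obtain ⟨E, hE⟩ := h2
    exact ⟨_, hD.fun_add hE⟩
  | congr _ h h1 =>
    obtain ⟨D, hD⟩ := h1
    refine ⟨D, hD.congr_of_eventuallyEq ?_⟩
    filter_upwards [isOpen_compl_singleton.mem_nhds hx] with s hs
    exact (h _ fun i => by exact Fin.cases hs hu i).symm

lemma isEvenLaurent (hf : EvenLaurent f) : IsEvenLaurent f := by
  have hden : ∀ (N : ℕ) (t : Fin n → ℂ), (∀ i, t i ≠ 0) → ∏ i, (t i ^ 2) ^ N ≠ 0 :=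
    fun N t ht => Finset.prod_ne_zero_iff.2 fun i _ => pow_ne_zero _ (pow_ne_zero _ (ht i))
  induction hf with
  | mono c κ =>
    set N : ℕ := ∑ i, (κ i).natAbs with hN
    refine ⟨MvPolynomial.C c * ∏ i, MvPolynomial.X i ^ (κ i + N).toNat, N, fun t ht => ?_⟩
    rw [eq_div_iff (hden N t ht), mul_assoc, ← Finset.prod_mul_distrib]
    simp only [map_mul, MvPolynomial.eval_C, map_prod, map_pow, MvPolynomial.eval_X]
    congr 1
    refine Finset.prod_congr rfl fun i _ => ?_
    have hi : (κ i).natAbs ≤ N := Finset.single_le_sum (f := fun i => (κ i).natAbs)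
      (fun _ _ => Nat.zero_le _) (Finset.mem_univ i)
    rw [← zpow_natCast (t i ^ 2) N, ← zpow_add₀ (pow_ne_zero 2 (ht i)),
      ← zpow_natCast (t i ^ 2) (κ i + N).toNat, Int.toNat_of_nonneg (by omega)]
  | add _ _ h1 h2 =>
    obtain ⟨P, N, h1⟩ := h1
    obtain ⟨Q, M, h2⟩ := h2
    refine ⟨P * ∏ i, MvPolynomial.X i ^ M + Q * ∏ i, MvPolynomial.X i ^ N, N + M, fun t ht => ?_⟩
    beta_reduce
    rw [h1 t ht, h2 t ht, div_add_div _ _ (hden N t ht) (hden M t ht)]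
    simp only [map_add, map_mul, map_prod, map_pow, MvPolynomial.eval_X, pow_add _ N M,
      Finset.prod_mul_distrib]
    ring
  | congr _ h h1 =>
    obtain ⟨P, N, h1⟩ := h1
    exact ⟨P, N, fun t ht => by rw [← h t ht, h1 t ht]⟩

end EvenLaurent

end EvenLaurent

/-! ### The contour integral of the recursion -/

section Contour

open Complex

/-- The integral of `f` over the contour consisting of the circle `|s| = ε` and the negatively
oriented circle `|s| = 1 / ε` exists and is `2πi` times `v`. -/
structure HasContour (ε : ℝ) (f : ℂ → ℂ) (v : ℂ) : Prop where
  int : CircleIntegrable f 0 ε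
  int' : CircleIntegrable f 0 (1 / ε)
  eq : (2 * Real.pi * I)⁻¹ * ((∮ s in C(0, ε), f s) - ∮ s in C(0, 1 / ε), f s) = v

/-- The point `w` lies in the annulus bounded by the contour. -/
def Between (ε : ℝ) (w : ℂ) : Prop := ε < ‖w‖ ∧ ‖w‖ < 1 / ε

variable {ε : ℝ} {f g : ℂ → ℂ} {v w : ℂ}

lemma Between.ne_zero (hε : 0 < ε) (h : Between ε w) : w ≠ 0 :=
  norm_pos_iff.1 (hε.trans h.1)

lemma Between.neg (h : Between ε w) : Between ε (-w) := by
  unfold Between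
  rwa [norm_neg]

/-- The points of the contour. -/
def contour (ε : ℝ) : Set ℂ := Metric.sphere 0 ε ∪ Metric.sphere 0 (1 / ε)

lemma ne_zero_of_mem_contour (hε : 0 < ε) {s : ℂ} (hs : s ∈ contour ε) : s ≠ 0 := by
  rintro rfl
  have h1 := one_div_pos.2 hε
  rcases hs with hs | hs <;> rw [mem_sphere_zero_iff_norm, norm_zero] at hs <;> linarith

lemma Between.sub_ne_zero (h : Between ε w) {s : ℂ} (hs : s ∈ contour ε) : s - w ≠ 0 := by
  intro h0
  rw [sub_eq_zero.1 h0] at hs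
  rcases hs with hs | hs <;> rw [mem_sphere_zero_iff_norm] at hs <;> linarith [h.1, h.2]

lemma Between.add_ne_zero (h : Between ε w) {s : ℂ} (hs : s ∈ contour ε) : s + w ≠ 0 := by
  have := h.neg.sub_ne_zero hs
  rwa [sub_neg_eq_add] at this

lemma Between.sq_sub_sq_ne_zero (h : Between ε w) {s : ℂ} (hs : s ∈ contour ε) :
    s ^ 2 - w ^ 2 ≠ 0 := by
  rw [sq_sub_sq]
  exact mul_ne_zero (h.add_ne_zero hs) (h.sub_ne_zero hs)

namespace HasContour

lemma congr (hε : 0 < ε) (h : HasContour ε f v) (hfg : ∀ s ∈ contour ε, f s = g s) :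
    HasContour ε g v := by
  have hε' := one_div_pos.2 hε
  have h1 : Set.EqOn f g (Metric.sphere 0 ε) := fun s hs => hfg s (Or.inl hs)
  have h2 : Set.EqOn f g (Metric.sphere 0 (1 / ε)) := fun s hs => hfg s (Or.inr hs)
  refine ⟨(circleIntegrable_congr (by rwa [abs_of_pos hε])).1 h.int,
    (circleIntegrable_congr (by rwa [abs_of_pos hε'])).1 h.int', ?_⟩
  rw [← circleIntegral.integral_congr hε.le h1, ← circleIntegral.integral_congr hε'.le h2, h.eq]

lemma add {u : ℂ} (hf : HasContour ε f v) (hg : HasContour ε g u) :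
    HasContour ε (fun s => f s + g s) (v + u) := by
  refine ⟨hf.int.add hg.int, hf.int'.add hg.int', ?_⟩
  rw [circleIntegral.integral_add hf.int hg.int, circleIntegral.integral_add hf.int' hg.int',
    ← hf.eq, ← hg.eq]
  ring

lemma const_mul (hf : HasContour ε f v) (c : ℂ) : HasContour ε (fun s => c * f s) (c * v) := by
  refine ⟨hf.int.const_fun_smul (a := c), hf.int'.const_fun_smul (a := c), ?_⟩
  rw [circleIntegral.integral_const_mul, circleIntegral.integral_const_mul, ← hf.eq]
  ring

lemma zero : HasContour ε (fun _ => 0) 0 :=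
  ⟨circleIntegrable_const 0 _ _, circleIntegrable_const 0 _ _, by simp [circleIntegral]⟩

lemma sum {ι : Type*} (s : Finset ι) {F : ι → ℂ → ℂ} {V : ι → ℂ}
    (h : ∀ i ∈ s, HasContour ε (F i) (V i)) :
    HasContour ε (fun x => ∑ i ∈ s, F i x) (∑ i ∈ s, V i) := by
  classical
  induction s using Finset.induction_on with
  | empty => simpa using zero
  | insert i s hi ih =>
    simp only [Finset.sum_insert hi]
    exact (h i (Finset.mem_insert_self i s)).add
      (ih fun j hj => h j (Finset.mem_insert_of_mem hj))

lemma of_hasDerivAt (hε : 0 < ε) (hf : ContinuousOn f (contour ε)) {F : ℂ → ℂ}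
    (hF : ∀ s ∈ contour ε, HasDerivAt F (f s) s) : HasContour ε f 0 := by
  have hε' := one_div_pos.2 hε
  refine ⟨(hf.mono Set.subset_union_left).circleIntegrable hε.le,
    (hf.mono Set.subset_union_right).circleIntegrable hε'.le, ?_⟩
  rw [circleIntegral.integral_eq_zero_of_hasDerivWithinAt hε.le
      (fun s hs => (hF s (Or.inl hs)).hasDerivWithinAt),
    circleIntegral.integral_eq_zero_of_hasDerivWithinAt hε'.le
      (fun s hs => (hF s (Or.inr hs)).hasDerivWithinAt), sub_zero, mul_zero]

lemma two_pi_I_ne : (2 * Real.pi * I : ℂ) ≠ 0 := by simp [Real.pi_ne_zero]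

lemma zpow (hε : 0 < ε) (k : ℤ) : HasContour ε (fun s => s ^ k) 0 := by
  have hε' := one_div_pos.2 hε
  have hc : ContinuousOn (fun s : ℂ => s ^ k) (contour ε) := fun s hs =>
    (continuousAt_zpow₀ s k (Or.inl (ne_zero_of_mem_contour hε hs))).continuousWithinAt
  refine ⟨(hc.mono Set.subset_union_left).circleIntegrable hε.le,
    (hc.mono Set.subset_union_right).circleIntegrable hε'.le, ?_⟩
  by_cases hk : k = -1
  · subst hk
    have h1 := circleIntegral.integral_sub_center_inv (0 : ℂ) hε.ne'
    have h2 := circleIntegral.integral_sub_center_inv (0 : ℂ) hε'.ne'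
    simp only [sub_zero] at h1 h2
    simp only [zpow_neg_one]
    rw [h1, h2, sub_self, mul_zero]
  · have h1 := circleIntegral.integral_sub_zpow_of_ne hk 0 0 ε
    have h2 := circleIntegral.integral_sub_zpow_of_ne hk 0 0 (1 / ε)
    simp only [sub_zero] at h1 h2
    rw [h1, h2, sub_self, mul_zero]

/-- A simple pole between the two circles is encircled only by the outer one. -/
lemma inv_sub (hε : 0 < ε) (hw : Between ε w) : HasContour ε (fun s => (s - w)⁻¹) (-1) := by
  have hε' := one_div_pos.2 hε
  have hc : ContinuousOn (fun s : ℂ => (s - w)⁻¹) (contour ε) :=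
    ContinuousOn.inv₀ (by fun_prop) fun s hs => hw.sub_ne_zero hs
  refine ⟨(hc.mono Set.subset_union_left).circleIntegrable hε.le,
    (hc.mono Set.subset_union_right).circleIntegrable hε'.le, ?_⟩
  have h1 : (∮ s in C(0, ε), (s - w)⁻¹) = 0 := by
    refine DiffContOnCl.circleIntegral_eq_zero hε.le (DifferentiableOn.diffContOnCl ?_)
    rw [closure_ball _ hε.ne']
    refine DifferentiableOn.inv (by fun_prop) fun s hs h0 => ?_
    rw [sub_eq_zero.1 h0, mem_closedBall_zero_iff] at hs
    linarith [hw.1]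
  rw [h1, circleIntegral.integral_sub_inv_of_mem_ball (by
    rw [mem_ball_zero_iff]; exact hw.2), zero_sub, mul_neg, inv_mul_cancel₀ two_pi_I_ne]

lemma inv_sub_sq (hε : 0 < ε) (hw : Between ε w) : HasContour ε (fun s => 1 / (s - w) ^ 2) 0 := by
  refine of_hasDerivAt hε (F := fun s => -(s - w)⁻¹) ?_ fun s hs => ?_
  · exact ContinuousOn.div (by fun_prop) (by fun_prop) fun s hs => pow_ne_zero 2 (hw.sub_ne_zero hs)
  · have := (((hasDerivAt_id s).sub_const w).fun_inv (hw.sub_ne_zero hs)).fun_neg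
    convert! this using 1
    simp [neg_div]

lemma unique {v' : ℂ} (h : HasContour ε f v) (h' : HasContour ε f v') : v = v' :=
  h.eq.symm.trans h'.eq

/-- Contour integrals of the functions `s ^ (2 k + 1) q(s)`, where `q` has the pole `s² = a`, are
found from one of them by the recursion `s² = a + (s² - a)`. -/
lemma of_recursion (hε : 0 < ε) {a : ℂ} (ha : a ≠ 0) {F H : ℤ → ℂ → ℂ} {V E : ℤ → ℂ}
    (hF : ∀ k, ∀ s ∈ contour ε, F (k + 1) s = H k s + a * F k s)
    (hH : ∀ k, HasContour ε (H k) (E k)) (hV : ∀ k, V (k + 1) = E k + a * V k)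
    (h0 : HasContour ε (F 0) (V 0)) (k : ℤ) : HasContour ε (F k) (V k) := by
  induction k with
  | zero => exact h0
  | succ k ih =>
    rw [hV]
    exact ((hH k).add (ih.const_mul a)).congr hε fun s hs => (hF k s hs).symm
  | pred k ih =>
    have h1 := hV (-(k : ℤ) - 1)
    rw [sub_add_cancel] at h1
    have h2 : V (-(k : ℤ) - 1) = a⁻¹ * (V (-k) + (-1) * E (-(k : ℤ) - 1)) := by
      rw [h1]
      field_simp
      ring
    rw [h2]
    refine ((ih.add ((hH _).const_mul (-1))).const_mul a⁻¹).congr hε fun s hs => ?_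
    have h3 := hF (-(k : ℤ) - 1) s hs
    rw [sub_add_cancel] at h3
    rw [h3]
    field_simp
    ring

lemma simple_pole (hε : 0 < ε) (hw : Between ε w) (k : ℤ) :
    HasContour ε (fun s => s * (s ^ 2) ^ k / (s ^ 2 - w ^ 2)) (-(w ^ 2) ^ k) := by
  have hw0 := hw.ne_zero hε
  have hsq : w ^ 2 ≠ 0 := pow_ne_zero 2 hw0
  refine of_recursion hε hsq (F := fun k s => s * (s ^ 2) ^ k / (s ^ 2 - w ^ 2))
    (V := fun k => -(w ^ 2) ^ k) (H := fun k s => s * (s ^ 2) ^ k) (E := fun _ => 0) ?_ ?_ ?_ ?_ k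
  · intro k s hs
    have h1 := hw.sq_sub_sq_ne_zero hs
    simp only [zpow_add_one₀ (pow_ne_zero 2 (ne_zero_of_mem_contour hε hs))]
    field_simp
    ring
  · intro k
    refine (zpow hε (2 * k + 1)).congr hε fun s hs => ?_
    rw [zpow_add_one₀ (ne_zero_of_mem_contour hε hs), zpow_mul]
    norm_cast
    rw [mul_comm]
  · intro k
    simp only [zpow_add_one₀ hsq]
    ring
  · have h := ((inv_sub hε hw).add (inv_sub hε hw.neg)).const_mul (1 / 2)
    rw [show (1 / 2 : ℂ) * (-1 + -1) = -(w ^ 2) ^ (0 : ℤ) by norm_num] at h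
    refine h.congr hε fun s hs => ?_
    have h1 := hw.sub_ne_zero hs
    have h2 := hw.add_ne_zero hs
    rw [sub_neg_eq_add, sq_sub_sq, zpow_zero]
    field_simp
    ring

lemma double_pole (hε : 0 < ε) (hw : Between ε w) (k : ℤ) :
    HasContour ε (fun s => s * (s ^ 2) ^ k / (s ^ 2 - w ^ 2) ^ 2) (-k * (w ^ 2) ^ (k - 1)) := by
  have hw0 := hw.ne_zero hε
  have hsq : w ^ 2 ≠ 0 := pow_ne_zero 2 hw0
  refine of_recursion hε hsq (F := fun k s => s * (s ^ 2) ^ k / (s ^ 2 - w ^ 2) ^ 2)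
    (V := fun k => -k * (w ^ 2) ^ (k - 1)) (H := fun k s => s * (s ^ 2) ^ k / (s ^ 2 - w ^ 2))
    (E := fun k => -(w ^ 2) ^ k) ?_ (simple_pole hε hw) ?_ ?_ k
  · intro k s hs
    have h1 := hw.sq_sub_sq_ne_zero hs
    simp only [zpow_add_one₀ (pow_ne_zero 2 (ne_zero_of_mem_contour hε hs))]
    field_simp
    ring
  · intro k
    simp only [zpow_sub_one₀ hsq, zpow_add_one₀ hsq]
    push_cast
    field_simp
    ring
  · have h := ((inv_sub_sq hε hw).add ((inv_sub_sq hε hw.neg).const_mul (-1))).const_mul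
      (1 / (4 * w))
    rw [show (1 / (4 * w) : ℂ) * (0 + -1 * 0) = -((0 : ℤ) : ℂ) * (w ^ 2) ^ ((0 : ℤ) - 1) by
      simp] at h
    refine h.congr hε fun s hs => ?_
    have h1 := hw.sub_ne_zero hs
    have h2 := hw.add_ne_zero hs
    rw [sub_neg_eq_add, sq_sub_sq, zpow_zero]
    field_simp
    ring

variable {u : ℂ}

lemma mixed_pole_of_ne (hε : 0 < ε) (hw : Between ε w) (hu : Between ε u) (hne : w ^ 2 ≠ u ^ 2)
    (k : ℤ) :
    HasContour ε (fun s => s * (s ^ 2) ^ k / ((s ^ 2 - w ^ 2) * (s ^ 2 - u ^ 2) ^ 2))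
      ((-(w ^ 2) ^ k + (u ^ 2) ^ k) / (w ^ 2 - u ^ 2) ^ 2
        + k * (u ^ 2) ^ (k - 1) / (w ^ 2 - u ^ 2)) := by
  have hsub : w ^ 2 - u ^ 2 ≠ 0 := sub_ne_zero.2 hne
  have h := (((simple_pole hε hw k).add ((simple_pole hε hu k).const_mul (-1))).const_mul
    (1 / (w ^ 2 - u ^ 2) ^ 2)).add ((double_pole hε hu k).const_mul (-1 / (w ^ 2 - u ^ 2)))
  convert! h.congr hε fun s hs => ?_ using 1
  · ring
  · have h1 := hw.sq_sub_sq_ne_zero hs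
    have h2 := hu.sq_sub_sq_ne_zero hs
    field_simp
    ring

/-- The integral is a Laurent polynomial in `w²`, `u²`, also on the diagonal `w² = u²`. -/
lemma exists_mixed_pole (k : ℤ) : ∃ p : (Fin 2 → ℂ) → ℂ, EvenLaurent p ∧
    ∀ (ε : ℝ) (w u : ℂ), 0 < ε → Between ε w → Between ε u →
      HasContour ε (fun s => s * (s ^ 2) ^ k / ((s ^ 2 - w ^ 2) * (s ^ 2 - u ^ 2) ^ 2))
        (p ![w, u]) := by
  have hstep (k : ℤ) {ε : ℝ} {w u s : ℂ} (hε : 0 < ε) (hw : Between ε w) (hu : Between ε u)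
      (hs : s ∈ contour ε) :
      s * (s ^ 2) ^ (k + 1) / ((s ^ 2 - w ^ 2) * (s ^ 2 - u ^ 2) ^ 2)
        = s * (s ^ 2) ^ k / (s ^ 2 - u ^ 2) ^ 2
          + w ^ 2 * (s * (s ^ 2) ^ k / ((s ^ 2 - w ^ 2) * (s ^ 2 - u ^ 2) ^ 2)) := by
    have h1 := hw.sq_sub_sq_ne_zero hs
    have h2 := hu.sq_sub_sq_ne_zero hs
    rw [zpow_add_one₀ (pow_ne_zero 2 (ne_zero_of_mem_contour hε hs))]
    field_simp
    ring
  induction k with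
  | zero =>
    refine ⟨fun _ => 0, EvenLaurent.const 0, fun ε w u hε hw hu => ?_⟩
    by_cases hne : w ^ 2 = u ^ 2
    · refine of_hasDerivAt hε (F := fun s => -(1 / 4) * ((s ^ 2 - u ^ 2) ^ 2)⁻¹) ?_ fun s hs => ?_
      · refine ContinuousOn.div (by simp; fun_prop) (by fun_prop) fun s hs =>
          mul_ne_zero (hw.sq_sub_sq_ne_zero hs) (pow_ne_zero 2 (hu.sq_sub_sq_ne_zero hs))
      · have h2 := hu.sq_sub_sq_ne_zero hs
        have h3 : HasDerivAt (fun s : ℂ => (s ^ 2 - u ^ 2) ^ 2)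
            (2 * (s ^ 2 - u ^ 2) * (2 * s)) s := by
          simpa using ((hasDerivAt_pow 2 s).sub_const (u ^ 2)).fun_pow 2
        convert! (h3.fun_inv (pow_ne_zero 2 h2)).const_mul (-(1 / 4)) using 1
        rw [hne, zpow_zero]
        field_simp
        norm_num
    · convert! mixed_pole_of_ne hε hw hu hne 0 using 1
      simp
  | succ k ih =>
    obtain ⟨p, hp, h⟩ := ih
    refine ⟨fun t => -((k : ℤ) : ℂ) * (t 1 ^ 2) ^ ((k : ℤ) - 1) + (t 0 ^ 2) ^ (1 : ℤ) * p t,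
      ((EvenLaurent.coord 1 _).const_mul _).add ((EvenLaurent.coord 0 1).mul hp),
      fun ε w u hε hw hu => ?_⟩
    beta_reduce
    rw [zpow_one]
    exact ((double_pole hε hu k).add ((h ε w u hε hw hu).const_mul (w ^ 2))).congr hε
      fun s hs => (hstep k hε hw hu hs).symm
  | pred k ih =>
    obtain ⟨p, hp, h⟩ := ih
    refine ⟨fun t => (t 0 ^ 2) ^ (-1 : ℤ) * (p t + ((-(k : ℤ) - 1 : ℤ) : ℂ)
        * (t 1 ^ 2) ^ (-(k : ℤ) - 1 - 1)),
      (EvenLaurent.coord 0 _).mul (hp.add ((EvenLaurent.coord 1 _).const_mul _)),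
      fun ε w u hε hw hu => ?_⟩
    have hw0 := hw.ne_zero hε
    have h1 := ((h ε w u hε hw hu).add
      ((double_pole hε hu (-(k : ℤ) - 1)).const_mul (-1))).const_mul ((w ^ 2)⁻¹)
    convert! h1.congr hε fun s hs => ?_ using 1
    · beta_reduce
      rw [zpow_neg_one]
      simp only [Matrix.cons_val_zero, Matrix.cons_val_one]
      ring
    · have h2 := hstep (-(k : ℤ) - 1) hε hw hu hs
      rw [sub_add_cancel] at h2
      rw [h2]
      have hcancel (A B : ℂ) : (w ^ 2)⁻¹ * (A + w ^ 2 * B + -1 * A) = B := by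
        field_simp
        ring
      exact hcancel _ _

end HasContour

namespace EvenLaurent

variable {m : ℕ} {φ : (Fin (m + 1) → ℂ) → ℂ}

lemma prod_cons_tail (κ : Fin (m + 1) → ℤ) (s : ℂ) (t : Fin (m + 1) → ℂ) :
    ∏ i, ((Fin.cons s (Fin.tail t) : Fin (m + 1) → ℂ) i ^ 2) ^ κ i
      = (s ^ 2) ^ κ 0 * ∏ i : Fin m, (t i.succ ^ 2) ^ κ i.succ := by
  rw [Fin.prod_univ_succ]
  rfl

lemma hasContour_simple (hφ : EvenLaurent φ) {ε : ℝ} (hε : 0 < ε) {t : Fin (m + 1) → ℂ}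
    (ht : ∀ i, Between ε (t i)) :
    HasContour ε (fun s => s / (s ^ 2 - t 0 ^ 2) * φ (Fin.cons s (Fin.tail t))) (-φ t) := by
  induction hφ with
  | mono c κ =>
    convert! ((HasContour.simple_pole hε (ht 0) (κ 0)).const_mul
      (c * ∏ i : Fin m, (t i.succ ^ 2) ^ κ i.succ)) using 1
    · funext s
      beta_reduce
      rw [prod_cons_tail]
      ring
    · beta_reduce
      rw [Fin.prod_univ_succ]
      ring
  | add _ _ h1 h2 =>
    convert! h1.add h2 using 1
    · funext s
      ring
    · ring
  | congr _ h h1 =>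
    rw [← h t fun i => (ht i).ne_zero hε]
    refine h1.congr hε fun s hs => ?_
    rw [h]
    exact fun i => Fin.cases (ne_zero_of_mem_contour hε hs) (fun i => (ht i.succ).ne_zero hε) i

/-- The integral against the double poles at `± t_j` is an even Laurent polynomial; away from the
diagonals it is the sum of the contributions of the poles at `± t_0` and `± t_j`. -/
lemma exists_hasContour_double (hφ : EvenLaurent φ) (j : Fin m) :
    ∃ p : (Fin (m + 1) → ℂ) → ℂ, EvenLaurent p ∧
      ∀ (ε : ℝ) (t : Fin (m + 1) → ℂ), 0 < ε → (∀ i, Between ε (t i)) →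
        HasContour ε (fun s => s / (s ^ 2 - t 0 ^ 2)
          * (2 * (s ^ 2 + t j.succ ^ 2) / (s ^ 2 - t j.succ ^ 2) ^ 2
            * φ (Fin.cons s (Fin.tail t)))) (p t) ∧
        (t 0 ^ 2 ≠ t j.succ ^ 2 → ∀ φ', HasDerivAt (fun x => φ (Fin.cons x (Fin.tail t))) φ'
            (t j.succ) →
          p t = -φ t * (2 * (t 0 ^ 2 + t j.succ ^ 2) / (t 0 ^ 2 - t j.succ ^ 2) ^ 2)
            - residueTerm (t 0) (t j.succ) (φ (Fin.cons (t j.succ) (Fin.tail t))) φ') := by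
  induction hφ with
  | mono c κ =>
    obtain ⟨p, hp, h⟩ := HasContour.exists_mixed_pole (κ 0)
    obtain ⟨q, hq, h'⟩ := HasContour.exists_mixed_pole (κ 0 + 1)
    let σ : Fin 2 → Fin (m + 1) := ![0, j.succ]
    have hσ (t : Fin (m + 1) → ℂ) : (fun i => t (σ i)) = ![t 0, t j.succ] := by
      ext i
      fin_cases i <;> rfl
    refine ⟨fun t => c * (∏ i : Fin m, (t i.succ ^ 2) ^ κ i.succ) * (2 * q (fun i => t (σ i))
      + 2 * (t j.succ ^ 2) ^ (1 : ℤ) * p fun i => t (σ i)),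
      ((prod _ fun i _ => coord _ _).const_mul c).mul (((hq.comp σ).const_mul 2).add
        (((coord _ 1).const_mul 2).mul (hp.comp σ))), fun ε t hε ht => ⟨?_, ?_⟩⟩
    · have h1 := (((h' ε _ _ hε (ht 0) (ht j.succ)).const_mul 2).add
        ((h ε _ _ hε (ht 0) (ht j.succ)).const_mul (2 * t j.succ ^ 2))).const_mul
        (c * ∏ i : Fin m, (t i.succ ^ 2) ^ κ i.succ)
      simp only [hσ, zpow_one]
      refine h1.congr hε fun s hs => ?_
      have h2 := (ht 0).sq_sub_sq_ne_zero hs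
      have h3 := (ht j.succ).sq_sub_sq_ne_zero hs
      rw [prod_cons_tail, zpow_add_one₀ (pow_ne_zero 2 (ne_zero_of_mem_contour hε hs))]
      field_simp
    · intro hne φ' hφ'
      have ha := (ht 0).ne_zero hε
      have hb := (ht j.succ).ne_zero hε
      have h1 := (h ε _ _ hε (ht 0) (ht j.succ)).unique
        (HasContour.mixed_pole_of_ne hε (ht 0) (ht j.succ) hne (κ 0))
      have h2 := (h' ε _ _ hε (ht 0) (ht j.succ)).unique
        (HasContour.mixed_pole_of_ne hε (ht 0) (ht j.succ) hne (κ 0 + 1))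
      have hsub : t 0 ^ 2 - t j.succ ^ 2 ≠ 0 := sub_ne_zero.2 hne
      have hsub' : t j.succ ^ 2 - t 0 ^ 2 ≠ 0 := sub_ne_zero.2 hne.symm
      have hder : HasDerivAt (fun x : ℂ => c * ((x ^ 2) ^ κ 0
          * ∏ i : Fin m, (t i.succ ^ 2) ^ κ i.succ))
          (c * ((κ 0) * (t j.succ ^ 2) ^ (κ 0 - 1) * (2 * t j.succ)
            * ∏ i : Fin m, (t i.succ ^ 2) ^ κ i.succ)) (t j.succ) := by
        have h3 := (hasDerivAt_zpow (κ 0) (t j.succ ^ 2) (Or.inl (pow_ne_zero 2 hb))).comp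
          (t j.succ) (hasDerivAt_pow 2 (t j.succ))
        convert! (h3.mul_const (∏ i : Fin m, (t i.succ ^ 2) ^ κ i.succ)).const_mul c using 1
        simp
      simp only [prod_cons_tail] at hφ' ⊢
      rw [hφ'.unique hder]
      simp only [hσ, zpow_one]
      rw [h1, h2, Fin.prod_univ_succ]
      unfold residueTerm
      rw [show t j.succ ^ 2 - t 0 ^ 2 = -(t 0 ^ 2 - t j.succ ^ 2) by ring]
      simp only [zpow_sub_one₀ (pow_ne_zero 2 hb), zpow_add_one₀ (pow_ne_zero 2 hb),
        zpow_add_one₀ (pow_ne_zero 2 ha), add_sub_cancel_right]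
      push_cast
      field_simp
      ring
  | @add f g hf hg h1 h2 =>
    obtain ⟨p, hp, h1⟩ := h1
    obtain ⟨q, hq, h2⟩ := h2
    refine ⟨_, hp.add hq, fun ε t hε ht => ⟨?_, ?_⟩⟩
    · convert! (h1 ε t hε ht).1.add (h2 ε t hε ht).1 using 1
      funext s
      ring
    · intro hne φ' hφ'
      have hb := (ht j.succ).ne_zero hε
      have hu : ∀ i, Fin.tail t i ≠ 0 := fun i => (ht i.succ).ne_zero hε
      obtain ⟨D, hD⟩ := hf.exists_hasDerivAt hb hu
      obtain ⟨E, hE⟩ := hg.exists_hasDerivAt hb hu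
      rw [hφ'.unique (hD.fun_add hE), (h1 ε t hε ht).2 hne D hD, (h2 ε t hε ht).2 hne E hE]
      unfold residueTerm
      ring
  | @congr f g hf h h1 =>
    obtain ⟨p, hp, h1⟩ := h1
    refine ⟨p, hp, fun ε t hε ht => ?_⟩
    have hcons : ∀ s, s ≠ 0 → f (Fin.cons s (Fin.tail t)) = g (Fin.cons s (Fin.tail t)) :=
      fun s hs => h _ fun i => by
        exact Fin.cases hs (fun i => (ht i.succ).ne_zero hε) i
    have hb := (ht j.succ).ne_zero hε
    refine ⟨(h1 ε t hε ht).1.congr hε fun s hs => ?_, fun hne φ' hφ' => ?_⟩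
    · rw [hcons s (ne_zero_of_mem_contour hε hs)]
    · rw [← hcons _ hb, ← h t fun i => (ht i).ne_zero hε]
      refine (h1 ε t hε ht).2 hne φ' (hφ'.congr_of_eventuallyEq ?_)
      filter_upwards [isOpen_compl_singleton.mem_nhds hb] with s hs using hcons s hs

end EvenLaurent

end Contour

/-! ### The recursion for three genus zero points -/

section ThreePoints

open Complex

/-- Inversion exchanges the circles `|s| = 1 / R` and `|s| = R`. -/
lemma circleIntegral_inv {R : ℝ} (hR : 0 < R) (f : ℂ → ℂ) :
    (∮ s in C(0, 1 / R), f s) = ∮ s in C(0, R), f s⁻¹ / s ^ 2 := by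
  have hR' : (R : ℂ) ≠ 0 := by exact_mod_cast hR.ne'
  set h : ℝ → ℂ := fun θ => deriv (circleMap 0 (1 / R)) θ • f (circleMap 0 (1 / R) θ) with hh
  have hper : Function.Periodic h (2 * Real.pi) := by
    intro θ
    simp only [hh, deriv_circleMap, periodic_circleMap 0 (1 / R) θ]
  have hneg : ∀ θ : ℝ, deriv (circleMap 0 R) θ • (f (circleMap 0 R θ)⁻¹ / circleMap 0 R θ ^ 2)
      = h (-θ) := by
    intro θ
    have hinv : circleMap 0 (1 / R) (-θ) = (circleMap 0 R θ)⁻¹ := by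
      simp only [circleMap, zero_add, mul_inv, ← Complex.exp_neg]
      push_cast
      rw [one_div, neg_mul]
    have hne : circleMap 0 R θ ≠ 0 := circleMap_ne_center hR.ne'
    simp only [hh, deriv_circleMap, hinv, smul_eq_mul]
    field_simp
  rw [circleIntegral, circleIntegral]
  simp only [hneg]
  rw [intervalIntegral.integral_comp_neg, neg_zero]
  have := hper.intervalIntegral_add_eq 0 (-(2 * Real.pi))
  rw [zero_add, neg_add_cancel] at this
  exact this

variable {ε : ℝ}

lemma hasContour_three (hε : 0 < ε) {a b c : ℂ} (ha : Between ε a) (hb : Between ε b)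
    (hc : Between ε c) :
    HasContour ε (fun s => s / (s ^ 2 - a ^ 2) * (kern s *
      (1 / ((s + b) ^ 2 * (s - c) ^ 2) + 1 / ((s + c) ^ 2 * (s - b) ^ 2))))
      (1 / (16 * a ^ 2 * b ^ 2 * c ^ 2) - 1 / 16) := by
  have hε' := one_div_pos.2 hε
  have ha0 := ha.ne_zero hε
  have hb0 := hb.ne_zero hε
  have hc0 := hc.ne_zero hε
  set f : ℂ → ℂ := fun s => s / (s ^ 2 - a ^ 2) * (kern s *
      (1 / ((s + b) ^ 2 * (s - c) ^ 2) + 1 / ((s + c) ^ 2 * (s - b) ^ 2))) with hf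
  have hcont : ContinuousOn f (contour ε) := by
    intro s hs
    refine ContinuousAt.continuousWithinAt ?_
    have h0 := ne_zero_of_mem_contour hε hs
    have h1 := ha.sq_sub_sq_ne_zero hs
    have h2 := mul_ne_zero (pow_ne_zero 2 (hb.add_ne_zero hs)) (pow_ne_zero 2 (hc.sub_ne_zero hs))
    have h3 := mul_ne_zero (pow_ne_zero 2 (hc.add_ne_zero hs)) (pow_ne_zero 2 (hb.sub_ne_zero hs))
    suffices DifferentiableAt ℂ f s from this.continuousAt
    exact DifferentiableAt.fun_mul (DifferentiableAt.fun_div (by fun_prop) (by fun_prop) h1)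
      (DifferentiableAt.fun_mul (hasDerivAt_kern h0).differentiableAt
        (DifferentiableAt.fun_add (DifferentiableAt.fun_div (by fun_prop) (by fun_prop) h2)
          (DifferentiableAt.fun_div (by fun_prop) (by fun_prop) h3)))
  refine ⟨(hcont.mono Set.subset_union_left).circleIntegrable hε.le,
    (hcont.mono Set.subset_union_right).circleIntegrable hε'.le, ?_⟩
  have hlt : ∀ {w : ℂ}, Between ε w → ∀ s ∈ Metric.closedBall (0 : ℂ) ε,
      s - w ≠ 0 ∧ s + w ≠ 0 ∧ 1 - s * w ≠ 0 ∧ 1 + s * w ≠ 0 := by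
    intro w hw s hs
    rw [mem_closedBall_zero_iff] at hs
    have hprod : ‖s * w‖ < 1 := by
      rw [norm_mul]
      calc ‖s‖ * ‖w‖ ≤ ε * ‖w‖ := by gcongr
        _ < ε * (1 / ε) := by have := hw.2; gcongr
        _ = 1 := by field_simp
    refine ⟨fun h => ?_, fun h => ?_, fun h => ?_, fun h => ?_⟩
    · rw [sub_eq_zero.1 h] at hs; linarith [hw.1]
    · rw [eq_neg_of_add_eq_zero_left h, norm_neg] at hs; linarith [hw.1]
    · rw [← sub_eq_zero.1 h, norm_one] at hprod; exact lt_irrefl _ hprod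
    · rw [eq_neg_of_add_eq_zero_right h, norm_neg, norm_one] at hprod; exact lt_irrefl _ hprod
  have hcl : closure (Metric.ball (0 : ℂ) ε) = Metric.closedBall 0 ε := closure_ball _ hε.ne'
  -- the pole at `0`
  have h1 : (∮ s in C(0, ε), f s) = (2 * Real.pi * I) * (1 / (16 * a ^ 2 * b ^ 2 * c ^ 2)) := by
    have hd : DiffContOnCl ℂ (fun s : ℂ => (s ^ 2 - 1) ^ 3 / (32 * (s ^ 2 - a ^ 2)) *
        (1 / ((s + b) ^ 2 * (s - c) ^ 2) + 1 / ((s + c) ^ 2 * (s - b) ^ 2)))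
        (Metric.ball 0 ε) := by
      refine DifferentiableOn.diffContOnCl ?_
      rw [hcl]
      intro s hs
      obtain ⟨a1, a2, -, -⟩ := hlt ha s hs
      obtain ⟨b1, b2, -, -⟩ := hlt hb s hs
      obtain ⟨c1, c2, -, -⟩ := hlt hc s hs
      refine DifferentiableAt.differentiableWithinAt ?_
      refine DifferentiableAt.fun_mul (DifferentiableAt.fun_div (by fun_prop) (by fun_prop) ?_)
        (DifferentiableAt.fun_add (DifferentiableAt.fun_div (by fun_prop) (by fun_prop) ?_)
          (DifferentiableAt.fun_div (by fun_prop) (by fun_prop) ?_))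
      · rw [sq_sub_sq]
        exact mul_ne_zero (by norm_num) (mul_ne_zero a2 a1)
      · exact mul_ne_zero (pow_ne_zero 2 b2) (pow_ne_zero 2 c1)
      · exact mul_ne_zero (pow_ne_zero 2 c2) (pow_ne_zero 2 b1)
    have h := hd.circleIntegral_sub_inv_smul (w := 0) (Metric.mem_ball_self hε)
    convert! h using 1
    · refine circleIntegral.integral_congr hε.le fun s hs => ?_
      have h0 := ne_zero_of_mem_contour hε (Or.inl hs)
      have h1 := ha.sq_sub_sq_ne_zero (Or.inl hs)
      simp only [hf, kern, sub_zero, smul_eq_mul]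
      field_simp
    · rw [smul_eq_mul]
      congr 1
      simp only [zero_add, zero_sub, neg_sq, zero_pow two_ne_zero]
      field_simp
      norm_num
  -- the pole at `∞`
  have h2 : (∮ s in C(0, 1 / ε), f s) = (2 * Real.pi * I) * (1 / 16) := by
    have hd : DiffContOnCl ℂ (fun s : ℂ => (1 - s ^ 2) ^ 3 / (32 * (1 - (s * a) ^ 2)) *
        (1 / ((1 + s * b) ^ 2 * (1 - s * c) ^ 2) + 1 / ((1 + s * c) ^ 2 * (1 - s * b) ^ 2)))
        (Metric.ball 0 ε) := by
      refine DifferentiableOn.diffContOnCl ?_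
      rw [hcl]
      intro s hs
      obtain ⟨-, -, a1, a2⟩ := hlt ha s hs
      obtain ⟨-, -, b1, b2⟩ := hlt hb s hs
      obtain ⟨-, -, c1, c2⟩ := hlt hc s hs
      refine DifferentiableAt.differentiableWithinAt ?_
      refine DifferentiableAt.fun_mul (DifferentiableAt.fun_div (by fun_prop) (by fun_prop) ?_)
        (DifferentiableAt.fun_add (DifferentiableAt.fun_div (by fun_prop) (by fun_prop) ?_)
          (DifferentiableAt.fun_div (by fun_prop) (by fun_prop) ?_))
      · rw [show 1 - (s * a) ^ 2 = (1 - s * a) * (1 + s * a) by ring]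
        exact mul_ne_zero (by norm_num) (mul_ne_zero a1 a2)
      · exact mul_ne_zero (pow_ne_zero 2 b2) (pow_ne_zero 2 c1)
      · exact mul_ne_zero (pow_ne_zero 2 c2) (pow_ne_zero 2 b1)
    have h := hd.circleIntegral_sub_inv_smul (w := 0) (Metric.mem_ball_self hε)
    rw [circleIntegral_inv hε]
    convert! h using 1
    · refine circleIntegral.integral_congr hε.le fun s hs => ?_
      have h0 := ne_zero_of_mem_contour hε (Or.inl hs)
      have hs' := Metric.sphere_subset_closedBall hs
      obtain ⟨-, -, a1, a2⟩ := hlt ha s hs'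
      obtain ⟨-, -, b1, b2⟩ := hlt hb s hs'
      obtain ⟨-, -, c1, c2⟩ := hlt hc s hs'
      simp only [hf, kern, sub_zero, smul_eq_mul]
      rw [show s⁻¹ ^ 2 - a ^ 2 = (1 - s * a) * (1 + s * a) / s ^ 2 by field_simp; ring,
        show s⁻¹ + b = (1 + s * b) / s by field_simp,
        show s⁻¹ - c = (1 - s * c) / s by field_simp,
        show s⁻¹ + c = (1 + s * c) / s by field_simp,
        show s⁻¹ - b = (1 - s * b) / s by field_simp,
        show s⁻¹ ^ 2 - 1 = (1 - s ^ 2) / s ^ 2 by field_simp,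
        show 1 - (s * a) ^ 2 = (1 - s * a) * (1 + s * a) by ring]
      field_simp
    · rw [smul_eq_mul]
      congr 1
      norm_num
  rw [h1, h2, ← mul_sub, inv_mul_cancel_left₀ HasContour.two_pi_I_ne]

end ThreePoints

/-! ### The topological recursion for the coefficient functions -/

section ScalarRecursion

variable {m : ℕ}

/-- The term `W_{g-1,n+1}(t, -t, t_2, …, t_n)`. -/
noncomputable def scalarConn (w : (g n : ℕ) → (Fin n → ℂ) → ℂ) (s : ℂ) (u : Fin m → ℂ) : ℕ → ℂ
  | 0 => 0
  | g + 1 => -regularized w g (m + 2) (Fin.cons s (Fin.cons (-s) u))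

/-- The sum of the products `W_{g₁,|I|+1}(t, t_I) W_{g₂,|J|+1}(-t, t_J)` without `(0,1)` terms. -/
noncomputable def scalarSplit (w : (g n : ℕ) → (Fin n → ℂ) → ℂ) (g : ℕ) (s : ℂ) (u : Fin m → ℂ) :
    ℂ :=
  ∑ p ∈ Finset.HasAntidiagonal.antidiagonal g, ∑ I : Finset (Fin m),
    if (p.1 = 0 ∧ I = ∅) ∨ (p.2 = 0 ∧ Iᶜ = ∅) then 0
    else -(w p.1 (I.card + 1) (Fin.cons s (restr I u))
      * w p.2 (Iᶜ.card + 1) (Fin.cons (-s) (restr Iᶜ u)))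

/-- The integrand of the untwisted topological recursion. -/
noncomputable def scalarIntegrand (w : (g n : ℕ) → (Fin n → ℂ) → ℂ) (g : ℕ) (t : Fin (m + 1) → ℂ)
    (s : ℂ) : ℂ :=
  kernelD s (t 0) * (scalarConn w s (Fin.tail t) g + scalarSplit w g s (Fin.tail t))

lemma regularized_of_ne {w : (g n : ℕ) → (Fin n → ℂ) → ℂ} {g n : ℕ} (h : (g, n) ≠ (0, 2)) :
    regularized w g n = w g n := by
  funext t
  rcases g with _ | g
  · rcases n with _ | _ | _ | n
    · rfl
    · rfl
    · exact absurd rfl h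
    · rfl
  · rfl

lemma card_add_card_compl (I : Finset (Fin m)) : I.card + Iᶜ.card = m := by
  rw [Finset.card_add_card_compl, Fintype.card_fin]

/-- The integrand depends only on the differentials of smaller complexity. -/
lemma scalarIntegrand_congr {w w' : (g n : ℕ) → (Fin n → ℂ) → ℂ} {g : ℕ}
    (h : ∀ h k, 2 * h + k < 2 * g + (m + 1) → w h k = w' h k) (t : Fin (m + 1) → ℂ) :
    scalarIntegrand w g t = scalarIntegrand w' g t := by
  funext s
  unfold scalarIntegrand
  congr 2
  · rcases g with _ | g
    · rfl
    · change -regularized w g (m + 2) _ = -regularized w' g (m + 2) _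
      by_cases hg : (g, m + 2) = (0, 2)
      · obtain ⟨rfl, hm⟩ := Prod.mk.inj hg
        obtain rfl : m = 0 := by omega
        rfl
      · rw [regularized_of_ne hg, regularized_of_ne hg, h g (m + 2) (by omega)]
  · unfold scalarSplit
    refine Finset.sum_congr rfl fun p hp => Finset.sum_congr rfl fun I _ => ?_
    rw [Finset.HasAntidiagonal.mem_antidiagonal] at hp
    have hcard := card_add_card_compl I
    split_ifs with hc
    · rfl
    · rw [not_or, not_and, not_and, ← Finset.card_eq_zero, ← Finset.card_eq_zero] at hc
      rw [h p.1 (I.card + 1) (by by_contra hlt; exact hc.2 (by omega) (by omega)),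
        h p.2 (Iᶜ.card + 1) (by by_contra hlt; exact hc.1 (by omega) (by omega))]

/-- Apart from the type `(0,3)`, each term of the splitting sum either consists of two stable
factors or has exactly one factor of type `(0,2)`. -/
lemma sum_split {g : ℕ} (hst : 2 < 2 * g + (m + 1)) (h02 : (g, m) ≠ (0, 2))
    (X : ℕ × ℕ → Finset (Fin m) → ℂ) :
    (∑ p ∈ Finset.HasAntidiagonal.antidiagonal g, ∑ I : Finset (Fin m),
      if (p.1 = 0 ∧ I = ∅) ∨ (p.2 = 0 ∧ Iᶜ = ∅) then 0 else X p I)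
      = (∑ p ∈ Finset.HasAntidiagonal.antidiagonal g, ∑ I : Finset (Fin m),
        if 2 < 2 * p.1 + (I.card + 1) ∧ 2 < 2 * p.2 + (Iᶜ.card + 1) then X p I else 0)
        + ∑ j, (X (0, g) {j} + X (g, 0) {j}ᶜ) := by
  have hpt : ∀ p ∈ Finset.HasAntidiagonal.antidiagonal g, ∀ I : Finset (Fin m),
      (if (p.1 = 0 ∧ I = ∅) ∨ (p.2 = 0 ∧ Iᶜ = ∅) then 0 else X p I)
        = (if 2 < 2 * p.1 + (I.card + 1) ∧ 2 < 2 * p.2 + (Iᶜ.card + 1) then X p I else 0)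
          + ((if p = (0, g) then (if I.card = 1 then X (0, g) I else 0) else 0)
          + (if p = (g, 0) then (if Iᶜ.card = 1 then X (g, 0) I else 0) else 0)) := by
    rintro ⟨a, b⟩ hp I
    rw [Finset.HasAntidiagonal.mem_antidiagonal] at hp
    have hcard := card_add_card_compl I
    have h02' : ¬(g = 0 ∧ m = 2) := fun h => h02 (by rw [h.1, h.2])
    simp only [Prod.mk.injEq, ← Finset.card_eq_zero] at hp ⊢
    by_cases h1 : a = 0 ∧ I.card = 1
    · obtain ⟨rfl, h1⟩ := h1
      obtain rfl : b = g := by omega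
      rw [if_neg (by omega), if_neg (by omega), if_pos ⟨rfl, rfl⟩, if_pos h1, zero_add]
      split_ifs
      · omega
      · rw [add_zero]
      · rw [add_zero]
    · have e1 : (if a = 0 ∧ b = g then (if I.card = 1 then X (0, g) I else 0) else 0) = 0 := by
        split_ifs
        · omega
        · rfl
        · rfl
      rw [e1]
      by_cases h2 : b = 0 ∧ Iᶜ.card = 1
      · obtain ⟨rfl, h2⟩ := h2
        obtain rfl : a = g := by omega
        rw [if_neg (by omega), if_neg (by omega), if_pos ⟨rfl, rfl⟩, if_pos h2, zero_add, zero_add]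
      · have e2 : (if a = g ∧ b = 0 then (if Iᶜ.card = 1 then X (g, 0) I else 0) else 0) = 0 := by
          split_ifs
          · omega
          · rfl
          · rfl
        rw [e2, add_zero, add_zero]
        split_ifs
        · omega
        · rfl
        · rfl
        · omega
  rw [Finset.sum_congr rfl fun p hp => Finset.sum_congr rfl fun I _ => hpt p hp I]
  simp only [Finset.sum_add_distrib]
  congr 1
  have hsingle (Y : Finset (Fin m) → ℂ) :
      (∑ I : Finset (Fin m), if I.card = 1 then Y I else 0) = ∑ j, Y {j} := by
    rw [← Finset.sum_filter]
    symm
    refine Finset.sum_bij (fun j _ => {j}) (by simp) (by simp) (fun I hI => ?_) (by simp)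
    rw [Finset.mem_filter, Finset.card_eq_one] at hI
    obtain ⟨j, hj⟩ := hI.2
    exact ⟨j, Finset.mem_univ _, hj.symm⟩
  have hcompl (Y : Finset (Fin m) → ℂ) :
      (∑ I : Finset (Fin m), if Iᶜ.card = 1 then Y I else 0) = ∑ j, Y {j}ᶜ := by
    rw [← hsingle fun I => Y Iᶜ]
    exact Fintype.sum_equiv (Function.Involutive.toPerm _ compl_involutive) _ _ fun I => by
      rw [Function.Involutive.coe_toPerm, compl_compl]
  congr 1
  · rw [Finset.sum_eq_single (0, g) (fun p _ hp => by simp [hp])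
      (fun h => absurd (Finset.HasAntidiagonal.mem_antidiagonal.2 (zero_add g)) h)]
    simp only [if_true]
    exact hsingle _
  · rw [Finset.sum_eq_single (g, 0) (fun p _ hp => by simp [hp])
      (fun h => absurd (Finset.HasAntidiagonal.mem_antidiagonal.2 (add_zero g)) h)]
    simp only [if_true]
    exact hcompl _

lemma evenLaurent_kern : EvenLaurent fun t : Fin (m + 1) → ℂ => kern (t 0) := by
  refine (((((EvenLaurent.coord 0 2).const_mul (1 / 32)).add
    ((EvenLaurent.coord 0 1).const_mul (-3 / 32))).add (EvenLaurent.const (3 / 32))).add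
    ((EvenLaurent.coord 0 (-1)).const_mul (-1 / 32))).congr fun t ht => ?_
  have := ht 0
  simp only [kern, zpow_neg_one, zpow_ofNat]
  field_simp
  ring

lemma kernelD_eq {ε : ℝ} {s a : ℂ} (ha : Between ε a) (hs : s ∈ contour ε) :
    kernelD s a = -(s / (s ^ 2 - a ^ 2) * kern s) := by
  have h1 := ha.sub_ne_zero hs
  have h2 := ha.add_ne_zero hs
  by_cases h0 : s = 0
  · simp [kernelD, kern, h0]
  · rw [kernelD, kern, sq_sub_sq]
    field_simp
    ring

/-- The part of the integrand which is an even Laurent polynomial in all variables. -/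
noncomputable def regularPart (w : (g n : ℕ) → (Fin n → ℂ) → ℂ) (g : ℕ) (t : Fin (m + 1) → ℂ) :
    ℂ :=
  (if g = 0 then 0 else w (g - 1) (m + 2) (Fin.cons (t 0) (Fin.cons (t 0) (Fin.tail t))))
    + ∑ p ∈ Finset.HasAntidiagonal.antidiagonal g, ∑ I : Finset (Fin m),
        if 2 < 2 * p.1 + (I.card + 1) ∧ 2 < 2 * p.2 + (Iᶜ.card + 1) then
          w p.1 (I.card + 1) (Fin.cons (t 0) (restr I (Fin.tail t)))
            * w p.2 (Iᶜ.card + 1) (Fin.cons (t 0) (restr Iᶜ (Fin.tail t)))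
        else 0

/-- The stable differentials below a given complexity are even Laurent polynomials, and the one of
type `(0,2)` is the expected one. -/
structure IsRegularBelow (w : (g n : ℕ) → (Fin n → ℂ) → ℂ) (N : ℕ) : Prop where
  zero_two : ∀ t, w 0 2 t = w02 (t 0) (t 1)
  stable : ∀ g m, 2 < 2 * g + (m + 1) → 2 * g + (m + 1) < N → EvenLaurent (w g (m + 1))

variable {w : (g n : ℕ) → (Fin n → ℂ) → ℂ} {g : ℕ}

lemma cons_restr_comp (I : Finset (Fin m)) (t : Fin (m + 1) → ℂ) :
    (Fin.cons (t 0) (restr I (Fin.tail t)) : Fin (I.card + 1) → ℂ)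
      = fun i => t ((Fin.cons 0 fun k => (I.orderEmbOfFin rfl k).succ :
        Fin (I.card + 1) → Fin (m + 1)) i) := by
  ext i
  exact Fin.cases rfl (fun _ => rfl) i

lemma IsRegularBelow.evenLaurent_restr (hw : IsRegularBelow w (2 * g + (m + 1))) {h : ℕ}
    {I : Finset (Fin m)} (h1 : 2 < 2 * h + (I.card + 1))
    (h2 : 2 * h + (I.card + 1) < 2 * g + (m + 1)) :
    EvenLaurent fun t : Fin (m + 1) → ℂ =>
      w h (I.card + 1) (Fin.cons (t 0) (restr I (Fin.tail t))) :=
  ((hw.stable h I.card h1 h2).comp _).congr fun t _ => by rw [cons_restr_comp]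

lemma IsRegularBelow.evenLaurent_regularPart (hw : IsRegularBelow w (2 * g + (m + 1))) :
    EvenLaurent fun t : Fin (m + 1) → ℂ => regularPart w g t := by
  refine EvenLaurent.add ?_ (EvenLaurent.sum _ fun p hp => EvenLaurent.sum _ fun I _ => ?_)
  · rcases g with _ | g
    · exact EvenLaurent.const 0
    · simp only [Nat.add_eq_zero_iff, one_ne_zero, and_false, if_false, Nat.add_sub_cancel]
      by_cases hg : (g, m) = (0, 0)
      · obtain ⟨rfl, rfl⟩ := Prod.mk.inj hg
        refine ((EvenLaurent.coord 0 (-1)).const_mul (1 / 4)).congr fun t ht => ?_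
        have := ht 0
        rw [hw.zero_two, w02, zpow_neg_one]
        simp only [Fin.cons_zero, Fin.cons_one]
        field_simp
        ring
      · have h1 : 2 < 2 * g + (m + 1 + 1) := by
          by_contra h
          exact hg (by rw [show g = 0 by omega, show m = 0 by omega])
        refine ((hw.stable g (m + 1) h1 (by omega)).comp
          (Fin.cons 0 (Fin.cons 0 Fin.succ) : Fin (m + 2) → Fin (m + 1))).congr fun t _ => ?_
        congr 1
        ext i
        refine Fin.cases rfl (fun i => ?_) i
        exact Fin.cases rfl (fun _ => rfl) i
  · rw [Finset.HasAntidiagonal.mem_antidiagonal] at hp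
    have hcard := card_add_card_compl I
    split_ifs with hc
    · exact (hw.evenLaurent_restr hc.1 (by omega)).mul (hw.evenLaurent_restr hc.2 (by omega))
    · exact EvenLaurent.const 0

/-- The integrand on the contour, when the type is not `(0,3)`. -/
lemma IsRegularBelow.scalarIntegrand_eq (hw : IsRegularBelow w (2 * g + (m + 1)))
    (hst : 2 < 2 * g + (m + 1)) (h02 : (g, m) ≠ (0, 2)) {ε : ℝ} (hε : 0 < ε)
    {t : Fin (m + 1) → ℂ} (ht : ∀ i, Between ε (t i)) {s : ℂ} (hs : s ∈ contour ε) :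
    scalarIntegrand w g t s
      = s / (s ^ 2 - t 0 ^ 2) * (kern s * regularPart w g (Fin.cons s (Fin.tail t)))
        + ∑ j : Fin m, s / (s ^ 2 - t 0 ^ 2)
          * (2 * (s ^ 2 + t j.succ ^ 2) / (s ^ 2 - t j.succ ^ 2) ^ 2
            * (kern s * w g _ (Fin.cons s (restr {j}ᶜ (Fin.tail t))))) := by
  have hs0 := ne_zero_of_mem_contour hε hs
  have hu : ∀ i, Fin.tail t i ≠ 0 := fun i => (ht i.succ).ne_zero hε
  have heven : ∀ {h : ℕ} {I : Finset (Fin m)}, 2 < 2 * h + (I.card + 1) →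
      2 * h + (I.card + 1) < 2 * g + (m + 1) →
      w h (I.card + 1) (Fin.cons (-s) (restr I (Fin.tail t)))
        = w h (I.card + 1) (Fin.cons s (restr I (Fin.tail t))) := by
    intro h I h1 h2
    refine (hw.stable h I.card h1 h2).eq_of_sq_eq (fun i => ?_) (fun i => ?_) fun i => ?_
    · exact Fin.cases (neg_ne_zero.2 hs0) (fun i => hu _) i
    · exact Fin.cases hs0 (fun i => hu _) i
    · exact Fin.cases (neg_sq s) (fun i => rfl) i
  have hconn : scalarConn w s (Fin.tail t) g
      = -(if g = 0 then 0 else w (g - 1) (m + 2) (Fin.cons s (Fin.cons s (Fin.tail t)))) := by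
    rcases g with _ | g
    · simp [scalarConn]
    · simp only [Nat.add_eq_zero_iff, one_ne_zero, and_false, if_false, Nat.add_sub_cancel]
      change -regularized w g (m + 2) _ = _
      congr 1
      by_cases hg : (g, m) = (0, 0)
      · obtain ⟨rfl, rfl⟩ := Prod.mk.inj hg
        rw [hw.zero_two, w02]
        change 1 / (s - -s) ^ 2 = 1 / (s + s) ^ 2
        rw [sub_neg_eq_add]
      · have h1 : 2 < 2 * g + (m + 1 + 1) := by
          by_contra h
          exact hg (by rw [show g = 0 by omega, show m = 0 by omega])
        rw [regularized_of_ne fun h => by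
          obtain ⟨rfl, h⟩ := Prod.mk.inj h
          exact hg (by rw [show m = 0 by omega])]
        refine (hw.stable g (m + 1) h1 (by omega)).eq_of_sq_eq (fun i => ?_) (fun i => ?_)
          fun i => ?_
        · refine Fin.cases hs0 (fun i => ?_) i
          exact Fin.cases (neg_ne_zero.2 hs0) (fun i => hu _) i
        · refine Fin.cases hs0 (fun i => ?_) i
          exact Fin.cases hs0 (fun i => hu _) i
        · refine Fin.cases rfl (fun i => ?_) i
          exact Fin.cases (neg_sq s) (fun i => rfl) i
  have hsplit := sum_split hst h02 fun p I =>
    -(w p.1 (I.card + 1) (Fin.cons s (restr I (Fin.tail t)))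
      * w p.2 (Iᶜ.card + 1) (Fin.cons (-s) (restr Iᶜ (Fin.tail t))))
  have hst' : ∀ p ∈ Finset.HasAntidiagonal.antidiagonal g, ∀ I : Finset (Fin m),
      (if 2 < 2 * p.1 + (I.card + 1) ∧ 2 < 2 * p.2 + (Iᶜ.card + 1) then
        -(w p.1 (I.card + 1) (Fin.cons s (restr I (Fin.tail t)))
          * w p.2 (Iᶜ.card + 1) (Fin.cons (-s) (restr Iᶜ (Fin.tail t)))) else 0)
      = -(if 2 < 2 * p.1 + (I.card + 1) ∧ 2 < 2 * p.2 + (Iᶜ.card + 1) then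
        w p.1 (I.card + 1) (Fin.cons s (restr I (Fin.tail t)))
          * w p.2 (Iᶜ.card + 1) (Fin.cons s (restr Iᶜ (Fin.tail t))) else 0) := by
    intro p hp I
    rw [Finset.HasAntidiagonal.mem_antidiagonal] at hp
    have hcard := card_add_card_compl I
    split_ifs with hc
    · rw [heven hc.2 (by omega)]
    · rw [neg_zero]
  have hun : ∀ j : Fin m, (-(w 0 _ (Fin.cons s (restr {j} (Fin.tail t)))
        * w g _ (Fin.cons (-s) (restr {j}ᶜ (Fin.tail t))))
      + -(w g _ (Fin.cons s (restr {j}ᶜ (Fin.tail t)))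
        * w 0 _ (Fin.cons (-s) (restr {j}ᶜᶜ (Fin.tail t)))))
      = -(2 * (s ^ 2 + t j.succ ^ 2) / (s ^ 2 - t j.succ ^ 2) ^ 2
          * w g _ (Fin.cons s (restr {j}ᶜ (Fin.tail t)))) := by
    intro j
    have h1 := (ht j.succ).sub_ne_zero hs
    have h2 := (ht j.succ).add_ne_zero hs
    have hcard := card_add_card_compl {j}
    rw [Finset.card_singleton] at hcard
    have hm : ¬(g = 0 ∧ m = 2) := fun h => h02 (by rw [h.1, h.2])
    have hcc : ∀ J : Finset (Fin m), J = {j} → ∀ x : ℂ,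
        w 0 (J.card + 1) (Fin.cons x (restr J (Fin.tail t))) = w02 x (t j.succ) := by
      rintro _ rfl x
      rw [apply_cons_restr_singleton (w 0), hw.zero_two]
      rfl
    rw [hcc _ rfl, hcc _ (compl_compl _), heven (by omega) (by omega), w02, w02,
      sq_sub_sq s (t j.succ)]
    rw [show -s + t j.succ = -(s - t j.succ) by ring, neg_sq]
    field_simp
    ring
  unfold scalarIntegrand scalarSplit regularPart
  rw [hconn, hsplit, Finset.sum_congr rfl fun j _ => hun j,
    Finset.sum_congr rfl fun p hp => Finset.sum_congr rfl fun I _ => hst' p hp I, kernelD_eq (ht 0) hs]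
  simp only [Finset.sum_neg_distrib, Fin.cons_zero, Fin.tail_cons]
  rw [← Finset.mul_sum]
  simp only [mul_left_comm _ (kern s)]
  rw [← Finset.mul_sum]
  ring

end ScalarRecursion

section ContourEvaluation

open Filter Topology

variable {m : ℕ} {w : (g n : ℕ) → (Fin n → ℂ) → ℂ} {g : ℕ}

/-- The contour integral of the recursion for the family `w` is, for all admissible contours, the
even Laurent polynomial `p`, which is given by the evaluated recursion at generic points. -/
def EvaluatesTo (w : (g n : ℕ) → (Fin n → ℂ) → ℂ) (g : ℕ) (p : (Fin (m + 1) → ℂ) → ℂ) : Prop :=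
  EvenLaurent p ∧ ∀ t : Fin (m + 1) → ℂ,
    (∀ ε, 0 < ε → (∀ i, Between ε (t i)) → HasContour ε (scalarIntegrand w g t) (p t)) ∧
    ((∀ i, t i ≠ 0) → (∀ j : Fin m, t 0 ≠ t j.succ) → (∀ i j, t i + t j ≠ 0) →
      ∀ φ' : Fin m → ℂ, (∀ j : Fin m, HasDerivAt
        (fun x => kern x * w g _ (Fin.cons x (restr {j}ᶜ (Fin.tail t)))) (φ' j) (t j.succ)) →
      p t = evaluatedRecursion w g (t 0) (Fin.tail t) φ')

lemma exists_between {n : ℕ} {t : Fin n → ℂ} (ht : ∀ i, t i ≠ 0) :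
    ∃ ε : ℝ, 0 < ε ∧ ∀ i, Between ε (t i) := by
  have h : ∀ᶠ ε : ℝ in 𝓝[>] 0, 0 < ε ∧ ∀ i, Between ε (t i) := by
    refine Filter.Eventually.and self_mem_nhdsWithin (Filter.eventually_all.2 fun i => ?_)
    have h1 : ∀ᶠ ε : ℝ in 𝓝[>] 0, ε < ‖t i‖ :=
      nhdsWithin_le_nhds (eventually_lt_nhds (norm_pos_iff.2 (ht i)))
    have h2 : ∀ᶠ ε : ℝ in 𝓝[>] 0, ‖t i‖ < ε⁻¹ :=
      tendsto_inv_nhdsGT_zero.eventually (eventually_gt_atTop _)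
    filter_upwards [h1, h2] with ε h1 h2
    exact ⟨h1, by rwa [one_div]⟩
  exact h.exists

lemma IsRegularBelow.exists_evaluatesTo_of_ne (hw : IsRegularBelow w (2 * g + (m + 1)))
    (hst : 2 < 2 * g + (m + 1)) (h02 : (g, m) ≠ (0, 2)) :
    ∃ p : (Fin (m + 1) → ℂ) → ℂ, EvaluatesTo w g p := by
  have hφ : ∀ j : Fin m, EvenLaurent fun t : Fin (m + 1) → ℂ =>
      kern (t 0) * w g _ (Fin.cons (t 0) (restr {j}ᶜ (Fin.tail t))) := by
    intro j
    have hcard := card_add_card_compl {j}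
    rw [Finset.card_singleton] at hcard
    have hm : ¬(g = 0 ∧ m = 2) := fun h => h02 (by rw [h.1, h.2])
    exact evenLaurent_kern.mul (hw.evenLaurent_restr (by omega) (by omega))
  have hreg : EvenLaurent fun t : Fin (m + 1) → ℂ => kern (t 0) * regularPart w g t :=
    evenLaurent_kern.mul hw.evenLaurent_regularPart
  choose p hp hpt using fun j => (hφ j).exists_hasContour_double j
  refine ⟨fun t => -(kern (t 0) * regularPart w g t) + ∑ j, p j t,
    hreg.neg.add (EvenLaurent.sum _ fun j _ => hp j), fun t => ⟨fun ε hε ht => ?_, ?_⟩⟩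
  · refine HasContour.congr hε (HasContour.add (hreg.hasContour_simple hε ht)
      (HasContour.sum Finset.univ fun j _ => (hpt j ε t hε ht).1)) fun s hs => ?_
    rw [hw.scalarIntegrand_eq hst h02 hε ht hs]
    rfl
  · intro h0 hne hadd φ' hφ'
    obtain ⟨ε, hε, ht⟩ := exists_between h0
    have hsub : ∀ j : Fin m, t 0 - Fin.tail t j ≠ 0 := fun j => sub_ne_zero.2 (hne j)
    have hadd' : ∀ j : Fin m, t 0 + Fin.tail t j ≠ 0 := fun j => hadd 0 j.succ
    have hsq : ∀ j : Fin m, t 0 ^ 2 ≠ t j.succ ^ 2 := fun j h =>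
      mul_ne_zero (hadd' j) (hsub j) (by
        change (t 0 + t j.succ) * (t 0 - t j.succ) = 0
        rw [← sq_sub_sq, h, sub_self])
    have hcc : ∀ (j : Fin m) (J : Finset (Fin m)), J = {j} →
        w 0 (J.card + 1) (Fin.cons (t 0) (restr J (Fin.tail t)))
          = 1 / (t 0 + Fin.tail t j) ^ 2 := by
      rintro j _ rfl
      rw [apply_cons_restr_singleton (w 0), hw.zero_two]
      rfl
    have hp' := fun j => (hpt j ε t hε ht).2 (hsq j) (φ' j) (hφ' j)
    simp only [Fin.cons_zero, Fin.tail_cons] at hp'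
    beta_reduce
    unfold evaluatedRecursion
    rw [sum_split hst h02]
    simp only [hp']
    rw [Finset.sum_sub_distrib, ← add_sub_assoc]
    congr 1
    unfold regularPart
    simp only [hcc _ _ rfl, hcc _ _ (compl_compl _)]
    rw [add_assoc (ite _ _ _), add_assoc, ← Finset.sum_add_distrib, ← add_assoc,
      mul_add (-kern (t 0)), Finset.mul_sum, neg_mul (kern (t 0)) (_ + _)]
    congr 1
    refine Finset.sum_congr rfl fun j _ => ?_
    have h1 := hsub j
    have h2 := hadd' j
    rw [show t j.succ = Fin.tail t j from rfl, sq_sub_sq]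
    field_simp
    ring

lemma evaluation_zero_three {a b c : ℂ} (ha : a ≠ 0) (hb : b ≠ 0) (hc : c ≠ 0) (hab : a - b ≠ 0)
    (hac : a - c ≠ 0) (hab' : a + b ≠ 0) (hac' : a + c ≠ 0) (hbc : b + c ≠ 0) :
    1 / (16 * a ^ 2 * b ^ 2 * c ^ 2) - 1 / 16
      = -kern a * (2 * (w02 a b * w02 a c)
          + (w02 a c * (1 / (a - b) ^ 2 - 1 / (a + b) ^ 2)
            + w02 a b * (1 / (a - c) ^ 2 - 1 / (a + c) ^ 2)))
        - (residueTerm a b (kern b * w02 b c)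
            ((b ^ 2 - 1) ^ 2 * (2 * b ^ 2 + 1) / (16 * b ^ 3) * w02 b c
              + kern b * (-2 / (b + c) ^ 3))
          + residueTerm a c (kern c * w02 c b)
            ((c ^ 2 - 1) ^ 2 * (2 * c ^ 2 + 1) / (16 * c ^ 3) * w02 c b
              + kern c * (-2 / (c + b) ^ 3))) := by
  unfold residueTerm w02 kern
  rw [add_comm c b, show b ^ 2 - a ^ 2 = -((a - b) * (a + b)) by ring,
    show c ^ 2 - a ^ 2 = -((a - c) * (a + c)) by ring]
  field_simp
  ring

lemma exists_evaluatesTo_zero_three (hw : ∀ t, w 0 2 t = w02 (t 0) (t 1)) :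
    ∃ p : (Fin (2 + 1) → ℂ) → ℂ, EvaluatesTo w 0 p := by
  have huniv : (Finset.univ : Finset (Finset (Fin 2))) = {∅, {0}, {1}, Finset.univ} := by decide
  have hc0 : ({0}ᶜ : Finset (Fin 2)) = {1} := by decide
  have hc1 : ({1}ᶜ : Finset (Fin 2)) = {0} := by decide
  -- the values at the restrictions to one variable
  have hr : ∀ (J : Finset (Fin 2)) (j : Fin 2), J = {j} → ∀ (x : ℂ) (u : Fin 2 → ℂ),
      w 0 (J.card + 1) (Fin.cons x (restr J u)) = w02 x (u j) := by
    rintro _ j rfl x u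
    rw [apply_cons_restr_singleton (w 0), hw]
    rfl
  have hsum : ∀ X : Finset (Fin 2) → ℂ, (∑ I : Finset (Fin 2),
      if I = ∅ ∨ Iᶜ = ∅ then 0 else X I) = X {0} + X {1} := by
    intro X
    rw [huniv, Finset.sum_insert (by decide), Finset.sum_insert (by decide),
      Finset.sum_insert (by decide), Finset.sum_singleton, if_pos (Or.inl rfl),
      if_neg (by decide), if_neg (by decide), if_pos (Or.inr (by decide))]
    ring
  refine ⟨fun t => 1 / (16 * t 0 ^ 2 * t 1 ^ 2 * t 2 ^ 2) - 1 / 16, ?_, fun t => ⟨?_, ?_⟩⟩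
  · refine ((EvenLaurent.mono (1 / 16) fun _ => -1).add (EvenLaurent.const (-1 / 16))).congr
      fun t ht => ?_
    rw [Fin.prod_univ_three]
    have h0 := ht 0
    have h1 := ht 1
    have h2 := ht 2
    simp only [zpow_neg_one]
    field_simp
    ring
  · intro ε hε ht
    refine HasContour.congr hε (hasContour_three hε (ht 0) (ht 1) (ht 2)) fun s hs => ?_
    unfold scalarIntegrand scalarSplit
    rw [kernelD_eq (ht 0) hs]
    simp only [scalarConn, Finset.HasAntidiagonal.antidiagonal_zero, Finset.sum_singleton,
      true_and]
    rw [hsum]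
    rw [hr _ 0 rfl, hr _ 1 hc0, hr _ 1 rfl, hr _ 0 hc1]
    unfold w02
    change _ = -(s / (s ^ 2 - t 0 ^ 2) * kern s) * (0 + (-(1 / (s + t 1) ^ 2 * (1 / (-s + t 2) ^ 2))
      + -(1 / (s + t 2) ^ 2 * (1 / (-s + t 1) ^ 2))))
    rw [show -s + t 2 = -(s - t 2) by ring, show -s + t 1 = -(s - t 1) by ring, neg_sq, neg_sq]
    simp only [one_div, mul_inv]
    ring
  · intro h0 hne hadd φ' hφ'
    have hd : ∀ b c : ℂ, b ≠ 0 → b + c ≠ 0 → HasDerivAt (fun x => kern x * w02 x c)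
        ((b ^ 2 - 1) ^ 2 * (2 * b ^ 2 + 1) / (16 * b ^ 3) * w02 b c
          + kern b * (-2 / (b + c) ^ 3)) b := by
      intro b c hb hbc
      refine (hasDerivAt_kern hb).fun_mul ?_
      have h := (((hasDerivAt_id b).add_const c).pow 2).inv (pow_ne_zero 2 hbc)
      convert! h using 1
      · funext x
        simp [w02]
      · simp only [id, Nat.cast_ofNat, Pi.pow_apply]
        field_simp
        ring
    have hr' := fun (J : Finset (Fin 2)) (j : Fin 2) (hJ : J = {j}) (x : ℂ) =>
      hr J j hJ x (Fin.tail t)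
    have h0' := hφ' 0
    have h1' := hφ' 1
    simp only [hr' _ 1 hc0] at h0'
    simp only [hr' _ 0 hc1] at h1'
    have e0 := h0'.unique (hd (t 1) (t 2) (h0 1) (hadd 1 2))
    have e1 := h1'.unique (hd (t 2) (t 1) (h0 2) (hadd 2 1))
    unfold evaluatedRecursion
    simp only [Finset.HasAntidiagonal.antidiagonal_zero, Finset.sum_singleton, true_and, if_true]
    rw [hsum, Fin.sum_univ_two, Fin.sum_univ_two, e0, e1]
    simp only [hr' _ 0 rfl, hr' _ 1 rfl, hr' _ 1 hc0, hr' _ 0 hc1]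
    have h := evaluation_zero_three (h0 0) (h0 1) (h0 2) (sub_ne_zero.2 (hne 0))
      (sub_ne_zero.2 (hne 1)) (hadd 0 1) (hadd 0 2) (hadd 1 2)
    rw [show Fin.tail t 0 = t 1 from rfl, show Fin.tail t 1 = t 2 from rfl]
    rw [show t 1 = t (Fin.succ 0) from rfl, show t 2 = t (Fin.succ 1) from rfl] at h ⊢
    rw [h]
    ring

/-- The contour integral of the recursion is an even Laurent polynomial, which is given by the
evaluated recursion at generic points. -/
lemma IsRegularBelow.exists_evaluatesTo (hw : IsRegularBelow w (2 * g + (m + 1)))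
    (hst : 2 < 2 * g + (m + 1)) : ∃ p : (Fin (m + 1) → ℂ) → ℂ, EvaluatesTo w g p := by
  by_cases h02 : (g, m) = (0, 2)
  · obtain ⟨rfl, rfl⟩ := Prod.mk.inj h02
    exact exists_evaluatesTo_zero_three hw.zero_two
  · exact hw.exists_evaluatesTo_of_ne hst h02

end ContourEvaluation

/-! ### The differentials defined by the recursion -/

section DessinForm

open Complex

open scoped Classical in
/-- The integral of `f` over the circle `|s| = ε` and the negatively oriented circle `|s| = 1 / ε`,
divided by `2πi`, where `ε` is a chosen number such that all `t_i` lie between the two circles. -/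
noncomputable def contourValue {n : ℕ} (f : ℂ → ℂ) (t : Fin n → ℂ) : ℂ :=
  if h : ∃ ε : ℝ, 0 < ε ∧ ∀ i, Between ε (t i) then
    (2 * Real.pi * I)⁻¹ * ((∮ s in C(0, h.choose), f s) - ∮ s in C(0, 1 / h.choose), f s)
  else 0

/-- One step of the recursion: the differentials of type `(g, n)` from those of smaller
complexity. -/
noncomputable def recursionStep (w : (g n : ℕ) → (Fin n → ℂ) → ℂ) :
    (g n : ℕ) → (Fin n → ℂ) → ℂ
  | 0, 1, t => w01 (t 0)
  | 0, 2, t => w02 (t 0) (t 1)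
  | _, 0, _ => 0
  | g, _ + 1, t => contourValue (scalarIntegrand w g t) t

/-- The coefficients of the differentials `W_{g,n}`, defined by the topological recursion. The guard
only makes the recursion well founded, since `recursionStep` does not use the values it discards. -/
noncomputable def dessinForm (g n : ℕ) : (Fin n → ℂ) → ℂ :=
  recursionStep (fun h k => if _ : 2 * h + k < 2 * g + n then dessinForm h k else 0) g n
termination_by 2 * g + n

lemma dessinForm_zero_one (t : Fin 1 → ℂ) : dessinForm 0 1 t = w01 (t 0) := by
  rw [dessinForm]
  rfl

lemma dessinForm_zero_two (t : Fin 2 → ℂ) : dessinForm 0 2 t = w02 (t 0) (t 1) := by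
  rw [dessinForm]
  rfl

lemma dessinForm_of_stable {g m : ℕ} (hst : 2 < 2 * g + (m + 1)) (t : Fin (m + 1) → ℂ) :
    dessinForm g (m + 1) t = contourValue (scalarIntegrand dessinForm g t) t := by
  have hstep : ∀ (w : (g n : ℕ) → (Fin n → ℂ) → ℂ), recursionStep w g (m + 1) t
      = contourValue (scalarIntegrand w g t) t := by
    intro w
    rcases g with _ | g
    · rcases m with _ | _ | m
      · omega
      · omega
      · rfl
    · rfl
  rw [dessinForm, hstep, scalarIntegrand_congr (w' := dessinForm) fun h k hlt => ?_]
  rw [dif_pos hlt]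

lemma EvaluatesTo.dessinForm_eq {g m : ℕ} {p : (Fin (m + 1) → ℂ) → ℂ}
    (hp : EvaluatesTo dessinForm g p) (hst : 2 < 2 * g + (m + 1)) {t : Fin (m + 1) → ℂ}
    (ht : ∀ i, t i ≠ 0) : dessinForm g (m + 1) t = p t := by
  have h := exists_between ht
  rw [dessinForm_of_stable hst, contourValue, dif_pos h]
  exact ((hp.2 t).1 _ h.choose_spec.1 h.choose_spec.2).eq

lemma EvaluatesTo.dessinForm {g m : ℕ} {p : (Fin (m + 1) → ℂ) → ℂ}
    (hp : EvaluatesTo dessinForm g p) (hst : 2 < 2 * g + (m + 1)) :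
    EvaluatesTo dessinForm g (dessinForm g (m + 1)) := by
  refine ⟨hp.1.congr fun t ht => (hp.dessinForm_eq hst ht).symm, fun t => ⟨fun ε hε ht => ?_, ?_⟩⟩
  · rw [hp.dessinForm_eq hst fun i => (ht i).ne_zero hε]
    exact (hp.2 t).1 ε hε ht
  · intro h0 h1 h2 φ' hφ'
    rw [hp.dessinForm_eq hst h0]
    exact (hp.2 t).2 h0 h1 h2 φ' hφ'

lemma isRegularBelow_dessinForm (N : ℕ) : IsRegularBelow dessinForm N := by
  induction N with
  | zero => exact ⟨dessinForm_zero_two, fun g m _ h => absurd h (Nat.not_lt_zero _)⟩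
  | succ N ih =>
    refine ⟨dessinForm_zero_two, fun g m hst hN => ?_⟩
    rcases Nat.lt_succ_iff_lt_or_eq.1 hN with hlt | heq
    · exact ih.stable g m hst hlt
    · rw [← heq] at ih
      obtain ⟨p, hp⟩ := ih.exists_evaluatesTo hst
      exact (hp.dessinForm hst).1

/-- The differentials satisfy the recursion, and their contour integrals can be evaluated. -/
theorem evaluatesTo_dessinForm {g m : ℕ} (hst : 2 < 2 * g + (m + 1)) :
    EvaluatesTo dessinForm g (dessinForm g (m + 1)) := by
  obtain ⟨p, hp⟩ := (isRegularBelow_dessinForm (2 * g + (m + 1))).exists_evaluatesTo hst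
  exact hp.dessinForm hst

variable {m : ℕ}

lemma evaluatedRecursion_congr {w w' : (g n : ℕ) → (Fin n → ℂ) → ℂ} {g : ℕ} {D : Set ℂ}
    (h : ∀ h k, 2 * h + k + 1 < 2 * g + m + 1 → ∀ t : Fin (k + 1) → ℂ, (∀ i, t i ∈ D) →
      w h (k + 1) t = w' h (k + 1) t) {s : ℂ} {u : Fin m → ℂ} (hs : s ∈ D) (hu : ∀ i, u i ∈ D)
    (φ' : Fin m → ℂ) : evaluatedRecursion w g s u φ' = evaluatedRecursion w' g s u φ' := by
  have hcons : ∀ {k : ℕ} {x : ℂ} {y : Fin k → ℂ}, x ∈ D → (∀ i, y i ∈ D) →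
      ∀ i, (Fin.cons x y : Fin (k + 1) → ℂ) i ∈ D := fun hx hy i => Fin.cases hx hy i
  have hr : ∀ (k : ℕ) (I : Finset (Fin m)) (x : ℂ), x ∈ D →
      2 * k + I.card + 1 < 2 * g + m + 1 → w k (I.card + 1) (Fin.cons x (restr I u))
        = w' k (I.card + 1) (Fin.cons x (restr I u)) :=
    fun k I x hx hlt => h k I.card hlt _ (hcons hx fun i => hu _)
  have hj : ∀ (j : Fin m) (x : ℂ), x ∈ D → w g _ (Fin.cons x (restr {j}ᶜ u))
      = w' g _ (Fin.cons x (restr {j}ᶜ u)) := by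
    intro j x hx
    have hcard := card_add_card_compl {j}
    rw [Finset.card_singleton] at hcard
    exact hr g _ x hx (by omega)
  unfold evaluatedRecursion
  congr 1
  · congr 2
    · congr 1
      · split_ifs with hg
        · rfl
        · exact h (g - 1) (m + 1) (by omega) _ (hcons hs (hcons hs hu))
      · refine Finset.sum_congr rfl fun p hp => Finset.sum_congr rfl fun I _ => ?_
        rw [Finset.HasAntidiagonal.mem_antidiagonal] at hp
        have hcard := card_add_card_compl I
        split_ifs with hc
        · rfl
        · rw [not_or, not_and, not_and, ← Finset.card_eq_zero, ← Finset.card_eq_zero] at hc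
          rw [hr p.1 I s hs (by by_contra hlt; exact hc.2 (by omega) (by omega)),
            hr p.2 Iᶜ s hs (by by_contra hlt; exact hc.1 (by omega) (by omega))]
    · exact Finset.sum_congr rfl fun j _ => by rw [hj j s hs]
  · exact Finset.sum_congr rfl fun j _ => by rw [hj j (u j) (hu j)]

/-- On the sheet `z ∼ 1 / x` the differentials defined by the recursion are the differentials
`d_1 ⋯ d_n F_{g,n}`: both satisfy the evaluated recursion. -/
theorem GrowthBound.dessinForm_eq_sheetForm {L : ℕ} {K ρ : ℝ} (hB : GrowthBound L K ρ) {g : ℕ}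
    (hL : 2 * g + m + 1 ≤ L) {t : Fin (m + 1) → ℂ} (ht : ∀ i, t i ∈ sheet (1 / (2 * ρ))) :
    dessinForm g (m + 1) t = sheetForm g (m + 1) t := by
  induction hN : 2 * g + m + 1 using Nat.strong_induction_on generalizing g m with
  | _ N ih =>
    subst hN
    have hsmall : ∀ h k, 2 * h + k + 1 < 2 * g + m + 1 → ∀ t : Fin (k + 1) → ℂ,
        (∀ i, t i ∈ sheet (1 / (2 * ρ))) → dessinForm h (k + 1) t = sheetForm h (k + 1) t :=
      fun h k hlt t ht => ih _ hlt (hlt.le.trans hL) ht rfl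
    by_cases hst : 2 < 2 * g + (m + 1)
    swap
    · obtain rfl : g = 0 := by omega
      rcases m with _ | _ | m
      · rw [dessinForm_zero_one, ← hB.sheetForm_zero_one (by omega) (ht 0)]
        congr 1
        ext i
        rw [Subsingleton.elim (α := Fin 1) i 0]
        rfl
      · rw [dessinForm_zero_two, ← hB.sheetForm_zero_two (by omega) (ht 0) (ht 1)]
        congr 1
        ext i
        fin_cases i <;> rfl
      · omega
    have hev := evaluatesTo_dessinForm hst
    obtain ⟨u, s, rfl⟩ : ∃ u s, t = Fin.cons s u := ⟨Fin.tail t, t 0, (Fin.cons_self_tail t).symm⟩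
    have hs : s ∈ sheet (1 / (2 * ρ)) := ht 0
    have hu : ∀ i, u i ∈ sheet (1 / (2 * ρ)) := fun i => ht i.succ
    obtain ⟨D, hD⟩ := hev.1.exists_hasDerivAt (ne_zero_of_re_neg hs.1)
      fun i => ne_zero_of_re_neg (hu i).1
    -- the derivatives which enter the evaluated recursion
    choose φ' hφ' using fun j : Fin m => show ∃ d, HasDerivAt
        (fun x => kern x * sheetForm g _ (Fin.cons x (restr {j}ᶜ u))) d (u j) by
      have hcard := card_add_card_compl {j}
      rw [Finset.card_singleton] at hcard
      exact ⟨_, (hasDerivAt_kern (ne_zero_of_re_neg (hu j).1)).fun_mul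
        (hB.hasDerivAt_sheetForm (by omega) (hu j) fun i => hu _)⟩
    refine eq_of_eventually_ne hD.continuousAt
      (hB.hasDerivAt_sheetForm hL hs hu).continuousAt (isOpen_sheet _) hs u fun s hs hne => ?_
    have hre : ∀ i, ((Fin.cons s u : Fin (m + 1) → ℂ) i).re < 0 :=
      fun i => Fin.cases hs.1 (fun i => (hu i).1) i
    have hgm : (g, m) ≠ (0, 0) := by
      intro h
      obtain ⟨rfl, rfl⟩ := Prod.mk.inj h
      omega
    rw [hB.sheetForm_recursion hL hgm hs hu hne φ' hφ']
    refine ((hev.2 _).2 (fun i => ne_zero_of_re_neg (hre i)) hne (fun i j h => ?_) φ'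
      fun j => ?_).trans (evaluatedRecursion_congr hsmall hs hu φ')
    · have := congrArg Complex.re h
      rw [Complex.add_re, Complex.zero_re] at this
      linarith [hre i, hre j]
    · refine (hφ' j).congr_of_eventuallyEq ?_
      filter_upwards [(isOpen_sheet _).mem_nhds (hu j)] with x hx
      have hcard := card_add_card_compl {j}
      rw [Finset.card_singleton] at hcard
      rw [hsmall g _ (by omega) _ fun i => ?_]
      · rfl
      · exact Fin.cases hx (fun i => hu _) i

end DessinForm

/-! ### Contraction with the Frobenius algebra -/

section Frobenius

open scoped TensorProduct

variable {K A ι : Type*} [Field K] [CommRing A] [Algebra K A] [Fintype ι] [DecidableEq ι]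
variable (Fr : FrobeniusForm K A) (e : Module.Basis ι K A)

/-- Expansion of an element with respect to the basis by means of the pairing. -/
lemma sum_etaInv (x : A) : ∑ i, ∑ a, (Fr.η x (e i) * Fr.etaInv e i a) • e a = x := by
  have hdet : IsUnit (Matrix.of fun i j => Fr.η (e i) (e j)).det := by
    rw [isUnit_iff_ne_zero]
    have h := (LinearMap.BilinForm.nondegenerate_iff_det_ne_zero e).1 Fr.nondegenerate
    convert h using 2
    ext i j
    simp [LinearMap.BilinForm.toMatrix_apply]
  have hinv : ∀ k a, ∑ i, Fr.η (e k) (e i) * Fr.etaInv e i a = (1 : Matrix ι ι K) k a := by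
    intro k a
    rw [← Matrix.mul_nonsing_inv _ hdet, Matrix.mul_apply]
    rfl
  have hbasis : ∀ k, ∑ i, ∑ a, (Fr.η (e k) (e i) * Fr.etaInv e i a) • e a = e k := by
    intro k
    rw [Finset.sum_comm]
    simp only [← Finset.sum_smul, hinv, Matrix.one_apply, ite_smul, one_smul, zero_smul,
      Finset.sum_ite_eq, Finset.mem_univ, if_true]
  let F : A →ₗ[K] A := ∑ i, ∑ a, Fr.etaInv e i a • (Fr.η.flip (e i)).smulRight (e a)
  have hF : ∀ x, F x = ∑ i, ∑ a, (Fr.η x (e i) * Fr.etaInv e i a) • e a := by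
    intro x
    simp only [F, LinearMap.sum_apply, LinearMap.smul_apply, LinearMap.smulRight_apply,
      LinearMap.BilinForm.flip_apply, smul_smul, mul_comm]
  rw [← hF]
  have hid : F = LinearMap.id := e.ext fun k => by rw [hF, hbasis, LinearMap.id_apply]
  rw [hid, LinearMap.id_apply]

lemma coproduct_apply (v : A) :
    Fr.coproduct e v = ∑ i, ∑ a, Fr.etaInv e i a • (e a ⊗ₜ[K] (v * e i)) := by
  have h : ∀ i, v * e i = ∑ j, ∑ b, (Fr.η (v * e i) (e j) * Fr.etaInv e j b) • e b :=
    fun i => (sum_etaInv Fr e (v * e i)).symm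
  simp only [FrobeniusForm.coproduct, LinearMap.sum_apply, LinearMap.smulRight_apply,
    LinearMap.comp_apply, LinearMap.BilinForm.flip_apply, LinearMap.mulRight_apply]
  refine Finset.sum_congr rfl fun i _ => ?_
  rw [Finset.sum_comm]
  refine Finset.sum_congr rfl fun a _ => ?_
  conv_rhs => rw [h i]
  simp only [TensorProduct.tmul_sum, Finset.smul_sum, TensorProduct.tmul_smul, smul_smul]
  refine Finset.sum_congr rfl fun j _ => Finset.sum_congr rfl fun b _ => ?_
  congr 1
  ring

/-- Multiplying the two legs of `δ v` gives `v` times the Euler element. -/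
lemma sum_etaInv_mul (v : A) : ∑ i, ∑ a, Fr.etaInv e i a • (e a * (v * e i)) = v * Fr.euler e := by
  rw [FrobeniusForm.euler, coproduct_apply]
  simp only [map_sum, map_smul, LinearMap.mul'_apply, Finset.mul_sum, one_mul, mul_smul_comm]
  exact Finset.sum_congr rfl fun i _ => Finset.sum_congr rfl fun a _ => by
    rw [mul_left_comm]

lemma eta_eq_counit (u v : A) : Fr.η u v = Fr.counit (u * v) := by
  rw [FrobeniusForm.counit, ← Fr.invariant, one_mul]

variable [Algebra K ℂ]

lemma Omega_apply (g n : ℕ) (v : Fin n → A) :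
    Fr.Omega e g n v = algebraMap K ℂ (Fr.counit ((∏ i, v i) * Fr.euler e ^ g)) := by
  simp [FrobeniusForm.Omega]

lemma coproductDual_apply (B : A →ₗ[K] A →ₗ[K] ℂ) (v : A) :
    Fr.coproductDual e B v = ∑ i, ∑ a, Fr.etaInv e i a • B (e a) (v * e i) := by
  rw [FrobeniusForm.coproductDual, LinearMap.comp_apply, coproduct_apply]
  simp only [map_sum, map_smul, TensorProduct.lift.tmul]

/-- Gluing the two legs of `δ v₁` inside one correlator raises the genus by one. -/
lemma coproductDual_eq_Omega {m g : ℕ} {B : A →ₗ[K] A →ₗ[K] ℂ} {c : ℂ} {v' : Fin m → A}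
    (hB : ∀ a b, B a b = c * Fr.Omega e g (m + 2) (Fin.cons a (Fin.cons b v'))) (v₁ : A) :
    Fr.coproductDual e B v₁ = c * Fr.Omega e (g + 1) (m + 1) (Fin.cons v₁ v') := by
  have h : ∀ a b, B a b
      = c * algebraMap K ℂ (Fr.counit (a * b * ((∏ i, v' i) * Fr.euler e ^ g))) := by
    intro a b
    rw [hB, Omega_apply, Fin.prod_univ_succ, Fin.prod_univ_succ]
    simp only [Fin.cons_zero, Fin.cons_succ]
    congr 3
    ring
  have hv := congrArg (fun x => algebraMap K ℂ (Fr.counit (x * ((∏ i, v' i) * Fr.euler e ^ g))))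
    (sum_etaInv_mul Fr e v₁)
  simp only [Finset.sum_mul, map_sum, smul_mul_assoc, map_smul, smul_eq_mul, map_mul] at hv
  rw [coproductDual_apply, Omega_apply, Fin.prod_univ_succ]
  simp only [Fin.cons_zero, Fin.cons_succ, h]
  rw [show v₁ * (∏ i, v' i) * Fr.euler e ^ (g + 1)
    = v₁ * Fr.euler e * ((∏ i, v' i) * Fr.euler e ^ g) by ring, ← hv, Finset.mul_sum]
  refine Finset.sum_congr rfl fun i _ => ?_
  rw [Finset.mul_sum]
  refine Finset.sum_congr rfl fun a _ => ?_
  rw [Algebra.smul_def]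
  ring

/-- Gluing two correlators along the two legs of `δ v₁` gives one correlator. -/
lemma deltaStar_eq {f₁ f₂ : A →ₗ[K] ℂ} {c₁ c₂ : ℂ} {p q : A}
    (h₁ : ∀ a, f₁ a = c₁ * algebraMap K ℂ (Fr.counit (a * p)))
    (h₂ : ∀ a, f₂ a = c₂ * algebraMap K ℂ (Fr.counit (a * q))) (v₁ : A) :
    Fr.deltaStar e f₁ f₂ v₁ = c₁ * c₂ * algebraMap K ℂ (Fr.counit (v₁ * (p * q))) := by
  have hv := congrArg (fun x => algebraMap K ℂ (Fr.counit (x * p))) (sum_etaInv Fr e (v₁ * q))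
  simp only [Finset.sum_mul, map_sum, smul_mul_assoc, map_smul, smul_eq_mul, map_mul] at hv
  rw [FrobeniusForm.deltaStar, coproductDual_apply]
  simp only [LinearMap.compl₁₂_apply, LinearMap.mul_apply', h₁, h₂]
  rw [show v₁ * (p * q) = v₁ * q * p by ring, ← hv, Finset.mul_sum]
  refine Finset.sum_congr rfl fun i _ => ?_
  rw [Finset.mul_sum]
  refine Finset.sum_congr rfl fun a _ => ?_
  rw [Algebra.smul_def, eta_eq_counit, mul_right_comm v₁ (e i) q]
  ring

variable {m : ℕ} (w : (g n : ℕ) → (Fin n → ℂ) → ℂ)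

/-- The Frobenius algebra enters the recursion only through the factor `Ω_{g,n}(v)`. -/
theorem recursionIntegrand_eq (g : ℕ) (t : Fin (m + 1) → ℂ) (v : Fin (m + 1) → A) (s : ℂ) :
    recursionIntegrand Fr e w g t v s = Fr.Omega e g (m + 1) v * scalarIntegrand w g t s := by
  obtain ⟨v₁, v', rfl⟩ : ∃ v₁ v', v = Fin.cons v₁ v' :=
    ⟨v 0, Fin.tail v, (Fin.cons_self_tail v).symm⟩
  have hconn : connectedTerm Fr e w s (Fin.tail t) v₁ v' g
      = Fr.Omega e g (m + 1) (Fin.cons v₁ v') * scalarConn w s (Fin.tail t) g := by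
    rcases g with _ | g
    · simp [connectedTerm, scalarConn]
    · rw [connectedTerm, scalarConn, coproductDual_eq_Omega Fr e (g := g)
        (c := regularized w g (m + 2) (Fin.cons s (Fin.cons (-s) (Fin.tail t)))) (v' := v')]
      · ring
      · intro a b
        rfl
  have hpart : ∀ (h : ℕ) (I : Finset (Fin m)) (x : ℂ) (a : A),
      partialForm Fr e w h I x (Fin.tail t) v' a
        = w h (I.card + 1) (Fin.cons x (restr I (Fin.tail t)))
          * algebraMap K ℂ (Fr.counit (a * ((∏ i ∈ I, v' i) * Fr.euler e ^ h))) := by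
    intro h I x a
    change w h (I.card + 1) (Fin.cons x (restr I (Fin.tail t)))
      * Fr.Omega e h (I.card + 1) (Fin.cons a (restr I v')) = _
    rw [Omega_apply, Fin.prod_univ_succ, ← prod_restr I v', mul_assoc]
    simp only [Fin.cons_zero, Fin.cons_succ]
  have hsplit : splitTerm Fr e w g s (Fin.tail t) v₁ v'
      = Fr.Omega e g (m + 1) (Fin.cons v₁ v') * scalarSplit w g s (Fin.tail t) := by
    unfold splitTerm scalarSplit
    rw [Finset.mul_sum]
    refine Finset.sum_congr rfl fun p hp => ?_
    rw [Finset.mul_sum]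
    refine Finset.sum_congr rfl fun I _ => ?_
    rw [Finset.HasAntidiagonal.mem_antidiagonal] at hp
    split_ifs
    · rw [mul_zero]
    · rw [deltaStar_eq Fr e (hpart p.1 I s) (hpart p.2 Iᶜ (-s)), Omega_apply, Fin.prod_univ_succ]
      simp only [Fin.cons_zero, Fin.cons_succ]
      rw [← Finset.prod_mul_prod_compl I, ← hp,
        show ∀ P Q : A, v₁ * (P * Fr.euler e ^ p.1 * (Q * Fr.euler e ^ p.2))
          = v₁ * (P * Q) * Fr.euler e ^ (p.1 + p.2) from fun P Q => by ring]
      ring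
  rw [recursionIntegrand, scalarIntegrand, Fin.cons_zero, Fin.tail_cons, hconn, hsplit]
  ring

lemma twisted_apply (g n : ℕ) (t : Fin n → ℂ) (v : Fin n → A) :
    twisted Fr e w g n t v = w g n t * Fr.Omega e g n v := rfl

lemma twistedLaplace_eq (g n : ℕ) (t : Fin n → ℂ) (v : Fin n → A) :
    twistedLaplace Fr e g n t v = Fr.Omega e g n v * dessinLaplace g n t := by
  rw [twistedLaplace, dessinLaplace, ← tsum_mul_left]
  refine tsum_congr fun μ => ?_
  change (dessinCount g n _ : ℂ) * Fr.Omega e g n v * laplaceWeight μ t = _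
  ring

end Frobenius

lemma mixedDeriv_const_mul {n : ℕ} (c : ℂ) (f : (Fin n → ℂ) → ℂ) :
    mixedDeriv (fun t => c * f t) = fun t => c * mixedDeriv f t := by
  unfold mixedDeriv
  induction List.finRange n with
  | nil => rfl
  | cons i l ih =>
    rw [List.foldr_cons, List.foldr_cons, ih]
    funext t
    exact deriv_const_mul_field c

/-! ### The recursion kernel -/

lemma integral_w02 {t₁ : ℂ} {γ γ' : ℝ → ℂ}
    (hγ : ∀ r ∈ Set.Icc (0 : ℝ) 1, γ r ≠ -t₁ ∧ HasDerivWithinAt γ (γ' r) (Set.Icc 0 1) r)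
    (hγ' : ContinuousOn γ' (Set.Icc 0 1)) :
    ∫ r in (0 : ℝ)..1, w02 (γ r) t₁ * γ' r = 1 / (γ 0 + t₁) - 1 / (γ 1 + t₁) := by
  have hne : ∀ r ∈ Set.Icc (0 : ℝ) 1, γ r + t₁ ≠ 0 := fun r hr h =>
    (hγ r hr).1 (eq_neg_of_add_eq_zero_left h)
  have hcont : ContinuousOn γ (Set.Icc 0 1) := fun r hr => (hγ r hr).2.continuousWithinAt
  have hint : ContinuousOn (fun r => w02 (γ r) t₁ * γ' r) (Set.Icc 0 1) := by
    unfold w02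
    exact (continuousOn_const.div ((hcont.add continuousOn_const).pow 2)
      fun r hr => pow_ne_zero 2 (hne r hr)).mul hγ'
  have h := intervalIntegral.integral_eq_sub_of_hasDerivAt_of_le zero_le_one
    (f := fun r => -(1 / (γ r + t₁))) (f' := fun r => w02 (γ r) t₁ * γ' r)
    (continuousOn_const.div (hcont.add continuousOn_const) hne).neg (fun r hr => ?_)
    (hint.intervalIntegrable_of_Icc zero_le_one)
  · rw [h]
    ring
  · have hr' := Set.Ioo_subset_Icc_self hr
    have hd := (((hγ r hr').2.hasDerivAt (Icc_mem_nhds hr.1 hr.2)).add_const t₁)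
    have hd' := ((hasDerivAt_const r (1 : ℂ)).fun_div hd (hne r hr')).fun_neg
    convert! hd' using 1
    unfold w02
    ring

/-- The kernel is half the quotient of `∫ W_{0,2}` by the difference of the values of `y dx` on the
two sheets. -/
lemma kernelD_eq_div {t t₁ : ℂ} (h0 : t ≠ 0) (h1 : t ≠ 1) (h2 : t ≠ -1) (h3 : t + t₁ ≠ 0)
    (h4 : -t + t₁ ≠ 0) :
    (1 / 2 : ℂ) * (1 / (t + t₁) - 1 / (-t + t₁)) / (-w01 (-t) - w01 t) = kernelD t t₁ := by
  have h1' : t - 1 ≠ 0 := sub_ne_zero.2 h1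
  have h2' : t + 1 ≠ 0 := fun h => h2 (eq_neg_of_add_eq_zero_left h)
  have hsq : t ^ 2 - 1 ≠ 0 := by
    rw [show t ^ 2 - 1 = (t - 1) * (t + 1) by ring]
    exact mul_ne_zero h1' h2'
  have h5 : t - t₁ ≠ 0 := fun h => h4 (by rw [sub_eq_zero.1 h]; ring)
  have hw : -w01 (-t) - w01 t = -(32 * t ^ 2 / (t ^ 2 - 1) ^ 3) := by
    rw [w01_eq (t := -t) (by rwa [neg_sq]), w01_eq hsq, neg_sq]
    ring
  rw [hw, kernelD, show -t + t₁ = -(t - t₁) by ring]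
  field_simp
  ring

/-! ### Differentiation of the Laplace transforms -/

lemma GrowthBound.mixedDeriv_eq_dessinForm {L : ℕ} {K ρ : ℝ} (hB : GrowthBound L K ρ) {g m : ℕ}
    (hL : 2 * g + m + 1 ≤ L) {t : Fin (m + 1) → ℂ}
    (ht : ∀ i, t i ∈ sheet (1 / (2 ^ (m + 1) * ρ))) :
    mixedDeriv (dessinLaplace g (m + 1)) t
      = dessinForm g (m + 1) t - if (g, m) = (0, 0) then recipLog (t 0) else 0 := by
  have hρ := hB.pos
  have hpow : (2 : ℝ) ≤ 2 ^ (m + 1) := by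
    rw [pow_succ]
    linarith [one_le_pow₀ (one_le_two (α := ℝ)) (n := m)]
  rw [hB.mixedDeriv_dessinLaplace hL ht, hB.dessinForm_eq_sheetForm hL fun i =>
    sheet_mono (one_div_le_one_div_of_le (by positivity)
      (mul_le_mul_of_nonneg_right hpow hρ.le)) (ht i)]

/-- A radius beyond which the Laplace transform of type `(g, m + 1)` is controlled. -/
lemma exists_radius (g m : ℕ) : ∃ R : ℝ, 0 < R ∧ ∀ t ∈ nearInfinity (m + 1) R,
    (∀ i, recip (t i) ≠ 0 ∧ t i ^ 2 + 1 ≠ 0) ∧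
    Summable (fun μ : Fin (m + 1) → ℕ+ =>
      (dessinCount g (m + 1) (fun i => (μ i : ℕ)) : ℂ) * laplaceWeight μ t) ∧
    mixedDeriv (dessinLaplace g (m + 1)) t
      = dessinForm g (m + 1) t - if (g, m) = (0, 0) then recipLog (t 0) else 0 := by
  obtain ⟨K, ρ, hB⟩ := exists_gluingCount_le (2 * g + m + 1)
  replace hB : GrowthBound (2 * g + m + 1) K ρ := hB
  have hρ := hB.pos
  have hR : 0 < 2 ^ (m + 1) * ρ := by positivity
  refine ⟨2 ^ (m + 1) * ρ, hR, fun t ht => ?_⟩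
  have hsheet := mem_sheet_of_mem_nearInfinity (one_div_pos.2 hR) (one_div_one_div _).le ht
  refine ⟨fun i => ⟨(hsheet i).2.1, sq_add_one_ne_zero (hsheet i).1⟩,
    hB.summable_dessinCount le_rfl fun i => sheet_mono (one_div_le_one_div_of_le hρ
      (le_mul_of_one_le_left hρ.le (one_le_pow₀ one_le_two))) (hsheet i),
    hB.mixedDeriv_eq_dessinForm le_rfl hsheet⟩

/-- The logarithmic derivative of `x` is minus that of `1 / x`. -/
lemma deriv_xOf_div {t : ℂ} (h : recip t ≠ 0) (h' : t ^ 2 + 1 ≠ 0) :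
    deriv xOf t / xOf t = -recipLog t := by
  have hsq := sq_sub_one_ne_zero h
  rw [deriv_xOf hsq, xOf_eq, recip, recipLog]
  field_simp
  ring

end DessinRecursion

open DessinRecursion

/-- The twisted differentials of the decorated dessin count satisfy the twisted Eynard-Orantin
topological recursion. Differentials are given by their coefficients with respect to
`dt_1 ⋯ dt_n`. -/
theorem theorem1 {K A ι : Type*} [Field K] [Algebra K ℂ] [CommRing A] [Algebra K A]
    [Fintype ι] [DecidableEq ι] (Fr : FrobeniusForm K A) (e : Module.Basis ι K A) :
    -- the kernel is the one of the spectral curve `x = z + 1 / z`, `y = - z`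
    (∀ (t t₁ : ℂ) (γ γ' : ℝ → ℂ), t ≠ 0 → t ≠ 1 → t ≠ -1 → γ 0 = t → γ 1 = -t →
      (∀ r ∈ Set.Icc (0 : ℝ) 1, γ r ≠ -t₁ ∧ HasDerivWithinAt γ (γ' r) (Set.Icc 0 1) r) →
      ContinuousOn γ' (Set.Icc 0 1) →
      (1 / 2 : ℂ) * (∫ r in (0 : ℝ)..1, w02 (γ r) t₁ * γ' r) / (-w01 (-t) - w01 t)
        = kernelD t t₁) ∧
    ∃ w : (g n : ℕ) → (Fin n → ℂ) → ℂ,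
      -- the unstable differentials
      (∀ t, w 0 1 t = w01 (t 0)) ∧
      (∀ t, w 0 2 t = w02 (t 0) (t 1)) ∧
      -- the stable differentials are meromorphic, with poles only at the ramification points
      (∀ g n : ℕ, 0 < n → 2 < 2 * g + n → IsEvenLaurent (w g n)) ∧
      -- they are the differentials `d_1 ⋯ d_n` of the Laplace transforms
      (∀ g n : ℕ, 0 < n → ∃ R : ℝ, 0 < R ∧ ∀ t ∈ nearInfinity n R,
        Summable (fun μ : Fin n → ℕ+ =>
          (dessinCount g n (fun i => (μ i : ℕ)) : ℂ) * laplaceWeight μ t) ∧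
        ((g, n) ≠ (0, 1) → w g n t = mixedDeriv (dessinLaplace g n) t ∧
          ∀ v : Fin n → A,
            twisted Fr e w g n t v = mixedDeriv (fun t' => twistedLaplace Fr e g n t' v) t)) ∧
      (∃ R : ℝ, 0 < R ∧ ∀ t ∈ nearInfinity 1 R,
        w 0 1 t + deriv xOf (t 0) / xOf (t 0) = mixedDeriv (dessinLaplace 0 1) t) ∧
      -- the twisted topological recursion
      ∀ (g m : ℕ), 2 < 2 * g + (m + 1) →
        ∀ (t : Fin (m + 1) → ℂ) (v : Fin (m + 1) → A) (ε : ℝ), 0 < ε →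
          (∀ i, ε < ‖t i‖ ∧ ‖t i‖ < 1 / ε) →
          twisted Fr e w g (m + 1) t v
            = (2 * Real.pi * Complex.I)⁻¹ *
              ((∮ s in C(0, ε), recursionIntegrand Fr e w g t v s)
                - ∮ s in C(0, 1 / ε), recursionIntegrand Fr e w g t v s) := by
  refine ⟨?_, dessinForm, dessinForm_zero_one, dessinForm_zero_two, ?_, ?_, ?_, ?_⟩
  · intro t t₁ γ γ' h0 h1 h2 hγ0 hγ1 hγ hγ'
    have h3 := (hγ 0 (Set.left_mem_Icc.2 zero_le_one)).1
    have h4 := (hγ 1 (Set.right_mem_Icc.2 zero_le_one)).1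
    rw [integral_w02 hγ hγ', hγ0, hγ1]
    rw [hγ0] at h3
    rw [hγ1] at h4
    exact kernelD_eq_div h0 h1 h2 (fun h => h3 (eq_neg_of_add_eq_zero_left h))
      fun h => h4 (eq_neg_of_add_eq_zero_left h)
  · intro g n hn hst
    obtain ⟨m, rfl⟩ := Nat.exists_eq_succ_of_ne_zero hn.ne'
    exact (evaluatesTo_dessinForm hst).1.isEvenLaurent
  · intro g n hn
    obtain ⟨m, rfl⟩ := Nat.exists_eq_succ_of_ne_zero hn.ne'
    obtain ⟨R, hR, h⟩ := exists_radius g m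
    refine ⟨R, hR, fun t ht => ⟨(h t ht).2.1, fun hgn => ?_⟩⟩
    have hw : dessinForm g (m + 1) t = mixedDeriv (dessinLaplace g (m + 1)) t := by
      rw [(h t ht).2.2, if_neg fun hgm => hgn (by
        obtain ⟨rfl, rfl⟩ := Prod.mk.inj hgm
        rfl), sub_zero]
    refine ⟨hw, fun v => ?_⟩
    simp only [twistedLaplace_eq]
    rw [mixedDeriv_const_mul, twisted_apply, mul_comm]
    exact congrArg _ hw
  · obtain ⟨R, hR, h⟩ := exists_radius 0 0
    refine ⟨R, hR, fun t ht => ?_⟩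
    obtain ⟨h1, -, h2⟩ := h t ht
    rw [h2, if_pos rfl, deriv_xOf_div (h1 0).1 (h1 0).2, sub_eq_add_neg]
  · intro g m hst t v ε hε ht
    simp only [recursionIntegrand_eq, circleIntegral.integral_const_mul]
    rw [twisted_apply, ← (((evaluatesTo_dessinForm hst).2 t).1 ε hε ht).eq]
    ring
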